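/- **Setting.** The $N$-vortex problem on the unit sphere $S^2\subset\mathbb R^3$ with identical vortices is the system $$\dot v_j=\sum_{i\ne j}\frac{v_i\times v_j}{|v_j-v_i|^2},\qquad j=1,\dots,N,\tag{1}$$ for $v=(v_1,\dots,v_N)\in (S^2)^N$ away from collisions (configurations with $v_i=v_j$ for some $i\neq j$). Its energy is $H(v)=-\frac12\sum_{i<j}\ln|v_j-v_i|^2$. Let $K<\mathrm{SO}(3)$ be one of the groups $\mathbb D_n$ ($n\ge 2$), $\mathbb T$, $\mathbb O$, $\mathbb I$ (in any position in space), let $K_u=\{g\in K: gu=u\}$, and let $\mathcal F[K]=\{u\in S^2: K_u\ne\{e\}\}$. Let $F\subset\mathcal F[K]$ be a $K$-invariant set, $m=|K|$, $N=m+|F|$. Let $(g_1=e,g_2,\dots,g_m)$ and $(f_{m+1},\dots,f_N)$ be orderings of $K$ and of $F$, and put $$\rho(u)=(u,g_2u,\dots,g_mu,f_{m+1},\dots,f_N),\qquad h_{(K,F)}(u)=H(\rho(u)).$$ The reduced system is $\dot u=-\frac1m\,u\times\nabla_u h_{(K,F)}(u)$ on $S^2\setminus\mathcal F[K]$. **Statement.**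 (i) Let $u_0\in S^2\setminus\mathcal F[K]$ be a local minimum or a local maximum of $h_{(K,F)}$ on $S^2\setminus\mathcal F[K]$, and let $h_0=h_{(K,F)}(u_0)$. Then $\rho(u_0)$ is a (collision-free) equilibrium of (1), and there are $\varepsilon>0$ and a one-parameter family $(u_h)_{h\in I}$ of non-constant periodic solutions of the reduced system, where $I=(h_0,h_0+\varepsilon)$ for a minimum and $I=(h_0-\varepsilon,h_0)$ for a maximum, such that $v_h(t)=\rho(u_h(t))$ is for each $h\in I$ a periodic collision-free solution of (1) with the same least period as $u_h$. The family is parametrised by the energy, $H(v_h(t))=h$ for all $t$; it is continuous, that is, $u_h(t)$ depends continuously on $(h,t)\in I\times\mathbb R$; it emanates from the equilibrium, that is, $v_h(t)\to\rho(u_0)$ and $u_h(t)\to u_0$ uniformly in $t$ as $h\to h_0$; and the orbits surround $u_0$, that is, the union of the orbits of the $u_h$, $h\in I$, is $U\setminus\{u_0\}$ for some neighbourhood $U$ of $u_0$ that is open in $S^2$. (ii) Let $u_0\in\mathcal F[K]$. Then $\rho(u_0)$ is a collision configuration. Its only collisions occur at the points of the orbit $Ku_0$, and at each of these points exactly $k$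 vortices collide, where $k=|K_{u_0}|$ if $u_0\notin F$ and $k=|K_{u_0}|+1$ if $u_0\in F$. Moreover there are $e_0\in\mathbb R$ and a family $(u_h)_{h\in(e_0,\infty)}$ of non-constant periodic solutions of the reduced system such that $v_h(t)=\rho(u_h(t))$ is for each $h>e_0$ a periodic collision-free solution of (1) with the same least period $T_h$ as $u_h$. The family is continuous in $(h,t)$ and parametrised by the energy, $H(v_h(t))=h$ for all $t$; as $h\to\infty$, $v_h(t)\to\rho(u_0)$ and $u_h(t)\to u_0$ uniformly in $t$, and $T_h\to0$; and the union of the orbits of the $u_h$ is $U\setminus\{u_0\}$ for some neighbourhood $U$ of $u_0$ that is open in $S^2$. -/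

import Mathlib

open Set Filter Topology

noncomputable section

namespace VortexSphere

/-- Euclidean three-space. -/
abbrev E3 : Type := EuclideanSpace ℝ (Fin 3)

/-- The unit sphere in Euclidean three-space. -/
abbrev S2 : Set E3 := Metric.sphere (0 : E3) 1

/-- The rotation group `SO(3)`. -/
abbrev SO3 : Type := Matrix.specialOrthogonalGroup (Fin 3) ℝ

/-- The rotation `a` applied to the vector `x`. -/
def rot (a : SO3) (x : E3) : E3 := Matrix.toEuclideanLin (a : Matrix (Fin 3) (Fin 3) ℝ) x

/-- The vector product. -/
def cross (x y : E3) : E3 := WithLp.toLp 2 (crossProduct x.ofLp y.ofLp)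

/-! ### The `N`-vortex problem on the sphere (identical vortices) -/

/-- The phase space `S² × ⋯ × S²`. -/
def phaseSpace (N : ℕ) : Set (Fin N → E3) := {v | ∀ j, v j ∈ S2}

/-- Configurations in which at least two vortices occupy the same position. -/
def collisionSet (N : ℕ) : Set (Fin N → E3) :=
  {v | v ∈ phaseSpace N ∧ ∃ i j, i ≠ j ∧ v i = v j}

/-- The energy `H(v) = -(1/2) ∑_{i<j} ln |v_j - v_i|²`. -/
def energy {N : ℕ} (v : Fin N → E3) : ℝ :=
  -(1 / 2) * ∑ i : Fin N, ∑ j ∈ Finset.Ioi i, Real.log (‖v j - v i‖ ^ 2)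

/-- The `j`-th component of the right-hand side of the equations of motion,
`∑_{i ≠ j} (v_i × v_j) / |v_j - v_i|²`. -/
def vortexField {N : ℕ} (v : Fin N → E3) (j : Fin N) : E3 :=
  ∑ i ∈ Finset.univ.erase j, (1 / ‖v j - v i‖ ^ 2) • cross (v i) (v j)

/-- A (global, collision-free) solution of the equations of motion. -/
def IsVortexSolution {N : ℕ} (v : ℝ → Fin N → E3) : Prop :=
  ∀ t, v t ∈ phaseSpace N \ collisionSet N ∧
    ∀ j, HasDerivAt (fun s => v s j) (vortexField (v t) j) t

/-- A (collision-free) equilibrium of the equations of motion. -/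
def IsVortexEquilibrium {N : ℕ} (v : Fin N → E3) : Prop :=
  v ∈ phaseSpace N \ collisionSet N ∧ ∀ j, vortexField v j = 0

/-! ### The rotation groups -/

/-- Rotation by the angle `θ` about the third coordinate axis. -/
def rotZ (θ : ℝ) : SO3 :=
  ⟨!![Real.cos θ, -Real.sin θ, 0; Real.sin θ, Real.cos θ, 0; 0, 0, 1], by
    rw [Matrix.mem_specialOrthogonalGroup_iff, Matrix.mem_orthogonalGroup_iff]
    have h := Real.sin_sq_add_cos_sq θ
    constructor
    · ext i j
      fin_cases i <;> fin_cases j <;>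
        simp [Matrix.mul_apply, Fin.sum_univ_three] <;> nlinarith
    · simp [Matrix.det_fin_three]; nlinarith⟩

/-- The half-turn about the first coordinate axis. -/
def halfTurnX : SO3 :=
  ⟨!![1, 0, 0; 0, -1, 0; 0, 0, -1], by
    rw [Matrix.mem_specialOrthogonalGroup_iff, Matrix.mem_orthogonalGroup_iff]
    constructor
    · ext i j
      fin_cases i <;> fin_cases j <;>
        simp [Matrix.mul_apply, Fin.sum_univ_three]
    · simp [Matrix.det_fin_three]⟩

/-- The rotation of order three permuting the coordinates cyclically. -/
def cyclicPerm : SO3 :=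
  ⟨!![0, 1, 0; 0, 0, 1; 1, 0, 0], by
    rw [Matrix.mem_specialOrthogonalGroup_iff, Matrix.mem_orthogonalGroup_iff]
    constructor
    · ext i j
      fin_cases i <;> fin_cases j <;>
        simp [Matrix.mul_apply, Fin.sum_univ_three]
    · simp [Matrix.det_fin_three]⟩

theorem rot_one (x : E3) : rot 1 x = x := by
  simp [rot]

theorem rot_mul (a b : SO3) (x : E3) : rot (a * b) x = rot a (rot b x) := by
  simp [rot, Matrix.toLpLin_apply, Matrix.mulVec_mulVec]

/-- The group of orientation-preserving (linear) symmetries of a set of points. -/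
def rotationGroup (V : Set E3) : Subgroup SO3 where
  carrier := {a | rot a '' V = V}
  one_mem' := by
    have : rot 1 = id := funext rot_one
    simp [this]
  mul_mem' := by
    intro a b ha hb
    have : rot (a * b) = rot a ∘ rot b := funext (rot_mul a b)
    simp only [mem_ofPred_eq] at ha hb ⊢
    rw [this, image_comp, hb, ha]
  inv_mem' := by
    intro a ha
    simp only [mem_ofPred_eq] at ha ⊢
    have : rot a⁻¹ ∘ rot a = id := by
      funext x
      simp [← rot_mul, rot_one]
    conv_lhs => rw [← ha]
    rw [← image_comp, this, image_id]

/-- The dihedral group `𝔻_n < SO(3)`, of order `2 n`. -/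
def dihedral (n : ℕ) : Subgroup SO3 :=
  Subgroup.closure {rotZ (2 * Real.pi / n), halfTurnX}

/-- The tetrahedral group `𝕋 < SO(3)`, of order `12`. -/
def tetrahedral : Subgroup SO3 := Subgroup.closure {cyclicPerm, halfTurnX}

/-- The vertices `(±1, 0, 0)`, `(0, ±1, 0)`, `(0, 0, ±1)` of an octahedron. -/
def octahedronVertices : Set E3 :=
  {x | ∃ s : ℝ, s ^ 2 = 1 ∧ (x = !₂[s, 0, 0] ∨ x = !₂[0, s, 0] ∨ x = !₂[0, 0, s])}

/-- The octahedral group `𝕆 < SO(3)`, of order `24`. -/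
def octahedral : Subgroup SO3 := rotationGroup octahedronVertices

/-- The cyclic permutations of `(0, ±1, ±φ)`, `φ` the golden ratio: the vertices of a regular
icosahedron. -/
def icosahedronVertices : Set E3 :=
  {x | ∃ s t : ℝ, s ^ 2 = 1 ∧ t ^ 2 = 1 ∧
    (x = !₂[0, s, t * Real.goldenRatio] ∨ x = !₂[s, t * Real.goldenRatio, 0] ∨
      x = !₂[t * Real.goldenRatio, 0, s])}

/-- The icosahedral group `𝕀 < SO(3)`, of order `60`. -/
def icosahedral : Subgroup SO3 := rotationGroup icosahedronVertices

/-- `K` is one of the groups `𝔻_n` (`n ≥ 2`), `𝕋`, `𝕆`, `𝕀`, in any position, that is, up to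
conjugation in `SO(3)`. -/
def IsDihedralOrPolyhedral (K : Subgroup SO3) : Prop :=
  ∃ (R : SO3) (G : Subgroup SO3),
    ((∃ n : ℕ, 2 ≤ n ∧ G = dihedral n) ∨ G = tetrahedral ∨ G = octahedral ∨ G = icosahedral) ∧
      K = G.map (MulAut.conj R).toMonoidHom

/-- The isotropy group `K_u`, as a set of rotations. -/
def isotropy (K : Subgroup SO3) (u : E3) : Set SO3 := {a | a ∈ K ∧ rot a u = u}

/-- The orbit `K u`. -/
def orbit (K : Subgroup SO3) (u : E3) : Set E3 := {x | ∃ a ∈ K, x = rot a u}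

/-- The set `𝓕[K]` of points of the sphere with non-trivial isotropy. -/
def nonFreePoints (K : Subgroup SO3) : Set E3 := {u | u ∈ S2 ∧ isotropy K u ≠ {1}}

/-! ### Symmetric configurations and the reduced system

Here `g : Fin m → SO3` is an ordering of the group and `f : Fin k → E3` an ordering of the set of
fixed vortices, so that there are `N = m + k` vortices. -/

/-- The map `ρ(u) = (g_1 u, …, g_m u, f_{m+1}, …, f_N)`. -/
def rho {m k : ℕ} (g : Fin m → SO3) (f : Fin k → E3) (u : E3) : Fin (m + k) → E3 :=
  Fin.append (fun j => rot (g j) u) f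

/-- The reduced Hamiltonian `h(u) = H(ρ(u))`. The formula makes sense on the ambient space, and it
is only used at and near points of the sphere. -/
def reducedHamiltonian {m k : ℕ} (g : Fin m → SO3) (f : Fin k → E3) (u : E3) : ℝ :=
  energy (rho g f u)

/-- A (global, collision-free) solution of the reduced system `u' = -(1/m) u × ∇h(u)` on
`S² \ 𝓕[K]`. Only the tangential part of the gradient contributes to the vector product. -/
def IsReducedSolution (K : Subgroup SO3) {m k : ℕ} (g : Fin m → SO3) (f : Fin k → E3)
    (u : ℝ → E3) : Prop :=
  ∀ t, u t ∈ S2 \ nonFreePoints K ∧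
    HasDerivAt u (-(1 / (m : ℝ)) • cross (u t) (gradient (reducedHamiltonian g f) (u t))) t

/-- `w` is a non-constant periodic function whose least period is `T`. -/
def HasLeastPeriod {α : Type*} (w : ℝ → α) (T : ℝ) : Prop :=
  IsLeast {τ : ℝ | 0 < τ ∧ ∀ t, w (t + τ) = w t} T

/-- `u e` (`e ∈ I`) is a one-parameter family of periodic solutions of the reduced system, giving
rise to the family `ρ ∘ u e` of periodic solutions of the equations of motion with least period
`T e`. It is parametrised by the energy `e`, it depends continuously on `e`, it converges to `u₀`
as `e` tends to its limit along the filter `l`, and its orbits surround `u₀`: they fill a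
punctured neighbourhood of `u₀` in the sphere. -/
structure IsPeriodicFamily (K : Subgroup SO3) {m k : ℕ} (g : Fin m → SO3) (f : Fin k → E3)
    (u₀ : E3) (I : Set ℝ) (l : Filter ℝ) (u : ℝ → ℝ → E3) (T : ℝ → ℝ) : Prop where
  reduced_solution : ∀ e ∈ I, IsReducedSolution K g f (u e)
  solution : ∀ e ∈ I, IsVortexSolution (fun t => rho g f (u e t))
  reduced_period : ∀ e ∈ I, HasLeastPeriod (u e) (T e)
  period : ∀ e ∈ I, HasLeastPeriod (fun t => rho g f (u e t)) (T e)
  energy_eq : ∀ e ∈ I, ∀ t, energy (rho g f (u e t)) = e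
  continuous : ContinuousOn (fun p : ℝ × ℝ => u p.1 p.2) (I ×ˢ univ)
  reduced_tendsto : TendstoUniformly u (fun _ => u₀) l
  tendsto : TendstoUniformly (fun e t => rho g f (u e t)) (fun _ => rho g f u₀) l
  surround : ∃ U : Set E3, IsOpen U ∧ u₀ ∈ U ∧ (U ∩ S2) \ {u₀} = ⋃ e ∈ I, range (u e)

/-- The configuration `ρ(u₀)` is a collision configuration whose only collisions take place at the
points of the orbit `K u₀`; at each of these points exactly `|K_{u₀}|` vortices collide if
`u₀ ∉ F`, and exactly `|K_{u₀}| + 1` if `u₀ ∈ F`. -/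
structure IsSymmetricCollision (K : Subgroup SO3) (F : Set E3) {m k : ℕ} (g : Fin m → SO3)
    (f : Fin k → E3) (u₀ : E3) : Prop where
  mem_collisionSet : rho g f u₀ ∈ collisionSet (m + k)
  off_orbit : ∀ x, x ∉ orbit K u₀ → {i | rho g f u₀ i = x}.ncard ≤ 1
  two_le : 2 ≤ (isotropy K u₀).ncard
  of_notMem : u₀ ∉ F → ∀ x ∈ orbit K u₀, {i | rho g f u₀ i = x}.ncard = (isotropy K u₀).ncard
  of_mem : u₀ ∈ F → ∀ x ∈ orbit K u₀,
    {i | rho g f u₀ i = x}.ncard = (isotropy K u₀).ncard + 1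

end VortexSphere

end

open VortexSphere

/-!
The reduced Hamiltonian is a logarithmic potential. For a rotation `a ≠ 1` with fixed points `± p`
on the sphere, `|u - a u|²` is a constant multiple of `|u - p|² |u + p|²`, so the mutual
interaction of the images of `u` is an interaction of `u` with the points of `𝓕[K]`, and up to a
constant `h(u) = -∑ w_p log |u - p|²` with positive weights and all points `p` of `𝓕[K]` as poles
(`IsOrdering.exists_reducedHamiltonian_eq`). By equivariance the reduced field is the velocity of
the vortex at `u`; the images of `u` move along with it, and the vortices in `F` rest, because a
tangent vector at a point of `𝓕[K]` that is fixed by a rotation about that point is zero. Hence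
solutions and zeros of the reduced field give solutions and equilibria of the vortex problem
(`IsOrdering.isVortexSolution`, `IsOrdering.isVortexEquilibrium`).

In stereographic coordinates around `u₀` the reduced system is Hamiltonian in the plane, up to a
density of constant sign, with the potential `pot`: logarithmic poles and a term `W log (1 +
|x|²)` (`IsPotentialChart`). If the level sets near `u₀` are star-shaped, they are closed curves
that the flow traverses; in polar coordinates they are graphs over the angle, and the angle solves
a scalar equation. This gives the family, its continuity and its least periods without any flow
(`exists_planar_family`).

At a point of `𝓕[K]` the potential has a pole, the level sets of high energy are star-shaped, and
the angular speed at distance `r` is of order `1 / r²`, so the periods tend to zero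
(`exists_planarFamily_pole`).

A local minimum `u₀` in the complement of `𝓕[K]` may be degenerate. Two facts replace
non-degeneracy. The potential is strictly subharmonic, so after a rotation of the coordinates its
second derivative in the real direction is positive. Moreover critical points are isolated: they
satisfy `conj x = r x` for a rational function `r`, and if they accumulated, `x = conj r (r x)`
would hold identically, which fails since `K` has at least two axes and `r` therefore a second
zero (`eventually_potGrad_ne_zero`). By the first fact, the points at which the derivative in the
real direction vanishes form a curve, and a shear straightens it into an axis. By the second, the
potential increases strictly along that axis away from `u₀`. Together they make the level sets
star-shaped (`exists_shear`), and since shears preserve the area, the system stays Hamiltonian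
(`exists_planarFamily_min`).

Subharmonicity also shows that `h` has no local maximum in the complement of `𝓕[K]`
(`IsOrdering.not_isLocalMaxOn`), so the assertion about maxima concerns no point at all.
-/

namespace VortexSphere

/-! ### Vector algebra in three-space and rotations -/

theorem inner_eq_sum (x y : E3) : inner ℝ x y = x 0 * y 0 + x 1 * y 1 + x 2 * y 2 := by
  simp [PiLp.inner_apply, Fin.sum_univ_three, mul_comm]

theorem cross_apply_zero (x y : E3) : cross x y 0 = x 1 * y 2 - x 2 * y 1 := by
  simp [cross, cross_apply]

theorem cross_apply_one (x y : E3) : cross x y 1 = x 2 * y 0 - x 0 * y 2 := by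
  simp [cross, cross_apply]

theorem cross_apply_two (x y : E3) : cross x y 2 = x 0 * y 1 - x 1 * y 0 := by
  simp [cross, cross_apply]

theorem ext_three {x y : E3} (h0 : x 0 = y 0) (h1 : x 1 = y 1) (h2 : x 2 = y 2) : x = y := by
  ext i
  fin_cases i
  · exact h0
  · exact h1
  · exact h2

theorem cross_add_left (x y z : E3) : cross (x + y) z = cross x z + cross y z := by
  apply ext_three <;> simp [cross_apply_zero, cross_apply_one, cross_apply_two] <;> ring

theorem cross_add_right (x y z : E3) : cross x (y + z) = cross x y + cross x z := by
  apply ext_three <;> simp [cross_apply_zero, cross_apply_one, cross_apply_two] <;> ring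

theorem cross_smul_left (c : ℝ) (x y : E3) : cross (c • x) y = c • cross x y := by
  apply ext_three <;> simp [cross_apply_zero, cross_apply_one, cross_apply_two] <;> ring

theorem cross_smul_right (c : ℝ) (x y : E3) : cross x (c • y) = c • cross x y := by
  apply ext_three <;> simp [cross_apply_zero, cross_apply_one, cross_apply_two] <;> ring

theorem cross_self_eq (x : E3) : cross x x = 0 := by
  apply ext_three <;> simp [cross_apply_zero, cross_apply_one, cross_apply_two] <;> ring

theorem cross_swap (x y : E3) : cross x y = -cross y x := by
  apply ext_three <;> simp [cross_apply_zero, cross_apply_one, cross_apply_two] <;> ring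

theorem cross_sub_right (x y z : E3) : cross x (y - z) = cross x y - cross x z := by
  apply ext_three <;> simp [cross_apply_zero, cross_apply_one, cross_apply_two] <;> ring

theorem cross_cross_eq (x y z : E3) :
    cross x (cross y z) = inner ℝ x z • y - inner ℝ x y • z := by
  apply ext_three <;>
    simp [cross_apply_zero, cross_apply_one, cross_apply_two, inner_eq_sum] <;> ring

theorem inner_cross_self_left (x y : E3) : inner ℝ x (cross x y) = 0 := by
  simp only [inner_eq_sum, cross_apply_zero, cross_apply_one, cross_apply_two]; ring

theorem inner_cross_self_right (x y : E3) : inner ℝ y (cross x y) = 0 := by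
  simp only [inner_eq_sum, cross_apply_zero, cross_apply_one, cross_apply_two]; ring

theorem inner_cross_rotate (x y z : E3) : inner ℝ (cross x y) z = inner ℝ y (cross z x) := by
  simp only [inner_eq_sum, cross_apply_zero, cross_apply_one, cross_apply_two]; ring

theorem inner_cross_cross (x y z w : E3) :
    inner ℝ (cross x y) (cross z w) =
      inner ℝ x z * inner ℝ y w - inner ℝ x w * inner ℝ y z := by
  simp only [inner_eq_sum, cross_apply_zero, cross_apply_one, cross_apply_two]; ring

theorem inner_self_sphere {u : E3} (hu : u ∈ S2) : inner ℝ u u = (1 : ℝ) := by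
  rw [real_inner_self_eq_norm_sq, mem_sphere_zero_iff_norm.1 hu, one_pow]

theorem ne_neg_of_mem_S2 {u : E3} (hu : u ∈ S2) : u ≠ -u := fun h =>
  ne_neg_of_mem_unit_sphere ℝ (⟨u, hu⟩ : S2) (Subtype.ext h)

theorem rot_add (a : SO3) (x y : E3) : rot a (x + y) = rot a x + rot a y := map_add _ _ _

theorem rot_sub (a : SO3) (x y : E3) : rot a (x - y) = rot a x - rot a y := map_sub _ _ _

theorem rot_neg (a : SO3) (x : E3) : rot a (-x) = -rot a x := map_neg _ _

theorem rot_smul (a : SO3) (c : ℝ) (x : E3) : rot a (c • x) = c • rot a x := map_smul _ _ _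

theorem rot_sum {ι : Type*} (a : SO3) (s : Finset ι) (x : ι → E3) :
    rot a (∑ i ∈ s, x i) = ∑ i ∈ s, rot a (x i) := map_sum _ _ _

theorem rot_inv_rot (a : SO3) (x : E3) : rot a⁻¹ (rot a x) = x := by
  rw [← rot_mul, inv_mul_cancel, rot_one]

theorem rot_rot_inv (a : SO3) (x : E3) : rot a (rot a⁻¹ x) = x := by
  rw [← rot_mul, mul_inv_cancel, rot_one]

theorem rot_injective (a : SO3) : Function.Injective (rot a) :=
  Function.LeftInverse.injective (rot_inv_rot a)

theorem rot_ext {a b : SO3} (h : ∀ x, rot a x = rot b x) : a = b := by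
  apply Subtype.ext
  have : Matrix.toEuclideanLin (a : Matrix (Fin 3) (Fin 3) ℝ) =
      Matrix.toEuclideanLin (b : Matrix (Fin 3) (Fin 3) ℝ) := LinearMap.ext h
  exact Matrix.toEuclideanLin.injective this

theorem rot_apply (a : SO3) (x : E3) (i : Fin 3) :
    rot a x i = a.1 i 0 * x 0 + a.1 i 1 * x 1 + a.1 i 2 * x 2 := by
  simp [rot, Matrix.toLpLin_apply, Matrix.mulVec, dotProduct, Fin.sum_univ_three]

theorem SO3_mul_transpose (a : SO3) : (a : Matrix (Fin 3) (Fin 3) ℝ) * (a.1).transpose = 1 := by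
  have h := a.2
  rw [Matrix.mem_specialOrthogonalGroup_iff, Matrix.mem_orthogonalGroup_iff] at h
  exact h.1

theorem SO3_det (a : SO3) : (a : Matrix (Fin 3) (Fin 3) ℝ).det = 1 := by
  have h := a.2
  rw [Matrix.mem_specialOrthogonalGroup_iff] at h
  exact h.2

theorem SO3_adjugate (a : SO3) : (a.1).adjugate = (a.1).transpose := by
  have h : (a.1).adjugate * (a.1 * (a.1).transpose) = (a.1).transpose := by
    rw [← mul_assoc, Matrix.adjugate_mul, SO3_det, one_smul, one_mul]
  rwa [SO3_mul_transpose, mul_one] at h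

/-- Rotations have determinant one, so they commute with the vector product. -/
theorem rot_cross (a : SO3) (x y : E3) : rot a (cross x y) = cross (rot a x) (rot a y) := by
  have h := SO3_adjugate a
  rw [Matrix.adjugate_fin_three] at h
  have e (i j : Fin 3) := congrFun (congrFun h i) j
  have e00 := e 0 0
  have e01 := e 0 1
  have e02 := e 0 2
  have e10 := e 1 0
  have e11 := e 1 1
  have e12 := e 1 2
  have e20 := e 2 0
  have e21 := e 2 1
  have e22 := e 2 2
  simp only [Matrix.of_apply, Matrix.cons_val,
    Matrix.transpose_apply] at e00 e01 e02 e10 e11 e12 e20 e21 e22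
  apply ext_three <;>
    simp only [cross_apply_zero, cross_apply_one, cross_apply_two, rot_apply]
  · linear_combination -(x 1 * y 2 - x 2 * y 1) * e00 - (x 2 * y 0 - x 0 * y 2) * e10 -
      (x 0 * y 1 - x 1 * y 0) * e20
  · linear_combination -(x 1 * y 2 - x 2 * y 1) * e01 - (x 2 * y 0 - x 0 * y 2) * e11 -
      (x 0 * y 1 - x 1 * y 0) * e21
  · linear_combination -(x 1 * y 2 - x 2 * y 1) * e02 - (x 2 * y 0 - x 0 * y 2) * e12 -
      (x 0 * y 1 - x 1 * y 0) * e22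

theorem inner_rot_rot (a : SO3) (x y : E3) : inner ℝ (rot a x) (rot a y) = inner ℝ x y := by
  have h : (a.1).transpose * a.1 = 1 := mul_eq_one_comm.1 (SO3_mul_transpose a)
  have e (i j : Fin 3) := congrFun (congrFun h i) j
  simp only [Matrix.mul_apply, Fin.sum_univ_three, Matrix.transpose_apply] at e
  have e00 := e 0 0
  have e01 := e 0 1
  have e02 := e 0 2
  have e11 := e 1 1
  have e12 := e 1 2
  have e22 := e 2 2
  simp at e00 e01 e02 e11 e12 e22
  simp only [inner_eq_sum, rot_apply]
  linear_combination (x 0 * y 0) * e00 + (x 0 * y 1 + x 1 * y 0) * e01 +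
    (x 0 * y 2 + x 2 * y 0) * e02 + (x 1 * y 1) * e11 + (x 1 * y 2 + x 2 * y 1) * e12 +
    (x 2 * y 2) * e22

theorem norm_rot (a : SO3) (x : E3) : ‖rot a x‖ = ‖x‖ := by
  have := inner_rot_rot a x x
  rw [real_inner_self_eq_norm_sq, real_inner_self_eq_norm_sq] at this
  exact (sq_eq_sq₀ (norm_nonneg _) (norm_nonneg _)).1 this

theorem rot_mem_sphere (a : SO3) {x : E3} (hx : x ∈ S2) : rot a x ∈ S2 := by
  rw [mem_sphere_zero_iff_norm] at *
  rw [norm_rot, hx]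

/-- Every rotation has an axis: `det (a - 1) = 0` because the dimension is odd. -/
theorem exists_axis (a : SO3) : ∃ p ∈ S2, rot a p = p := by
  have h1 : (a.1 - 1).det = 0 := by
    have h : a.1 - 1 = a.1 * (1 - a.1).transpose := by
      rw [Matrix.transpose_sub, Matrix.transpose_one, mul_sub, SO3_mul_transpose, mul_one]
    have h2 : (a.1 - 1).det = (1 - a.1).det := by
      conv_lhs => rw [h]
      rw [Matrix.det_mul, SO3_det, Matrix.det_transpose, one_mul]
    have h3 : (1 - a.1).det = -(a.1 - 1).det := by
      rw [← neg_sub, Matrix.det_neg, Fintype.card_fin]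
      ring
    linarith
  obtain ⟨v, hv0, hv⟩ := Matrix.exists_mulVec_eq_zero_iff.2 h1
  have hw0 : WithLp.toLp 2 v ≠ (0 : E3) := by simpa using hv0
  have hw : rot a (WithLp.toLp 2 v) = WithLp.toLp 2 v := by
    have : a.1.mulVec v = v := by
      rw [Matrix.sub_mulVec, Matrix.one_mulVec, sub_eq_zero] at hv
      exact hv
    simp [rot, Matrix.toLpLin_apply, this]
  refine ⟨‖WithLp.toLp 2 v‖⁻¹ • WithLp.toLp 2 v, ?_, ?_⟩
  · rw [mem_sphere_zero_iff_norm, norm_smul, norm_inv, norm_norm,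
      inv_mul_cancel₀ (norm_ne_zero_iff.2 hw0)]
  · rw [rot_smul, hw]

/-- An orthonormal frame `(e₁, e₂, u)` of orientation `o = ± 1`. -/
structure IsFrame (u e₁ e₂ : E3) (o : ℝ) : Prop where
  mem : u ∈ S2
  mem_fst : e₁ ∈ S2
  mem_snd : e₂ ∈ S2
  inner_fst : inner ℝ e₁ u = (0 : ℝ)
  inner_snd : inner ℝ e₂ u = (0 : ℝ)
  inner_fst_snd : inner ℝ e₁ e₂ = (0 : ℝ)
  cross_eq : cross e₁ e₂ = o • u
  sq_eq : o ^ 2 = 1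

namespace IsFrame

variable {u e₁ e₂ : E3} {o : ℝ}

theorem cross_fst (h : IsFrame u e₁ e₂ o) : cross u e₁ = o • e₂ := by
  have h1 := cross_cross_eq e₁ e₁ e₂
  rw [h.inner_fst_snd, inner_self_sphere h.mem_fst, h.cross_eq, cross_smul_right, cross_swap] at h1
  have h2 : e₂ = o • cross u e₁ := by
    rw [zero_smul, one_smul, zero_sub, smul_neg, neg_inj] at h1
    exact h1.symm
  have h3 := congrArg (fun x => o • x) h2
  simp only [smul_smul, ← pow_two, h.sq_eq, one_smul] at h3
  exact h3.symm

theorem cross_snd (h : IsFrame u e₁ e₂ o) : cross e₂ u = o • e₁ := by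
  have h1 := cross_cross_eq e₂ e₁ e₂
  rw [real_inner_comm e₁ e₂, h.inner_fst_snd, inner_self_sphere h.mem_snd, h.cross_eq,
    cross_smul_right] at h1
  have h2 : e₁ = o • cross e₂ u := by
    rw [zero_smul, one_smul, sub_zero] at h1
    exact h1.symm
  have h3 := congrArg (fun x => o • x) h2
  simp only [smul_smul, ← pow_two, h.sq_eq, one_smul] at h3
  exact h3.symm

theorem expand (h : IsFrame u e₁ e₂ o) (x : E3) :
    x = inner ℝ x e₁ • e₁ + inner ℝ x e₂ • e₂ + inner ℝ x u • u := by
  have h1 := cross_cross_eq u x u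
  have h2 := cross_cross_eq x e₁ e₂
  have h3 : o • cross x u = inner ℝ x e₂ • e₁ - inner ℝ x e₁ • e₂ := by
    rw [← h2, h.cross_eq, cross_smul_right]
  have h4 : cross x u = o • (inner ℝ x e₂ • e₁ - inner ℝ x e₁ • e₂) := by
    rw [← h3, smul_smul, ← pow_two, h.sq_eq, one_smul]
  have h5 : cross u e₂ = -(o • e₁) := by rw [cross_swap, h.cross_snd]
  rw [h4, cross_smul_right, cross_sub_right, cross_smul_right, cross_smul_right, h.cross_fst, h5,
    inner_self_sphere h.mem, one_smul, real_inner_comm x u] at h1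
  have h6 : x = o • (inner ℝ x e₂ • o • e₂ - inner ℝ x e₁ • -(o • e₁)) + inner ℝ x u • u := by
    rw [h1]; abel
  have h7 : o • (inner ℝ x e₂ • o • e₂ - inner ℝ x e₁ • -(o • e₁)) =
      (o ^ 2) • (inner ℝ x e₁ • e₁ + inner ℝ x e₂ • e₂) := by module
  rw [h7, h.sq_eq, one_smul] at h6
  exact h6

theorem rotate (h : IsFrame u e₁ e₂ o) : IsFrame u e₂ (-e₁) o where
  mem := h.mem
  mem_fst := h.mem_snd
  mem_snd := by simpa using h.mem_fst
  inner_fst := h.inner_snd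
  inner_snd := by rw [inner_neg_left, h.inner_fst, neg_zero]
  inner_fst_snd := by rw [inner_neg_right, real_inner_comm, h.inner_fst_snd, neg_zero]
  cross_eq := by rw [← neg_one_smul ℝ e₁, cross_smul_right, neg_one_smul, ← cross_swap, h.cross_eq]
  sq_eq := h.sq_eq

theorem swap (h : IsFrame u e₁ e₂ o) : IsFrame u e₂ e₁ (-o) where
  mem := h.mem
  mem_fst := h.mem_snd
  mem_snd := h.mem_fst
  inner_fst := h.inner_snd
  inner_snd := h.inner_fst
  inner_fst_snd := by rw [real_inner_comm, h.inner_fst_snd]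
  cross_eq := by rw [cross_swap, h.cross_eq, neg_smul]
  sq_eq := by rw [neg_sq, h.sq_eq]

theorem inner_lin (h : IsFrame u e₁ e₂ o) (a b c a' b' c' : ℝ) :
    inner ℝ (a • e₁ + b • e₂ + c • u) (a' • e₁ + b' • e₂ + c' • u) = a * a' + b * b' + c * c' := by
  simp only [inner_add_left, inner_add_right, inner_smul_left, inner_smul_right,
    inner_self_sphere h.mem, inner_self_sphere h.mem_fst, inner_self_sphere h.mem_snd, h.inner_fst,
    h.inner_snd, h.inner_fst_snd, real_inner_comm e₁ e₂, real_inner_comm e₁ u, real_inner_comm e₂ u]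
  simp
  ring

theorem cross_lin (h : IsFrame u e₁ e₂ o) (a b c a' b' c' : ℝ) :
    cross (a • e₁ + b • e₂ + c • u) (a' • e₁ + b' • e₂ + c' • u) =
      o • ((b * c' - c * b') • e₁ + (c * a' - a * c') • e₂ + (a * b' - b * a') • u) := by
  simp only [cross_add_left, cross_add_right, cross_smul_left, cross_smul_right, cross_self_eq,
    h.cross_eq, h.cross_fst, h.cross_snd, cross_swap e₂ e₁, cross_swap e₁ u, cross_swap u e₂]
  module

end IsFrame

/-- Every unit vector completes to a positively oriented orthonormal frame. -/
theorem exists_frame {u : E3} (hu : u ∈ S2) :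
    ∃ e, IsFrame u e (cross u e) 1 := by
  obtain ⟨e, he, heu⟩ : ∃ e ∈ S2, inner ℝ e u = (0 : ℝ) := by
    obtain ⟨v, hv0, hv⟩ : ∃ v : E3, v ≠ 0 ∧ inner ℝ v u = (0 : ℝ) := by
      by_cases h : u 0 = 0 ∧ u 1 = 0
      · refine ⟨!₂[1, 0, 0], fun h0 => ?_, ?_⟩
        · simpa using congrArg (fun z : E3 => z 0) h0
        · rw [inner_eq_sum]; simp [h.1]
      · refine ⟨!₂[-u 1, u 0, 0], fun h0 => h ⟨?_, ?_⟩, ?_⟩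
        · simpa using congrArg (fun z : E3 => z 1) h0
        · simpa using congrArg (fun z : E3 => z 0) h0
        · rw [inner_eq_sum]; simp; ring
    refine ⟨‖v‖⁻¹ • v, ?_, ?_⟩
    · rw [mem_sphere_zero_iff_norm, norm_smul, norm_inv, norm_norm,
        inv_mul_cancel₀ (norm_ne_zero_iff.2 hv0)]
    · rw [inner_smul_left, hv, mul_zero]
  refine ⟨e, hu, he, ?_, heu, ?_, inner_cross_self_right u e, ?_, one_pow 2⟩
  · have h := inner_cross_cross u e u e
    rw [inner_self_sphere he, inner_self_sphere hu, real_inner_comm, heu,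
      real_inner_self_eq_norm_sq] at h
    rw [mem_sphere_zero_iff_norm]
    have h0 := norm_nonneg (cross u e)
    nlinarith
  · rw [real_inner_comm, inner_cross_self_left]
  · rw [cross_cross_eq, inner_self_sphere he, heu]; simp

/-- The rotation formula about a unit axis `p`. -/
theorem exists_rotation_formula {a : SO3} {p : E3} (hp : p ∈ S2) (hap : rot a p = p) :
    ∃ α β : ℝ, α ^ 2 + β ^ 2 = 1 ∧ ∀ x : E3, rot a x =
      inner ℝ p x • p + α • (x - inner ℝ p x • p) + β • cross p x := by
  obtain ⟨e, hfr⟩ := exists_frame hp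
  set f := cross p e with hf
  have hae : inner ℝ (rot a e) p = (0 : ℝ) := by
    rw [← hap, inner_rot_rot, hfr.inner_fst]
  have hfae : rot a f = cross p (rot a e) := by rw [hf, rot_cross, hap]
  set α : ℝ := inner ℝ (rot a e) e
  set β : ℝ := inner ℝ (rot a e) f
  have h5 : rot a e = α • e + β • f := by
    have := hfr.expand (rot a e)
    rwa [hae, zero_smul, add_zero] at this
  have hpf : cross p f = -e := by
    rw [cross_swap, hfr.cross_snd, one_smul]
  have h6 : rot a f = α • f - β • e := by
    rw [hfae, h5, cross_add_right, cross_smul_right, cross_smul_right, hpf, smul_neg,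
      ← sub_eq_add_neg]
  refine ⟨α, β, ?_, fun x => ?_⟩
  · have h7 := inner_rot_rot a e e
    have h8 := hfr.inner_lin α β 0 α β 0
    rw [zero_smul, add_zero, ← h5, h7, inner_self_sphere hfr.mem_fst] at h8
    linarith
  · have hx := hfr.expand x
    rw [real_inner_comm] at hx
    rw [real_inner_comm x p]
    set s : ℝ := inner ℝ x p
    set t : ℝ := inner ℝ x e
    set r : ℝ := inner ℝ x f
    rw [hx, rot_add, rot_add, rot_smul, rot_smul, rot_smul, hap, h5, h6, cross_add_right,
      cross_add_right, cross_smul_right, cross_smul_right, cross_smul_right, cross_self_eq, hpf,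
      ← hf]
    module

/-- A non-trivial rotation about `p` displaces `x` in proportion to its distance from the axis. -/
theorem exists_norm_sub_rot_sq {a : SO3} {p : E3} (hp : p ∈ S2) (hap : rot a p = p) (ha : a ≠ 1) :
    ∃ s > 0, ∀ x : E3, ‖x - rot a x‖ ^ 2 = s * (‖x‖ ^ 2 - (inner ℝ p x) ^ 2) := by
  obtain ⟨α, β, h1, h2⟩ := exists_rotation_formula hp hap
  have hα : α < 1 := by
    have hle : α ≤ 1 := by nlinarith [sq_nonneg β]
    refine lt_of_le_of_ne hle fun h => ha ?_
    have hβ : β = 0 := by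
      have : β ^ 2 = 0 := by rw [h] at h1; linarith
      simpa using this
    refine rot_ext fun x => ?_
    rw [h2 x, rot_one, h, hβ]
    simp
  refine ⟨2 * (1 - α), by linarith, fun x => ?_⟩
  have hpp := inner_self_sphere hp
  have h3 := h2 x
  set s : ℝ := inner ℝ p x with hs
  have h4 : x - rot a x = (1 - α) • (x - s • p) - β • cross p x := by
    rw [h3]; module
  have h5 : inner ℝ (cross p x) (cross p x) = inner ℝ x x - s ^ 2 := by
    rw [inner_cross_cross, hpp, real_inner_comm p x]; ring
  have h6 : inner ℝ (x - s • p) (cross p x) = (0 : ℝ) := by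
    rw [inner_sub_left, inner_smul_left, inner_cross_self_right, inner_cross_self_left]; simp
  have h7 : inner ℝ (x - s • p) (x - s • p) = inner ℝ x x - s ^ 2 := by
    simp only [inner_sub_left, inner_sub_right, inner_smul_left, inner_smul_right, hpp,
      real_inner_comm p x, ← hs]
    simp
    ring
  rw [← real_inner_self_eq_norm_sq, ← real_inner_self_eq_norm_sq, h4]
  simp only [inner_sub_left ((1 - α) • (x - s • p)), inner_sub_right _ ((1 - α) • (x - s • p)),
    inner_smul_left, inner_smul_right, h5, h6, h7, real_inner_comm (x - s • p) (cross p x)]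
  simp
  linear_combination (‖x‖ ^ 2 - s ^ 2) * h1

/-- The fixed points of a non-trivial rotation lie on its axis. -/
theorem eq_smul_of_rot_eq {a : SO3} {p x : E3} (hp : p ∈ S2) (hap : rot a p = p) (ha : a ≠ 1)
    (hx : rot a x = x) : x = (inner ℝ p x : ℝ) • p := by
  obtain ⟨s, hs, h⟩ := exists_norm_sub_rot_sq hp hap ha
  have h1 := h x
  rw [hx, sub_self, norm_zero, zero_pow two_ne_zero] at h1
  have h2 : ‖x‖ ^ 2 - (inner ℝ p x) ^ 2 = 0 := by
    rcases mul_eq_zero.1 h1.symm with h | h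
    · exact absurd h hs.ne'
    · exact h
  have hpp := inner_self_sphere hp
  rw [← sub_eq_zero, ← norm_eq_zero, ← sq_eq_zero_iff, ← real_inner_self_eq_norm_sq]
  simp only [inner_sub_left, inner_sub_right, inner_smul_left, inner_smul_right, hpp,
      real_inner_comm p x]
  rw [real_inner_self_eq_norm_sq]
  simp
  linear_combination h2

theorem eq_or_eq_neg_of_rot_eq {a : SO3} {p x : E3} (hp : p ∈ S2) (hap : rot a p = p)
    (ha : a ≠ 1) (hxS : x ∈ S2) (hx : rot a x = x) : x = p ∨ x = -p := by
  have h := eq_smul_of_rot_eq hp hap ha hx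
  have h1 : |(inner ℝ p x : ℝ)| = 1 := by
    have := congrArg norm h
    rwa [norm_smul, mem_sphere_zero_iff_norm.1 hxS, mem_sphere_zero_iff_norm.1 hp, mul_one,
      Real.norm_eq_abs, eq_comm] at this
  rcases eq_or_eq_neg_of_abs_eq h1 with h2 | h2 <;> rw [h2] at h
  · left; simpa using h
  · right; simpa using h

theorem norm_sub_sq_sphere {x y : E3} (hx : x ∈ S2) (hy : y ∈ S2) :
    ‖x - y‖ ^ 2 = 2 - 2 * inner ℝ x y := by
  rw [norm_sub_sq_real, mem_sphere_zero_iff_norm.1 hx, mem_sphere_zero_iff_norm.1 hy]; ring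

/-- On the sphere, the displacement by a non-trivial rotation is, up to a constant, the product of
the distances to the two fixed points. -/
theorem exists_norm_sub_rot_sq_sphere {a : SO3} {p : E3} (hp : p ∈ S2) (hap : rot a p = p)
    (ha : a ≠ 1) :
    ∃ s > 0, ∀ x ∈ S2, ‖x - rot a x‖ ^ 2 = s * (‖x - p‖ ^ 2 * ‖x - -p‖ ^ 2) := by
  obtain ⟨s, hs, h⟩ := exists_norm_sub_rot_sq hp hap ha
  refine ⟨s / 4, by positivity, fun x hx => ?_⟩
  have hnp : -p ∈ S2 := by simpa using hp
  rw [h x, norm_sub_sq_sphere hx hp, norm_sub_sq_sphere hx hnp, mem_sphere_zero_iff_norm.1 hx,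
    inner_neg_right, real_inner_comm]
  ring

/-! ### Periodic families around a centre in the plane -/

/-- A family of positive `2π`-periodic angular speeds `Ω e`, jointly continuous in `(e, θ)`, is
realised by a family of angles `Θ e`, jointly continuous in `(e, t)`. The time needed to reach the
angle `θ` is `∫₀^θ 1 / Ω e`, and `Θ e` is its inverse. -/
theorem exists_angle_family {I : Set ℝ} {Ω : ℝ → ℝ → ℝ}
    (hcont : ContinuousOn (fun p : ℝ × ℝ => Ω p.1 p.2) (I ×ˢ univ))
    (hpos : ∀ e ∈ I, ∀ θ, 0 < Ω e θ) (hper : ∀ e ∈ I, ∀ θ, Ω e (θ + 2 * Real.pi) = Ω e θ) :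
    ∃ (Θ : ℝ → ℝ → ℝ) (T : ℝ → ℝ),
      (∀ e ∈ I, ∀ t, HasDerivAt (Θ e) (Ω e (Θ e t)) t) ∧
      (∀ e ∈ I, StrictMono (Θ e)) ∧ (∀ e ∈ I, Function.Surjective (Θ e)) ∧
      (∀ e ∈ I, 0 < T e) ∧ (∀ e ∈ I, ∀ t, Θ e (t + T e) = Θ e t + 2 * Real.pi) ∧
      ContinuousOn (fun p : ℝ × ℝ => Θ p.1 p.2) (I ×ˢ univ) ∧
      ∀ e ∈ I, ∀ M > 0, (∀ θ, M ≤ Ω e θ) → T e ≤ 2 * Real.pi / M := by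
  have hc1 : ∀ e ∈ I, Continuous fun θ => (Ω e θ)⁻¹ := fun e he => by
    have h : Continuous (Ω e) := by
      rw [← continuousOn_univ]
      exact hcont.comp (f := fun θ => (e, θ)) (by fun_prop) fun θ _ => ⟨he, mem_univ _⟩
    exact h.inv₀ fun θ => (hpos e he θ).ne'
  set τ : ℝ → ℝ → ℝ := fun e θ => ∫ s in (0 : ℝ)..θ, (Ω e s)⁻¹ with hτ
  have hint : ∀ e ∈ I, ∀ a b, IntervalIntegrable (fun θ => (Ω e θ)⁻¹) MeasureTheory.volume a b :=
    fun e he a b => (hc1 e he).intervalIntegrable a b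
  have hderiv : ∀ e ∈ I, ∀ θ, HasDerivAt (τ e) (Ω e θ)⁻¹ θ := fun e he θ =>
    intervalIntegral.integral_hasDerivAt_right (hint e he 0 θ)
      ((hc1 e he).stronglyMeasurableAtFilter _ _) (hc1 e he).continuousAt
  have hmono : ∀ e ∈ I, StrictMono (τ e) := fun e he =>
    strictMono_of_hasDerivAt_pos (hderiv e he) fun θ => inv_pos.2 (hpos e he θ)
  have hτ0 : ∀ e, τ e 0 = 0 := fun e => intervalIntegral.integral_same
  have hpi : 0 < 2 * Real.pi := Real.two_pi_pos
  have hτper : ∀ e ∈ I, ∀ θ, τ e (θ + 2 * Real.pi) = τ e θ + τ e (2 * Real.pi) := by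
    intro e he θ
    have hp : Function.Periodic (fun θ => (Ω e θ)⁻¹) (2 * Real.pi) := fun θ => by
      simp only [hper e he θ]
    have h1 := hp.intervalIntegral_add_eq θ 0
    have h2 := intervalIntegral.integral_add_adjacent_intervals (hint e he 0 θ)
      (hint e he θ (θ + 2 * Real.pi))
    rw [zero_add] at h1
    simp only [hτ]
    rw [← h2, h1]
  have hτn : ∀ e ∈ I, ∀ n : ℕ, ∀ θ,
      τ e (θ + n * (2 * Real.pi)) = τ e θ + n * τ e (2 * Real.pi) := by
    intro e he n
    induction n with
    | zero => intro θ; simp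
    | succ n ih =>
      intro θ
      have : θ + ((n + 1 : ℕ) : ℝ) * (2 * Real.pi) = (θ + n * (2 * Real.pi)) + 2 * Real.pi := by
        push_cast; ring
      rw [this, hτper e he, ih]
      push_cast; ring
  have hTpos : ∀ e ∈ I, 0 < τ e (2 * Real.pi) := fun e he => by
    rw [← hτ0 e]; exact hmono e he hpi
  have hsurj : ∀ e ∈ I, Function.Surjective (τ e) := by
    intro e he t
    obtain ⟨n, hn⟩ := exists_nat_ge (|t| / τ e (2 * Real.pi))
    rw [div_le_iff₀ (hTpos e he)] at hn
    have h1 : t ≤ τ e (n * (2 * Real.pi)) := by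
      have := hτn e he n 0
      rw [zero_add, hτ0, zero_add] at this
      rw [this]; exact (le_abs_self t).trans hn
    have h2 : τ e (-(n * (2 * Real.pi))) ≤ t := by
      have := hτn e he n (-(n * (2 * Real.pi)))
      rw [neg_add_cancel, hτ0] at this
      have := neg_abs_le t
      linarith
    have hcτ : Continuous (τ e) :=
      continuous_iff_continuousAt.2 fun θ => (hderiv e he θ).continuousAt
    exact mem_range_of_exists_le_of_exists_ge hcτ ⟨_, h2⟩ ⟨_, h1⟩
  have hτcont : ContinuousOn (fun p : ℝ × ℝ => τ p.1 p.2) (I ×ˢ univ) := by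
    have h1 : Continuous (fun p : (I × ℝ) × ℝ => (Ω p.1.1 p.2)⁻¹) := by
      refine Continuous.inv₀ ?_ fun p => (hpos _ p.1.1.2 _).ne'
      exact hcont.comp_continuous (f := fun p : (I × ℝ) × ℝ => ((p.1.1 : ℝ), p.2)) (by fun_prop)
        fun p => ⟨p.1.1.2, mem_univ _⟩
    have h2 : Continuous fun p : I × ℝ => τ p.1 p.2 :=
      intervalIntegral.continuous_parametric_intervalIntegral_of_continuous
        (f := fun (p : I × ℝ) s => (Ω p.1 s)⁻¹) (s := fun p : I × ℝ => p.2) h1 continuous_snd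
    rw [continuousOn_iff_continuous_domRestrict]
    exact h2.comp (f := fun p : (I ×ˢ univ : Set (ℝ × ℝ)) => ((⟨p.1.1, p.2.1⟩ : I), p.1.2))
      (by fun_prop)
  choose! Θ hΘ using hsurj
  have hΘ' : ∀ e ∈ I, ∀ θ, Θ e (τ e θ) = θ := fun e he θ =>
    (hmono e he).injective (hΘ e he _)
  have hΘmono : ∀ e ∈ I, StrictMono (Θ e) := fun e he s t hst => by
    rw [← (hmono e he).lt_iff_lt, hΘ e he, hΘ e he]; exact hst
  have hΘcont : ContinuousOn (fun p : ℝ × ℝ => Θ p.1 p.2) (I ×ˢ univ) := by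
    rintro ⟨e, t⟩ ⟨he, -⟩
    rw [ContinuousWithinAt, tendsto_order]
    have key (θ : ℝ) : Tendsto (fun p : ℝ × ℝ => τ p.1 θ - p.2) (𝓝[I ×ˢ univ] (e, t))
        (𝓝 (τ e θ - t)) := by
      have h1 : ContinuousWithinAt (fun p : ℝ × ℝ => τ p.1 θ) (I ×ˢ univ) (e, t) :=
        ContinuousWithinAt.comp (f := fun p : ℝ × ℝ => (p.1, θ)) (x := (e, t))
          (hτcont (e, θ) ⟨he, mem_univ _⟩)
          (continuous_fst.prodMk continuous_const).continuousWithinAt fun p hp => ⟨hp.1, mem_univ _⟩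
      exact h1.sub continuousWithinAt_snd
    have hmem : ∀ᶠ p : ℝ × ℝ in 𝓝[I ×ˢ univ] (e, t), p.1 ∈ I := by
      filter_upwards [self_mem_nhdsWithin] with p hp using hp.1
    refine ⟨fun θ hθ => ?_, fun θ hθ => ?_⟩
    · have h0 : τ e θ - t < 0 := by
        rw [sub_neg, ← hΘ e he t]; exact hmono e he hθ
      filter_upwards [hmem, (key θ).eventually (gt_mem_nhds h0)] with p hp hlt
      rw [← (hmono _ hp).lt_iff_lt, hΘ _ hp]; linarith
    · have h0 : 0 < τ e θ - t := by
        rw [sub_pos]; conv_lhs => rw [← hΘ e he t]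
        exact hmono e he hθ
      filter_upwards [hmem, (key θ).eventually (lt_mem_nhds h0)] with p hp hlt
      rw [← (hmono _ hp).lt_iff_lt, hΘ _ hp]; linarith
  refine ⟨Θ, fun e => τ e (2 * Real.pi), fun e he t => ?_, hΘmono, fun e he θ => ⟨_, hΘ' e he θ⟩,
    hTpos, fun e he t => ?_, hΘcont, fun e he M hM hΩ => ?_⟩
  · have h1 : ContinuousAt (Θ e) t := by
      have : ContinuousOn (Θ e) univ :=
        hΘcont.comp (f := fun t => (e, t)) (by fun_prop) fun t _ => ⟨he, mem_univ _⟩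
      exact this.continuousAt univ_mem
    have := HasDerivAt.of_local_left_inverse h1 (hderiv e he (Θ e t))
      (inv_pos.2 (hpos e he _)).ne' (Eventually.of_forall (hΘ e he))
    rwa [inv_inv] at this
  · apply (hmono e he).injective
    rw [hΘ e he, hτper e he, hΘ e he]
  · have h1 : τ e (2 * Real.pi) ≤ ∫ s in (0 : ℝ)..(2 * Real.pi), M⁻¹ :=
      intervalIntegral.integral_mono_on hpi.le (hint e he _ _) (by simp)
        fun s _ => inv_anti₀ hM (hΩ s)
    simpa [div_eq_mul_inv] using h1

/-- The decomposition of a planar vector into its radial and angular parts. -/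
theorem smul_add_smul_I_mul {w z : ℂ} (hw : w ≠ 0) :
    ((starRingEnd ℂ w * z).re / ‖w‖ ^ 2 : ℝ) • w +
      ((starRingEnd ℂ w * z).im / ‖w‖ ^ 2 : ℝ) • (Complex.I * w) = z := by
  have h : (‖w‖ ^ 2 : ℂ) = w * starRingEnd ℂ w := by
    rw [Complex.mul_conj, Complex.normSq_eq_norm_sq]; push_cast; rfl
  have h0 : starRingEnd ℂ w ≠ 0 := by simpa using hw
  have h1 : starRingEnd ℂ w * z =
      (starRingEnd ℂ w * z).re + (starRingEnd ℂ w * z).im * Complex.I := (Complex.re_add_im _).symm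
  rw [Complex.real_smul, Complex.real_smul]
  push_cast
  rw [h]
  field_simp
  rw [h1]
  simp only [Complex.add_re, Complex.ofReal_re, Complex.mul_re, Complex.I_re, Complex.ofReal_im,
    Complex.I_im, Complex.add_im, Complex.mul_im]
  push_cast
  ring

/-- Let `G` have no critical points along rays in a punctured disc, and let `Z` be a continuous
vector field tangent to the level sets of `G` which turns around the origin. If every ray meets
every level `e ∈ I`, then the levels are filled by periodic solutions of `w' = Z w`. In polar
coordinates the level set is a graph `r = R(e, θ)` by the inverse function theorem, and the angle
solves a scalar equation. -/
theorem exists_planar_family {r₀ : ℝ} {G : ℂ → ℝ} {G' : ℂ → ℂ →L[ℝ] ℝ} {Z : ℂ → ℂ} {I : Set ℝ}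
    (hI : IsOpen I)
    (hG : ∀ w, 0 < ‖w‖ → ‖w‖ < r₀ → HasStrictFDerivAt G (G' w) w)
    (hZ : ContinuousOn Z {w | 0 < ‖w‖ ∧ ‖w‖ < r₀})
    (hGZ : ∀ w, 0 < ‖w‖ → ‖w‖ < r₀ → G' w (Z w) = 0)
    (hrot : ∀ w, 0 < ‖w‖ → ‖w‖ < r₀ → 0 < (starRingEnd ℂ w * Z w).im)
    (hrad : ∀ w, 0 < ‖w‖ → ‖w‖ < r₀ → G' w w ≠ 0)
    (hex : ∀ e ∈ I, ∀ θ : ℝ, ∃ r : ℝ, 0 < r ∧ r < r₀ ∧ G (r * Complex.exp (θ * Complex.I)) = e) :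
    ∃ (w : ℝ → ℝ → ℂ) (T : ℝ → ℝ),
      (∀ e ∈ I, ∀ t, 0 < ‖w e t‖ ∧ ‖w e t‖ < r₀ ∧ G (w e t) = e) ∧
      (∀ e ∈ I, ∀ t, HasDerivAt (w e) (Z (w e t)) t) ∧
      (∀ e ∈ I, HasLeastPeriod (w e) (T e)) ∧
      ContinuousOn (fun p : ℝ × ℝ => w p.1 p.2) (I ×ˢ univ) ∧
      (∀ z, 0 < ‖z‖ → ‖z‖ < r₀ → G z ∈ I → ∃ t, w (G z) t = z) ∧
      ∀ e ∈ I, ∀ M > 0, (∀ z, 0 < ‖z‖ → ‖z‖ < r₀ → G z = e →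
        M * ‖z‖ ^ 2 ≤ (starRingEnd ℂ z * Z z).im) → T e ≤ 2 * Real.pi / M := by
  set c : ℝ → ℂ := fun θ => Complex.exp (θ * Complex.I) with hc
  have hcn (θ : ℝ) : ‖c θ‖ = 1 := Complex.norm_exp_ofReal_mul_I θ
  have hcd (θ : ℝ) : HasStrictDerivAt c (c θ * Complex.I) θ := by
    have h1 : HasStrictDerivAt (fun θ : ℝ => (θ : ℂ) * Complex.I) (1 * Complex.I) θ :=
      (Complex.ofRealCLM.hasStrictDerivAt (x := θ)).mul_const Complex.I
    simpa using h1.cexp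
  have hcper (θ : ℝ) : c (θ + 2 * Real.pi) = c θ := by
    have := Complex.exp_periodic (θ * Complex.I)
    simp only [hc]
    rw [← this]
    push_cast
    ring_nf
  have hnorm {r : ℝ} (hr : 0 < r) (θ : ℝ) : ‖(r : ℂ) * c θ‖ = r := by
    rw [norm_mul, hcn, mul_one, Complex.norm_real, Real.norm_of_nonneg hr.le]
  -- levels are attained at most once on each ray, by Rolle's theorem
  have hinj : ∀ θ r s : ℝ, 0 < r → r < r₀ → 0 < s → s < r₀ → G (r * c θ) = G (s * c θ) → r = s := by
    have key : ∀ θ r s : ℝ, 0 < r → s < r₀ → r < s → G (r * c θ) ≠ G (s * c θ) := by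
      intro θ r s hr hs hrs heq
      have hd : ∀ x : ℝ, 0 < x → x < r₀ →
          HasDerivAt (fun x : ℝ => G (x * c θ)) (G' (x * c θ) (c θ)) x := by
        intro x hx hx0
        have h1 : HasDerivAt (fun x : ℝ => (x : ℂ) * c θ) (1 * c θ) x :=
          (Complex.ofRealCLM.hasDerivAt (x := x)).mul_const (c θ)
        rw [one_mul] at h1
        exact (hG _ (by rwa [hnorm hx]) (by rwa [hnorm hx])).hasFDerivAt.comp_hasDerivAt x h1
      obtain ⟨x, hx, h0⟩ := exists_hasDerivAt_eq_zero (f := fun x : ℝ => G (x * c θ))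
        (f' := fun x => G' (x * c θ) (c θ)) hrs
        (fun x hx => (hd x (hr.trans_le hx.1) (hx.2.trans_lt hs)).continuousAt.continuousWithinAt)
        heq (fun x hx => hd x (hr.trans hx.1) (hx.2.trans hs))
      have hx0 : 0 < x := hr.trans hx.1
      refine hrad (x * c θ) (by rwa [hnorm hx0]) (by rw [hnorm hx0]; exact hx.2.trans hs) ?_
      rw [← Complex.real_smul, map_smul, Complex.real_smul, h0, smul_zero]
    intro θ r s hr hr0 hs hs0 heq
    rcases lt_trichotomy r s with h | h | h
    · exact absurd heq (key θ r s hr hs0 h)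
    · exact h
    · exact absurd heq.symm (key θ s r hs hr0 h)
  choose! R hR0 hR1 hRG using hex
  have hRu : ∀ e ∈ I, ∀ θ r : ℝ, 0 < r → r < r₀ → G (r * c θ) = e → r = R e θ :=
    fun e he θ r hr hr0 h => hinj θ r _ hr hr0 (hR0 e he θ) (hR1 e he θ)
      (h.trans (hRG e he θ).symm)
  have hRper : ∀ e ∈ I, ∀ θ, R e (θ + 2 * Real.pi) = R e θ := fun e he θ =>
    hRu e he θ _ (hR0 e he _) (hR1 e he _) (by rw [← hcper θ]; exact hRG e he _)
  have hn1 : ∀ e ∈ I, ∀ θ : ℝ, 0 < ‖(R e θ : ℂ) * c θ‖ := fun e he θ => by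
    rw [hnorm (hR0 e he θ)]; exact hR0 e he θ
  have hn2 : ∀ e ∈ I, ∀ θ : ℝ, ‖(R e θ : ℂ) * c θ‖ < r₀ := fun e he θ => by
    rw [hnorm (hR0 e he θ)]; exact hR1 e he θ
  -- the inverse function theorem for `(r, θ) ↦ (G (r e^{iθ}), θ)`
  have hRd : ∀ e ∈ I, ∀ θ, DifferentiableAt ℝ (fun p : ℝ × ℝ => R p.1 p.2) (e, θ) := by
    intro e he θ
    set r := R e θ with hr
    have hrpos : 0 < r := hR0 e he θ
    set A := G' (r * c θ) with hA
    set a : ℝ := A (c θ) with ha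
    set b : ℝ := A (r * (c θ * Complex.I)) with hb
    have ha0 : a ≠ 0 := by
      intro h0
      refine hrad (r * c θ) (hn1 e he θ) (hn2 e he θ) ?_
      rw [← Complex.real_smul, map_smul, Complex.real_smul, ← hA, ← ha, h0, smul_zero]
    have hP : HasStrictFDerivAt (fun p : ℝ × ℝ => (p.1 : ℂ) * c p.2)
        (((ContinuousLinearMap.fst ℝ ℝ ℝ).smulRight (c θ)) +
          ((ContinuousLinearMap.snd ℝ ℝ ℝ).smulRight ((r : ℂ) * (c θ * Complex.I)))) (r, θ) := by
      have h1 : HasStrictFDerivAt (fun p : ℝ × ℝ => (p.1 : ℂ))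
          (Complex.ofRealCLM.comp (ContinuousLinearMap.fst ℝ ℝ ℝ)) (r, θ) :=
        (Complex.ofRealCLM.comp (ContinuousLinearMap.fst ℝ ℝ ℝ)).hasStrictFDerivAt
      have h2 : HasStrictFDerivAt (fun p : ℝ × ℝ => c p.2) _ (r, θ) :=
        (hcd θ).hasStrictFDerivAt.comp (r, θ) (ContinuousLinearMap.snd ℝ ℝ ℝ).hasStrictFDerivAt
      refine (h1.mul h2).congr_fderiv ?_
      ext <;> simp [mul_comm, mul_left_comm]
    set L : (ℝ × ℝ) ≃L[ℝ] (ℝ × ℝ) := ContinuousLinearEquiv.equivOfInverse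
      ((a • ContinuousLinearMap.fst ℝ ℝ ℝ + b • ContinuousLinearMap.snd ℝ ℝ ℝ).prod
        (ContinuousLinearMap.snd ℝ ℝ ℝ))
      ((a⁻¹ • (ContinuousLinearMap.fst ℝ ℝ ℝ - b • ContinuousLinearMap.snd ℝ ℝ ℝ)).prod
        (ContinuousLinearMap.snd ℝ ℝ ℝ))
      (fun x => by ext <;> simp [ha0])
      (fun x => by ext <;> simp [ha0]) with hL
    have hF : HasStrictFDerivAt (fun p : ℝ × ℝ => (G (p.1 * c p.2), p.2)) (L : ℝ × ℝ →L[ℝ] ℝ × ℝ)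
        (r, θ) := by
      have h1 := ((hG _ (hn1 e he θ) (hn2 e he θ)).comp (r, θ) hP).prodMk
        (ContinuousLinearMap.snd ℝ ℝ ℝ).hasStrictFDerivAt
      refine h1.congr_fderiv ?_
      apply ContinuousLinearMap.ext
      rintro ⟨x, y⟩
      have : A (x • c θ + y • ((r : ℂ) * (c θ * Complex.I))) = a * x + b * y := by
        rw [map_add, map_smul, map_smul, smul_eq_mul, smul_eq_mul, mul_comm x, mul_comm y]
      exact Prod.ext this rfl
    have hFe : G (r * c θ) = e := hRG e he θ
    have hinv := hF.to_localInverse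
    have hright := hF.eventually_right_inverse
    have hself : hF.localInverse _ _ _ (e, θ) = (r, θ) := by
      have := hF.localInverse_apply_image
      simp only [hFe] at this
      exact this
    simp only [hFe] at hinv hright
    have hcont : Tendsto (hF.localInverse _ _ _) (𝓝 (e, θ)) (𝓝 (r, θ)) := by
      have := hinv.continuousAt
      rwa [ContinuousAt, hself] at this
    have hev1 : ∀ᶠ p : ℝ × ℝ in 𝓝 (e, θ), 0 < (hF.localInverse _ _ _ p).1 :=
      (hcont.fst_nhds).eventually (lt_mem_nhds hrpos)
    have hev2 : ∀ᶠ p : ℝ × ℝ in 𝓝 (e, θ), (hF.localInverse _ _ _ p).1 < r₀ :=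
      (hcont.fst_nhds).eventually (gt_mem_nhds (hR1 e he θ))
    have hev3 : ∀ᶠ p : ℝ × ℝ in 𝓝 (e, θ), p.1 ∈ I :=
      continuousAt_fst.eventually (hI.mem_nhds he)
    have heq : (fun p : ℝ × ℝ => R p.1 p.2) =ᶠ[𝓝 (e, θ)] fun p => (hF.localInverse _ _ _ p).1 := by
      filter_upwards [hev1, hev2, hev3, hright] with p h1 h2 h3 h4
      have h5 := congrArg Prod.fst h4
      have h6 := congrArg Prod.snd h4
      simp only at h5 h6
      rw [h6] at h5
      exact (hRu p.1 h3 p.2 _ h1 h2 h5).symm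
    exact (hinv.hasFDerivAt.differentiableAt.fst).congr_of_eventuallyEq heq
  have hRc : ContinuousOn (fun p : ℝ × ℝ => R p.1 p.2) (I ×ˢ univ) := fun p hp =>
    (hRd p.1 hp.1 p.2).continuousAt.continuousWithinAt
  have hcc : Continuous c := continuous_iff_continuousAt.2 fun θ => (hcd θ).hasDerivAt.continuousAt
  set W : ℝ → ℝ → ℂ := fun e θ => R e θ * c θ with hW
  have hWc : ContinuousOn (fun p : ℝ × ℝ => W p.1 p.2) (I ×ˢ univ) :=
    (Complex.continuous_ofReal.comp_continuousOn hRc).mul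
      (hcc.comp continuous_snd).continuousOn
  set Ω : ℝ → ℝ → ℝ := fun e θ => (starRingEnd ℂ (W e θ) * Z (W e θ)).im / ‖W e θ‖ ^ 2 with hΩ
  have hΩc : ContinuousOn (fun p : ℝ × ℝ => Ω p.1 p.2) (I ×ˢ univ) := by
    have h1 : ContinuousOn (fun p : ℝ × ℝ => Z (W p.1 p.2)) (I ×ˢ univ) :=
      hZ.comp hWc fun p hp => ⟨hn1 p.1 hp.1 p.2, hn2 p.1 hp.1 p.2⟩
    refine ContinuousOn.div (Complex.continuous_im.comp_continuousOn
      ((Complex.continuous_conj.comp_continuousOn hWc).mul h1)) (hWc.norm.pow 2) fun p hp => ?_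
    exact pow_ne_zero 2 (hn1 p.1 hp.1 p.2).ne'
  have hΩpos : ∀ e ∈ I, ∀ θ, 0 < Ω e θ := fun e he θ =>
    div_pos (hrot _ (hn1 e he θ) (hn2 e he θ)) (pow_pos (hn1 e he θ) 2)
  have hWper : ∀ e ∈ I, ∀ θ, W e (θ + 2 * Real.pi) = W e θ := fun e he θ => by
    simp only [hW, hRper e he, hcper]
  obtain ⟨Θ, T, hΘd, hΘm, hΘs, hTpos, hΘT, hΘc, hTb⟩ := exists_angle_family hΩc hΩpos
    fun e he θ => by simp only [hΩ, hWper e he]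
  -- equal points of a level curve have angles differing by a multiple of `2π`
  have hWinj : ∀ e ∈ I, ∀ θ₁ θ₂, W e θ₁ = W e θ₂ → θ₁ < θ₂ → θ₁ + 2 * Real.pi ≤ θ₂ := by
    intro e he θ₁ θ₂ h hlt
    have h1 : R e θ₁ = R e θ₂ := by
      have := congrArg norm h
      rwa [hnorm (hR0 e he _), hnorm (hR0 e he _)] at this
    have h2 : c θ₁ = c θ₂ := by
      have h3 : (R e θ₂ : ℂ) ≠ 0 := by exact_mod_cast (hR0 e he θ₂).ne'
      simp only [hW, h1] at h
      exact mul_left_cancel₀ h3 h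
    obtain ⟨n, hn⟩ := Complex.exp_eq_exp_iff_exists_int.1 h2
    have h4 : θ₁ = θ₂ + n * (2 * Real.pi) := by
      have := congrArg Complex.im hn
      simpa using this
    have hn0 : n < 0 := by
      by_contra hcon
      have : (0 : ℝ) ≤ n := by exact_mod_cast not_lt.1 hcon
      have := mul_nonneg this Real.two_pi_pos.le
      linarith
    have hn1 : (n : ℝ) ≤ -1 := by exact_mod_cast Int.le_sub_one_of_lt hn0
    nlinarith [Real.two_pi_pos]
  refine ⟨fun e t => W e (Θ e t), T, fun e he t => ⟨hn1 e he _, hn2 e he _, hRG e he _⟩,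
    fun e he t => ?_, fun e he => ⟨⟨hTpos e he, fun t => ?_⟩, ?_⟩, ?_, fun z hz0 hz1 hzI => ?_,
    fun e he M hM hb => ?_⟩
  · set θ := Θ e t with hθ
    have hRθ : HasDerivAt (R e) (deriv (R e) θ) θ := by
      have h1 : DifferentiableAt ℝ (fun s : ℝ => (e, s)) θ := by fun_prop
      exact ((hRd e he θ).comp θ h1).hasDerivAt
    set ρ := deriv (R e) θ
    have hWd : HasDerivAt (W e) (ρ • c θ + R e θ • (c θ * Complex.I)) θ := by
      have := (Complex.ofRealCLM.hasFDerivAt.comp_hasDerivAt θ hRθ).mul (hcd θ).hasDerivAt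
      simp only [Complex.real_smul]
      exact this
    have hw0 : W e θ ≠ 0 := norm_pos_iff.1 (hn1 e he θ)
    have hRne : R e θ ≠ 0 := (hR0 e he θ).ne'
    have hrw1 : c θ = (R e θ)⁻¹ • W e θ := by
      rw [hW]; simp only; rw [← Complex.real_smul, smul_smul, inv_mul_cancel₀ hRne, one_smul]
    have hWd' : HasDerivAt (W e) ((ρ / R e θ) • W e θ + Complex.I * W e θ) θ := by
      convert hWd using 2
      · rw [hrw1, smul_smul, div_eq_mul_inv]
      · simp only [hW, Complex.real_smul]; ring
    have hGW : G' (W e θ) ((ρ / R e θ) • W e θ + Complex.I * W e θ) = 0 := by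
      have h1 := (hG _ (hn1 e he θ) (hn2 e he θ)).hasFDerivAt.comp_hasDerivAt θ hWd'
      have h2 : (G ∘ W e) = fun _ => e := funext fun s => hRG e he s
      rw [h2] at h1
      exact h1.unique (hasDerivAt_const θ e)
    -- both `Z` and the velocity of the graph are tangent to the level, and the radial derivative of
    -- `G` is non-zero, so their radial parts agree once their angular parts do
    have hdec := smul_add_smul_I_mul (w := W e θ) (z := Z (W e θ)) hw0
    set α := (starRingEnd ℂ (W e θ) * Z (W e θ)).re / ‖W e θ‖ ^ 2
    change α • W e θ + Ω e θ • (Complex.I * W e θ) = _ at hdec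
    have h3 : G' (W e θ) (α • W e θ + Ω e θ • (Complex.I * W e θ)) = 0 := by
      rw [hdec]; exact hGZ _ (hn1 e he θ) (hn2 e he θ)
    have h4 : α = Ω e θ * (ρ / R e θ) := by
      rw [map_add, map_smul, map_smul, smul_eq_mul, smul_eq_mul] at h3
      rw [map_add, map_smul, smul_eq_mul] at hGW
      have h5 := hrad _ (hn1 e he θ) (hn2 e he θ)
      apply mul_right_cancel₀ h5
      linear_combination h3 - Ω e θ * hGW
    have h6 := hWd'.scomp t (hΘd e he t)
    refine h6.congr_deriv ?_
    rw [← hθ, ← hdec, h4, smul_add, smul_smul]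
  · simp only [hΘT e he, hWper e he]
  · rintro s ⟨hs, hper⟩
    have h1 := hWinj e he (Θ e 0) (Θ e (0 + s)) (hper 0).symm (hΘm e he (by linarith))
    rw [← hΘT e he, (hΘm e he).le_iff_le] at h1
    linarith
  · exact hWc.comp (continuousOn_fst.prodMk hΘc) fun p hp => ⟨hp.1, mem_univ _⟩
  · obtain ⟨t, ht⟩ := hΘs (G z) hzI (Complex.arg z)
    refine ⟨t, ?_⟩
    have hz : (‖z‖ : ℂ) * c (Complex.arg z) = z := Complex.norm_mul_exp_arg_mul_I z
    have h1 : ‖z‖ = R (G z) (Complex.arg z) :=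
      hRu (G z) hzI _ _ hz0 hz1 (by rw [hz])
    simp only [hW, ht, ← h1]
    exact hz
  · refine hTb e he M hM fun θ => ?_
    rw [hΩ, le_div_iff₀ (pow_pos (hn1 e he θ) 2)]
    exact hb _ (hn1 e he θ) (hn2 e he θ) (hRG e he θ)

/-! ### Logarithmic potentials in the plane -/

section Potential

variable {ι : Type*}

/-- The logarithmic potential with poles `z i` of weights `w i` (`i ∈ s`), together with the
rotationally symmetric term that stereographic projection produces. -/
noncomputable def pot (s : Finset ι) (w : ι → ℝ) (z : ι → ℂ) (W C : ℝ) (x : ℂ) : ℝ :=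
  C - ∑ i ∈ s, w i * Real.log (‖x - z i‖ ^ 2) + W * Real.log (1 + ‖x‖ ^ 2)

/-- The complex gradient `∂ pot / ∂x` (Wirtinger derivative) of the potential. -/
noncomputable def potGrad (s : Finset ι) (w : ι → ℝ) (z : ι → ℂ) (W : ℝ) (x : ℂ) : ℂ :=
  W * starRingEnd ℂ x / (1 + ‖x‖ ^ 2 : ℝ) - ∑ i ∈ s, (w i : ℂ) / (x - z i)

/-- The real linear form `v ↦ 2 Re (v q)` on the plane. -/
noncomputable def reForm (q : ℂ) : ℂ →L[ℝ] ℝ :=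
  Complex.reCLM.comp ((2 * q) • (ContinuousLinearMap.id ℝ ℂ))

theorem reForm_apply (q v : ℂ) : reForm q v = 2 * (v * q).re := by
  simp [reForm]; ring

theorem reForm_one (q : ℂ) : reForm q 1 = 2 * q.re := by
  simp [reForm_apply]

theorem reForm_I (q : ℂ) : reForm q Complex.I = -(2 * q.im) := by
  simp [reForm_apply]

theorem eq_zero_of_reForm_eq_zero {q : ℂ} (hq : reForm q = 0) : q = 0 := by
  have h1 := reForm_one q
  have h2 := reForm_I q
  rw [hq] at h1 h2
  exact Complex.ext (by simpa using h1.symm) (by simpa using h2.symm)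

variable {s : Finset ι} {w : ι → ℝ} {z : ι → ℂ} {W C : ℝ} {x : ℂ}

theorem contDiffAt_pot {n : ℕ∞} (hx : ∀ i ∈ s, x ≠ z i) : ContDiffAt ℝ n (pot s w z W C) x := by
  unfold pot
  refine ContDiffAt.add (ContDiffAt.sub contDiffAt_const (ContDiffAt.sum fun i hi => ?_)) ?_
  · refine contDiffAt_const.mul (ContDiffAt.log ?_ ?_)
    · exact (contDiffAt_id.sub contDiffAt_const).norm_sq ℝ
    · exact pow_ne_zero 2 (norm_ne_zero_iff.2 (sub_ne_zero.2 (hx i hi)))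
  · refine contDiffAt_const.mul (ContDiffAt.log ?_ ?_)
    · exact contDiffAt_const.add (contDiffAt_id.norm_sq ℝ)
    · positivity

theorem hasFDerivAt_norm_sub_sq (a x : ℂ) :
    HasFDerivAt (fun x : ℂ => ‖x - a‖ ^ 2) (reForm (starRingEnd ℂ (x - a))) x := by
  have h := ((hasFDerivAt_id (𝕜 := ℝ) x).sub_const a).norm_sq
  refine h.congr_fderiv ?_
  ext v
  simp [reForm_apply, Complex.inner, Complex.mul_re]
  ring

theorem hasFDerivAt_pot (hx : ∀ i ∈ s, x ≠ z i) :
    HasFDerivAt (pot s w z W C) (reForm (potGrad s w z W x)) x := by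
  have h1 : ∀ i ∈ s, HasFDerivAt (fun x => w i * Real.log (‖x - z i‖ ^ 2))
      (w i • (‖x - z i‖ ^ 2)⁻¹ • reForm (starRingEnd ℂ (x - z i))) x := fun i hi =>
    ((hasFDerivAt_norm_sub_sq (z i) x).log
      (pow_ne_zero 2 (norm_ne_zero_iff.2 (sub_ne_zero.2 (hx i hi))))).const_mul (w i)
  have h2 : HasFDerivAt (fun x : ℂ => W * Real.log (1 + ‖x‖ ^ 2))
      (W • (1 + ‖x‖ ^ 2)⁻¹ • reForm (starRingEnd ℂ x)) x := by
    have h := (hasFDerivAt_norm_sub_sq 0 x).const_add 1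
    simp only [sub_zero] at h
    exact (h.log (by positivity)).const_mul W
  have h3 := ((hasFDerivAt_const C x).sub (HasFDerivAt.fun_sum h1)).add h2
  refine h3.congr_fderiv ?_
  ext v
  have h4 : ∀ i ∈ s, (w i : ℂ) / (x - z i) =
      ((w i * (‖x - z i‖ ^ 2)⁻¹ : ℝ) : ℂ) * starRingEnd ℂ (x - z i) := by
    intro i _
    rw [div_eq_mul_inv, Complex.inv_def, Complex.normSq_eq_norm_sq]
    push_cast
    ring
  have h5 : (W : ℂ) * starRingEnd ℂ x / (1 + ‖x‖ ^ 2 : ℝ) =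
      ((W * (1 + ‖x‖ ^ 2)⁻¹ : ℝ) : ℂ) * starRingEnd ℂ x := by
    push_cast; ring
  rw [potGrad, h5, Finset.sum_congr rfl h4]
  simp only [add_apply, sub_apply,
    zero_apply, sum_apply, smul_apply,
    reForm_apply, smul_eq_mul, mul_sub, Complex.sub_re, Finset.mul_sum, Complex.re_sum]
  have h6 (r : ℝ) (a : ℂ) : (v * ((r : ℂ) * a)).re = r * (v * a).re := by
    rw [mul_left_comm, Complex.re_ofReal_mul]
  simp only [h6]
  have h7 : ∀ i, w i * ((‖x - z i‖ ^ 2)⁻¹ * (2 * (v * starRingEnd ℂ (x - z i)).re)) =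
      2 * (w i * (‖x - z i‖ ^ 2)⁻¹ * (v * starRingEnd ℂ (x - z i)).re) := fun i => by ring
  simp only [h7]
  ring

/-! ### Critical points of the potential are isolated -/

open Polynomial in
/-- If there are at least three poles, all in the plane, and `W` is their total weight, then the
critical points of the potential do not accumulate at `0`. They satisfy `conj x = r x` for a
rational function `r = A / B`, hence `x = conj r (r x)`; were `0` an accumulation point, this would
be an identity between rational functions with `r 0 = 0`, `r' 0 ≠ 0`. But `A` has degree at least
two, so it has a root `ζ ≠ 0`, and the identity at `ζ` reads `ζ = 0`. -/
theorem eventually_potGrad_ne_zero (hs : 3 ≤ s.card) (hw : ∀ i ∈ s, 0 < w i)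
    (hz : Set.InjOn z s) (hz0 : ∀ i ∈ s, z i ≠ 0) (hW : W = ∑ i ∈ s, w i) :
    ∀ᶠ x in 𝓝[≠] (0 : ℂ), potGrad s w z W x ≠ 0 := by
  classical
  by_contra hcon
  have hfreq : ∃ᶠ x in 𝓝[≠] (0 : ℂ), potGrad s w z W x = 0 := by
    simpa only [not_eventually, ne_eq, not_not] using hcon
  set Q : ℂ[X] := ∏ i ∈ s, (X - C (z i)) with hQ
  set A : ℂ[X] := ∑ i ∈ s, C (w i : ℂ) * ∏ j ∈ s.erase i, (X - C (z j)) with hA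
  set B : ℂ[X] := C (W : ℂ) * Q - X * A with hB
  have hWpos : 0 < W := by
    rw [hW]; exact Finset.sum_pos hw (Finset.card_pos.1 (by omega))
  have hWne : (W : ℂ) ≠ 0 := by exact_mod_cast hWpos.ne'
  have hdeg : ∀ i ∈ s, (∏ j ∈ s.erase i, (X - C (z j))).natDegree = s.card - 1 := by
    intro i hi
    rw [natDegree_prod_of_monic _ _ fun j _ => monic_X_sub_C _]
    simp [Finset.card_erase_of_mem hi]
  have hAcoeff : A.coeff (s.card - 1) = W := by
    rw [hA, finsetSum_coeff, hW]
    push_cast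
    refine Finset.sum_congr rfl fun i hi => ?_
    rw [coeff_C_mul, ← hdeg i hi]
    have := (monic_prod_of_monic (s.erase i) (fun j => X - C (z j)) fun j _ =>
      monic_X_sub_C (z j)).coeff_natDegree
    rw [this, mul_one]
  have hAdeg : 2 ≤ A.natDegree := by
    have : s.card - 1 ≤ A.natDegree := le_natDegree_of_ne_zero (by rw [hAcoeff]; exact hWne)
    omega
  have hAz : ∀ i ∈ s, A.eval (z i) ≠ 0 := by
    intro i hi
    rw [hA, eval_finsetSum, Finset.sum_eq_single_of_mem i hi]
    · rw [eval_mul, eval_C, eval_prod]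
      refine mul_ne_zero (by exact_mod_cast (hw i hi).ne')
        (Finset.prod_ne_zero_iff.2 fun j hj => ?_)
      rw [Finset.mem_erase] at hj
      simp only [eval_sub, eval_X, eval_C]
      exact sub_ne_zero.2 fun h => hj.1 (hz hj.2 hi h.symm)
    · intro j hj hji
      rw [eval_mul, eval_prod, Finset.prod_eq_zero (i := i) (Finset.mem_erase.2 ⟨hji.symm, hi⟩)]
      · simp
      · simp
  have hQ0 : ∀ x, Q.eval x = 0 → ∃ i ∈ s, x = z i := by
    intro x hx
    rw [hQ, eval_prod, Finset.prod_eq_zero_iff] at hx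
    obtain ⟨i, hi, h⟩ := hx
    exact ⟨i, hi, by simpa [sub_eq_zero] using h⟩
  have hBA : ∀ x, A.eval x = 0 → B.eval x ≠ 0 := by
    intro x hx h
    have h1 : (W : ℂ) * Q.eval x = 0 := by
      have : B.eval x = (W : ℂ) * Q.eval x - x * A.eval x := by simp [hB]
      rw [this, hx, mul_zero, sub_zero] at h
      exact h
    obtain ⟨i, hi, rfl⟩ := hQ0 x ((mul_eq_zero.1 h1).resolve_left hWne)
    exact hAz i hi hx
  have hnear : ∀ᶠ x in 𝓝[≠] (0 : ℂ), ∀ i ∈ s, x ≠ z i := by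
    rw [Filter.eventually_all_finset]
    exact fun i hi => (eventually_ne_nhds (hz0 i hi).symm).filter_mono nhdsWithin_le_nhds
  -- the equation of critical points
  have hcrit : ∃ᶠ x in 𝓝[≠] (0 : ℂ), starRingEnd ℂ x * B.eval x = A.eval x := by
    refine (hfreq.and_eventually hnear).mono fun x ⟨hx, hxz⟩ => ?_
    have hAQ : A.eval x = Q.eval x * ∑ i ∈ s, (w i : ℂ) / (x - z i) := by
      rw [hA, eval_finsetSum, Finset.mul_sum]
      refine Finset.sum_congr rfl fun i hi => ?_
      have hne : x - z i ≠ 0 := sub_ne_zero.2 (hxz i hi)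
      rw [hQ, eval_prod, ← Finset.mul_prod_erase s _ hi, eval_mul, eval_prod]
      simp only [eval_sub, eval_X, eval_C]
      field_simp
    have h1 : (1 + ‖x‖ ^ 2 : ℝ) = 1 + x * starRingEnd ℂ x := by
      rw [Complex.mul_conj, Complex.normSq_eq_norm_sq]; push_cast; rfl
    have h2 : ((1 + ‖x‖ ^ 2 : ℝ) : ℂ) ≠ 0 := by
      have : (0 : ℝ) < 1 + ‖x‖ ^ 2 := by positivity
      exact_mod_cast this.ne'
    have h3 : (W : ℂ) * starRingEnd ℂ x =
        (∑ i ∈ s, (w i : ℂ) / (x - z i)) * (1 + x * starRingEnd ℂ x) := by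
      rw [potGrad, sub_eq_zero, div_eq_iff h2, h1] at hx
      exact hx
    have h4 : B.eval x = (W : ℂ) * Q.eval x - x * A.eval x := by simp [hB]
    rw [h4, hAQ]
    linear_combination Q.eval x * h3
  have htend (p : ℂ[X]) : Tendsto (fun x => p.eval x) (𝓝[≠] (0 : ℂ)) (𝓝 (p.eval 0)) :=
    p.continuous.continuousAt.tendsto.mono_left nhdsWithin_le_nhds
  have hconj0 : Tendsto (fun x : ℂ => starRingEnd ℂ x) (𝓝[≠] (0 : ℂ)) (𝓝 0) := by
    have := (Complex.continuous_conj.tendsto (0 : ℂ)).mono_left (nhdsWithin_le_nhds (s := {0}ᶜ))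
    simpa using this
  have hA0 : A.eval 0 = 0 := by
    by_contra h
    have h1 := (hconj0.mul (htend B)).sub (htend A)
    rw [zero_mul, zero_sub] at h1
    exact hcrit ((h1.eventually_ne (neg_ne_zero.2 h)).mono fun x hx he => hx (sub_eq_zero.2 he))
  have hB0 : B.eval 0 ≠ 0 := hBA 0 hA0
  obtain ⟨A₁, hA₁⟩ : X ∣ A := by rwa [X_dvd_iff, coeff_zero_eq_eval_zero]
  have hA₁0 : A₁.eval 0 ≠ 0 := by
    intro h
    have h1 := ((htend B).norm).sub ((htend A₁).norm)
    rw [h, norm_zero, sub_zero] at h1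
    refine hcrit ((h1.eventually_ne (norm_ne_zero_iff.2 hB0)).mp ?_)
    filter_upwards [self_mem_nhdsWithin] with x hx hne he
    refine hne ?_
    have hx0 : ‖x‖ ≠ 0 := norm_ne_zero_iff.2 hx
    have h2 := congrArg norm he
    rw [hA₁, eval_mul, eval_X, norm_mul, norm_mul, RCLike.norm_conj] at h2
    rw [sub_eq_zero]
    exact mul_left_cancel₀ hx0 h2
  have hA₁deg : A₁.degree ≠ 0 := by
    intro h
    have h1 : A.natDegree ≤ 1 := by
      have h2 : A₁.natDegree = 0 := natDegree_eq_zero_iff_degree_le_zero.2 h.le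
      rw [hA₁]
      refine natDegree_mul_le.trans ?_
      rw [h2]; simp
    omega
  obtain ⟨ζ, hζ⟩ := IsAlgClosed.exists_root A₁ hA₁deg
  have hζ0 : ζ ≠ 0 := fun h => hA₁0 (h ▸ hζ.eq_zero)
  have hAζ : A.eval ζ = 0 := by rw [hA₁, eval_mul, hζ.eq_zero, mul_zero]
  -- the identity `x = conj r (r x)`, cleared of its outer denominator
  set A' : ℂ[X] := A.map (starRingEnd ℂ) with hA'
  set B' : ℂ[X] := B.map (starRingEnd ℂ) with hB'
  have hmap (p : ℂ[X]) (y : ℂ) :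
      (p.map (starRingEnd ℂ)).eval (starRingEnd ℂ y) = starRingEnd ℂ (p.eval y) := by
    rw [eval_map, eval₂_hom]
  set U : Set ℂ := {x | B.eval x ≠ 0} with hU
  set φ : ℂ → ℂ := fun x =>
    x * B'.eval (A.eval x / B.eval x) - A'.eval (A.eval x / B.eval x) with hφ
  have hUcompl : Uᶜ.Finite := by
    have : Uᶜ = B.rootSet ℂ ∨ B = 0 := by
      by_cases h : B = 0
      · exact Or.inr h
      · left
        ext x
        simp [hU, mem_rootSet, h]
    rcases this with h | h
    · rw [h]; exact B.rootSet_finite ℂ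
    · exact absurd (by rw [h, eval_zero]) hB0
  have hUconn : IsPreconnected U := by
    have := (hUcompl.countable.isPathConnected_compl_of_one_lt_rank
      (by rw [Complex.rank_real_complex]; norm_num)).isConnected.isPreconnected
    rwa [compl_compl] at this
  have han (p : ℂ[X]) : AnalyticOnNhd ℂ (fun x => p.eval x) univ := AnalyticOnNhd.eval_polynomial p
  have hφan : AnalyticOnNhd ℂ φ U := by
    intro x hx
    have hr : AnalyticAt ℂ (fun x => A.eval x / B.eval x) x :=
      (han A x (mem_univ _)).div (han B x (mem_univ _)) hx
    have hcomp (p : ℂ[X]) : AnalyticAt ℂ (fun x => p.eval (A.eval x / B.eval x)) x :=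
      (han p _ (mem_univ _)).fun_comp hr
    exact (analyticAt_id.mul (hcomp B')).sub (hcomp A')
  have hφ0 : ∃ᶠ x in 𝓝[≠] (0 : ℂ), φ x = 0 := by
    have hev : ∀ᶠ x in 𝓝[≠] (0 : ℂ), B.eval x ≠ 0 := (htend B).eventually_ne hB0
    refine (hcrit.and_eventually hev).mono fun x ⟨hx, hBx⟩ => ?_
    have h1 : A.eval x / B.eval x = starRingEnd ℂ x := by
      rw [div_eq_iff hBx, hx]
    simp only [hφ, h1, hA', hB', hmap]
    rw [← hx, map_mul, Complex.conj_conj, sub_self]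
  have hzero := hφan.eqOn_zero_of_preconnected_of_frequently_eq_zero hUconn
    (show (0 : ℂ) ∈ U from hB0) hφ0 (show ζ ∈ U from hBA ζ hAζ)
  simp only [hφ, hAζ, zero_div, Pi.zero_apply] at hzero
  have hA'0 : A'.eval 0 = 0 := by
    have := hmap A 0
    rwa [hA0, map_zero] at this
  have hB'0 : B'.eval 0 ≠ 0 := by
    have := hmap B 0
    rw [map_zero] at this
    rw [hB', this]
    simpa using hB0
  rw [hA'0, sub_zero] at hzero
  exact (mul_ne_zero hζ0 hB'0) hzero

end Potential

/-! ### Star-shaped coordinates at a degenerate minimum -/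

/-- A function with positive second derivative has a strict minimum at its critical point. -/
theorem lt_of_second_deriv_pos {f f₁ f₂ : ℝ → ℝ} {δ : ℝ}
    (h1 : ∀ s, |s| < δ → HasDerivAt f (f₁ s) s) (h2 : ∀ s, |s| < δ → HasDerivAt f₁ (f₂ s) s)
    (hpos : ∀ s, |s| < δ → 0 < f₂ s) (h0 : f₁ 0 = 0) {s : ℝ} (hs : |s| < δ) (hs0 : s ≠ 0) :
    f 0 < f s := by
  have hδ : 0 < δ := (abs_nonneg s).trans_lt hs
  have hm : StrictMonoOn f₁ (Ioo (-δ) δ) := by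
    refine strictMonoOn_of_deriv_pos (convex_Ioo _ _)
      (fun x hx => (h2 x (abs_lt.2 hx)).continuousAt.continuousWithinAt) fun x hx => ?_
    rw [interior_Ioo] at hx
    rw [(h2 x (abs_lt.2 hx)).deriv]
    exact hpos x (abs_lt.2 hx)
  have h0mem : (0 : ℝ) ∈ Ioo (-δ) δ := ⟨by linarith, hδ⟩
  rw [abs_lt] at hs
  rcases lt_or_gt_of_ne hs0 with hneg | hpos'
  · have ha : StrictAntiOn f (Icc s 0) := by
      refine strictAntiOn_of_deriv_neg (convex_Icc _ _) (fun x hx => (h1 x (abs_lt.2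
        ⟨by linarith [hx.1], by linarith [hx.2]⟩)).continuousAt.continuousWithinAt) fun x hx => ?_
      rw [interior_Icc] at hx
      have hxm : x ∈ Ioo (-δ) δ := ⟨by linarith [hx.1], by linarith [hx.2]⟩
      rw [(h1 x (abs_lt.2 hxm)).deriv, ← h0]
      exact hm hxm h0mem hx.2
    exact ha (left_mem_Icc.2 hneg.le) (right_mem_Icc.2 hneg.le) hneg
  · have ha : StrictMonoOn f (Icc 0 s) := by
      refine strictMonoOn_of_deriv_pos (convex_Icc _ _) (fun x hx => (h1 x (abs_lt.2
        ⟨by linarith [hx.1], by linarith [hx.2]⟩)).continuousAt.continuousWithinAt) fun x hx => ?_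
      rw [interior_Icc] at hx
      have hxm : x ∈ Ioo (-δ) δ := ⟨by linarith [hx.1], by linarith [hx.2]⟩
      rw [(h1 x (abs_lt.2 hxm)).deriv, ← h0]
      exact hm h0mem hxm hx.1
    exact ha (left_mem_Icc.2 hpos'.le) (right_mem_Icc.2 hpos'.le) hpos'

/-- If `0` is a local minimum and an isolated critical point, the derivative is positive on the
right of `0`. -/
theorem eventually_deriv_pos_right {f f' : ℝ → ℝ} (hf : ∀ᶠ s in 𝓝 0, HasDerivAt f (f' s) s)
    (hc : ∀ᶠ s in 𝓝 0, ContinuousAt f' s) (h0 : ∀ᶠ s in 𝓝[≠] 0, f' s ≠ 0)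
    (hmin : IsLocalMin f 0) : ∀ᶠ s in 𝓝 (0 : ℝ), 0 < s → 0 < f' s := by
  rw [eventually_nhdsWithin_iff] at h0
  obtain ⟨δ, hδ, h⟩ := Metric.eventually_nhds_iff.1 (hf.and (hc.and (h0.and hmin)))
  have hd {s : ℝ} (hs : s ∈ Ioo (-δ) δ) : dist s 0 < δ := by
    rw [Real.dist_0_eq_abs, abs_lt]; exact hs
  refine Metric.eventually_nhds_iff.2 ⟨δ, hδ, fun s hs hs0 => ?_⟩
  rw [Real.dist_0_eq_abs, abs_lt] at hs
  by_contra hcon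
  have hneg : ∀ x ∈ Ioo 0 δ, f' x < 0 := by
    intro x hx
    have hs' : s ∈ Ioo 0 δ := ⟨hs0, hs.2⟩
    have hne : ∀ y ∈ Ioo 0 δ, f' y ≠ 0 := fun y hy =>
      (h (hd ⟨by linarith [hy.1], hy.2⟩)).2.2.1 hy.1.ne'
    by_contra hx0
    have hpre : IsPreconnected (Ioo (0 : ℝ) δ) := isPreconnected_Ioo
    obtain ⟨y, hy, hy0⟩ := hpre.intermediate_value hs' hx (f := f')
      (fun y hy => (h (hd ⟨by linarith [hy.1], hy.2⟩)).2.1.continuousWithinAt)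
      ⟨not_lt.1 hcon, not_lt.1 hx0⟩
    exact hne y hy hy0
  have hanti : StrictAntiOn f (Icc 0 s) := by
    refine strictAntiOn_of_deriv_neg (convex_Icc _ _) (fun x hx => (h (hd
      ⟨by linarith [hx.1], by linarith [hx.2, hs.2]⟩)).1.continuousAt.continuousWithinAt)
      fun x hx => ?_
    rw [interior_Icc] at hx
    rw [(h (hd ⟨by linarith [hx.1], by linarith [hx.2, hs.2]⟩)).1.deriv]
    exact hneg x ⟨hx.1, by linarith [hx.2, hs.2]⟩
  have h1 := hanti (left_mem_Icc.2 hs0.le) (right_mem_Icc.2 hs0.le) hs0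
  exact absurd (h (hd hs)).2.2.2 (not_le.2 h1)

/-- At a local minimum that is an isolated critical point, the derivative has the sign of the
variable. -/
theorem eventually_mul_deriv_pos {f f' : ℝ → ℝ} (hf : ∀ᶠ s in 𝓝 0, HasDerivAt f (f' s) s)
    (hc : ∀ᶠ s in 𝓝 0, ContinuousAt f' s) (h0 : ∀ᶠ s in 𝓝[≠] 0, f' s ≠ 0)
    (hmin : IsLocalMin f 0) : ∀ᶠ s in 𝓝[≠] (0 : ℝ), 0 < s * f' s := by
  have hneg : Tendsto (fun s : ℝ => -s) (𝓝 0) (𝓝 0) := by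
    simpa using (continuous_neg.tendsto (0 : ℝ))
  have hneg' : Tendsto (fun s : ℝ => -s) (𝓝[≠] 0) (𝓝[≠] 0) :=
    tendsto_nhdsWithin_iff.2 ⟨hneg.mono_left nhdsWithin_le_nhds, by
      filter_upwards [self_mem_nhdsWithin] with s hs
      exact neg_ne_zero.2 hs⟩
  have h1 := eventually_deriv_pos_right hf hc h0 hmin
  have h2 := eventually_deriv_pos_right (f := fun s => f (-s)) (f' := fun s => -f' (-s))
    ((hneg.eventually hf).mono fun s hs => by
      have := hs.comp s (hasDerivAt_neg s)
      rwa [mul_neg, mul_one] at this)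
    ((hneg.eventually hc).mono fun s hs =>
      (ContinuousAt.comp (g := f') hs continuous_neg.continuousAt).neg)
    ((hneg'.eventually h0).mono fun s hs => neg_ne_zero.2 hs)
    (by
      have : ∀ᶠ s in 𝓝 (0 : ℝ), f 0 ≤ f (-s) := hneg.eventually hmin
      simpa [IsLocalMin, IsMinFilter] using this)
  filter_upwards [h1.filter_mono nhdsWithin_le_nhds, (hneg.eventually h2).filter_mono
    nhdsWithin_le_nhds, self_mem_nhdsWithin] with s hs1 hs2 hs0
  rcases lt_or_gt_of_ne (show s ≠ 0 from hs0) with h | h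
  · have := hs2 (neg_pos.2 h)
    rw [neg_neg] at this
    nlinarith
  · exact mul_pos h (hs1 h)

/-- A criterion for the level sets of `G` to be star-shaped about `0`: along the axis `i ℝ` the
transversal derivative vanishes and the longitudinal derivative points outwards, and the
transversal second derivative is positive at `0`. Indeed `E w = dG(w) w` restricted to a
transversal line has positive second derivative, and its minimum on the axis. -/
theorem eventually_radial_deriv_pos {G : ℂ → ℝ} (hG : ContDiffAt ℝ 3 G 0)
    (h1 : ∀ᶠ b : ℝ in 𝓝 0, fderiv ℝ G (b * Complex.I) 1 = 0)
    (h2 : 0 < fderiv ℝ (fun w => fderiv ℝ G w 1) 0 1)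
    (h3 : ∀ᶠ b : ℝ in 𝓝[≠] 0, 0 < b * fderiv ℝ G (b * Complex.I) Complex.I) :
    ∀ᶠ w in 𝓝[≠] (0 : ℂ), 0 < fderiv ℝ G w w := by
  set D := fderiv ℝ G with hD
  set D2 := fderiv ℝ D with hD2
  have hDc : ContDiffAt ℝ 2 D 0 := hG.fderiv_right (by norm_num)
  have hD2c : ContDiffAt ℝ 1 D2 0 := hDc.fderiv_right (by norm_num)
  -- the first two derivatives of `E w = D w w` in the real direction
  set E₁ : ℂ → ℝ := fun w => D w 1 + D2 w 1 w with hE₁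
  have hE₁c : ContDiffAt ℝ 1 E₁ 0 :=
    ((hDc.of_le (by norm_num)).clm_apply contDiffAt_const).add
      ((hD2c.clm_apply contDiffAt_const).clm_apply contDiffAt_id)
  set E₂ : ℂ → ℝ := fun w => fderiv ℝ E₁ w 1 with hE₂
  have hE₂c : ContinuousAt E₂ 0 :=
    ((hE₁c.fderiv_right (m := 0) (by norm_num)).clm_apply contDiffAt_const).continuousAt
  have hDd : ∀ᶠ w in 𝓝 (0 : ℂ), DifferentiableAt ℝ D w :=
    (hDc.eventually (by simp)).mono fun w hw => hw.differentiableAt (by norm_num)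
  have hE₁d : ∀ᶠ w in 𝓝 (0 : ℂ), DifferentiableAt ℝ E₁ w :=
    (hE₁c.eventually (by simp)).mono fun w hw => hw.differentiableAt (by norm_num)
  have hEd : ∀ w, DifferentiableAt ℝ D w →
      HasFDerivAt (fun w => D w w) (D w + (D2 w).flip w) w := by
    intro w hw
    refine (hw.hasFDerivAt.clm_apply (hasFDerivAt_id w)).congr_fderiv ?_
    ext; simp [hD2]
  have hE₂0 : 0 < E₂ 0 := by
    have hd0 : DifferentiableAt ℝ D 0 := hDc.differentiableAt (by norm_num)
    have hd1 : DifferentiableAt ℝ D2 0 := hD2c.differentiableAt (by norm_num)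
    have h4 : HasFDerivAt (fun w => D w 1) ((D2 0).flip 1) 0 :=
      (hd0.hasFDerivAt.clm_apply (hasFDerivAt_const (1 : ℂ) (0 : ℂ))).congr_fderiv
        (by ext; simp [hD2])
    have h5 := ((hd1.hasFDerivAt.clm_apply (hasFDerivAt_const (1 : ℂ) (0 : ℂ))).clm_apply
      (hasFDerivAt_id (0 : ℂ)))
    have h6 := h4.add h5
    have h7 : E₂ 0 = 2 * (D2 0 1 1) := by
      simp only [hE₂]
      rw [show E₁ = _ from rfl]
      have h8 := h6.fderiv
      have h9 : fderiv ℝ E₁ 0 = _ := h8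
      rw [h9]
      simp
      ring
    rw [h7]
    have h10 : fderiv ℝ (fun w => D w 1) 0 1 = D2 0 1 1 := by rw [h4.fderiv]; simp
    rw [h10] at h2
    linarith
  have hE₂ev : ∀ᶠ w in 𝓝 (0 : ℂ), 0 < E₂ w := hE₂c.eventually (lt_mem_nhds hE₂0)
  have hsymm : ∀ᶠ w in 𝓝 (0 : ℂ), D2 w 1 Complex.I = D2 w Complex.I 1 := by
    filter_upwards [hG.eventually (by simp)] with w hw
    exact (hw.isSymmSndFDerivAt (by simp; norm_num)) 1 Complex.I
  have hI : Tendsto (fun b : ℝ => (b : ℂ) * Complex.I) (𝓝 0) (𝓝 0) := by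
    have : Continuous fun b : ℝ => (b : ℂ) * Complex.I := by fun_prop
    simpa using this.tendsto 0
  have hE₁0 : ∀ᶠ b : ℝ in 𝓝 0, E₁ (b * Complex.I) = 0 := by
    filter_upwards [h1, h1.eventually_nhds, hI.eventually hDd, hI.eventually hsymm]
      with b hb hb' hd hs
    have h4 : HasDerivAt (fun b : ℝ => D (b * Complex.I) 1) (D2 (b * Complex.I) Complex.I 1) b := by
      have h5 : HasDerivAt (fun b : ℝ => (b : ℂ) * Complex.I) Complex.I b := by
        simpa using (Complex.ofRealCLM.hasDerivAt (x := b)).mul_const Complex.I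
      have h6 : HasDerivAt (fun b : ℝ => D (b * Complex.I)) (D2 (b * Complex.I) Complex.I) b :=
        hd.hasFDerivAt.comp_hasDerivAt b h5
      simpa using h6.clm_apply (hasDerivAt_const b (1 : ℂ))
    have h5 : HasDerivAt (fun b : ℝ => D (b * Complex.I) 1) 0 b :=
      (hasDerivAt_const b (0 : ℝ)).congr_of_eventuallyEq hb'
    have h6 := h4.unique h5
    simp only [hE₁]
    rw [hb, ← Complex.real_smul, map_smul, Complex.real_smul, hs, h6]
    simp
  rw [eventually_nhdsWithin_iff] at h3
  obtain ⟨δ, hδ, hball⟩ := Metric.eventually_nhds_iff.1 (hDd.and (hE₁d.and hE₂ev))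
  obtain ⟨η, hη, hline⟩ := Metric.eventually_nhds_iff.1 (h3.and hE₁0)
  rw [eventually_nhdsWithin_iff]
  refine Metric.eventually_nhds_iff.2 ⟨min (δ / 2) η, by positivity, fun w hw hw0 => ?_⟩
  rw [dist_zero_right, lt_min_iff] at hw
  have hre : |w.re| < δ / 2 := (Complex.abs_re_le_norm w).trans_lt hw.1
  have him : |w.im| < δ / 2 := (Complex.abs_im_le_norm w).trans_lt hw.1
  have him' : dist w.im 0 < η := by
    rw [Real.dist_0_eq_abs]; exact (Complex.abs_im_le_norm w).trans_lt hw.2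
  have hin {s : ℝ} (hs : |s| < δ / 2) : dist ((s : ℂ) + w.im * Complex.I) 0 < δ := by
    rw [dist_zero_right]
    refine (Complex.norm_le_abs_re_add_abs_im _).trans_lt ?_
    simp
    linarith
  have hpath (s : ℝ) : HasDerivAt (fun s : ℝ => (s : ℂ) + w.im * Complex.I) 1 s := by
    simpa using (Complex.ofRealCLM.hasDerivAt (x := s)).add_const (w.im * Complex.I)
  have hw' : (w.re : ℂ) + w.im * Complex.I = w := Complex.re_add_im w
  set f : ℝ → ℝ := fun s => D (s + w.im * Complex.I) (s + w.im * Complex.I) with hf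
  have hlt : w.re ≠ 0 → f 0 < f w.re := fun hne =>
    lt_of_second_deriv_pos (f := f) (f₁ := fun s : ℝ => E₁ (s + w.im * Complex.I))
      (f₂ := fun s : ℝ => E₂ (s + w.im * Complex.I)) (δ := δ / 2)
      (fun s hs => by
        have := (hEd _ (hball (hin hs)).1).comp_hasDerivAt s (hpath s)
        exact this)
      (fun s hs => HasFDerivAt.comp_hasDerivAt (l := E₁) s (hball (hin hs)).2.1.hasFDerivAt
        (hpath s))
      (fun s hs => (hball (hin hs)).2.2)
      (by simpa using (hline him').2) hre hne
  have hf0 : f 0 = w.im * D (w.im * Complex.I) Complex.I := by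
    simp only [hf, Complex.ofReal_zero, zero_add]
    conv_lhs => rw [← Complex.real_smul, map_smul]
    rw [Complex.real_smul, smul_eq_mul]
  have hfw : f w.re = D w w := by simp only [hf, hw']
  rw [← hfw]
  by_cases hb : w.im = 0
  · have hr : w.re ≠ 0 := fun hr => hw0 (Complex.ext hr hb)
    have := hlt hr
    rwa [hf0, hb, zero_mul] at this
  · have h4 := (hline him').1 hb
    rw [← hf0] at h4
    by_cases hr : w.re = 0
    · rwa [hr]
    · exact h4.trans (hlt hr)

/-- The plane shear `w ↦ w + φ (Im w)`. -/
noncomputable def shear (φ : ℝ → ℝ) (w : ℂ) : ℂ := w + φ w.im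

theorem shear_im (φ : ℝ → ℝ) (w : ℂ) : (shear φ w).im = w.im := by simp [shear]

/-- Let `0` be a local minimum of `K` and an isolated critical point, and let the second derivative
of `K` in the real direction be positive. After a shear that straightens the curve on which the
derivative in the real direction vanishes, the level sets around `0` are star-shaped. -/
theorem exists_shear {K : ℂ → ℝ} (hK : ContDiffAt ℝ 4 K 0)
    (hmin : IsLocalMin K 0) (haa : 0 < fderiv ℝ (fun z => fderiv ℝ K z 1) 0 1)
    (hiso : ∀ᶠ z in 𝓝[≠] (0 : ℂ), fderiv ℝ K z ≠ 0) :
    ∃ φ : ℝ → ℝ, ContDiffAt ℝ 3 φ 0 ∧ φ 0 = 0 ∧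
      ∀ᶠ w in 𝓝[≠] (0 : ℂ), 0 < fderiv ℝ (fun w => K (shear φ w)) w w := by
  set Ka : ℂ → ℝ := fun z => fderiv ℝ K z 1 with hKa
  have hKac : ContDiffAt ℝ 3 Ka 0 :=
    (hK.fderiv_right (m := 3) (by norm_num)).clm_apply contDiffAt_const
  have hK0 : fderiv ℝ K 0 = 0 := hmin.fderiv_eq_zero
  set j : ℝ × ℝ →L[ℝ] ℂ := Complex.ofRealCLM.comp (ContinuousLinearMap.snd ℝ ℝ ℝ) +
    (ContinuousLinearMap.fst ℝ ℝ ℝ).smulRight Complex.I with hj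
  have hj0 : j (0, 0) = 0 := by simp [hj]
  have hjab (b a : ℝ) : j (b, a) = a + b * Complex.I := by simp [hj]
  set P : ℝ × ℝ → ℝ := fun p => Ka (j p) with hP
  have hPc : ContDiffAt ℝ 3 P (0, 0) :=
    ContDiffAt.comp (g := Ka) (0, 0) (by rw [hj0]; exact hKac) j.contDiff.contDiffAt
  have hPd : HasFDerivAt P ((fderiv ℝ Ka 0).comp j) (0, 0) := by
    refine HasFDerivAt.comp (g := Ka) (0, 0) ?_ j.hasFDerivAt
    rw [hj0]
    exact (hKac.differentiableAt (by norm_num)).hasFDerivAt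
  have hinv : (fderiv ℝ P (0, 0) ∘L .inr ℝ ℝ ℝ).IsInvertible := by
    set a := fderiv ℝ Ka 0 1 with ha
    refine ⟨ContinuousLinearEquiv.unitsEquivAut ℝ (Units.mk0 a haa.ne'), ?_⟩
    ext
    rw [hPd.fderiv]
    simp [hj, ha]
  -- the curve `a = φ b` on which the derivative `Ka` in the real direction vanishes
  set φ := hPc.implicitFunction (by norm_num) hinv with hφ
  have hφc : ContDiffAt ℝ 3 φ 0 := hPc.contDiffAt_implicitFunction (by norm_num) hinv
  have hφ0 : φ 0 = 0 := hPc.implicitFunction_apply_self (by norm_num) hinv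
  have hφP : ∀ᶠ b in 𝓝 (0 : ℝ), Ka (φ b + b * Complex.I) = 0 := by
    have h1 := hPc.eventually_apply_implicitFunction (by norm_num) hinv
    have h2 : P (0, 0) = 0 := by simp only [hP, hj0, hKa, hK0]; simp
    filter_upwards [h1] with b hb
    rw [h2] at hb
    rw [← hjab]
    exact hb
  refine ⟨φ, hφc, hφ0, ?_⟩
  have hsh0 : shear φ 0 = 0 := by simp [shear, hφ0]
  have hshc : ContDiffAt ℝ 3 (shear φ) 0 := by
    unfold shear
    refine contDiffAt_id.add ?_
    refine Complex.ofRealCLM.contDiff.contDiffAt.comp (0 : ℂ) ?_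
    exact ContDiffAt.comp (g := φ) (0 : ℂ) (by simpa using hφc) Complex.imCLM.contDiff.contDiffAt
  set G : ℂ → ℝ := fun w => K (shear φ w) with hG
  have hGc : ContDiffAt ℝ 3 G 0 :=
    ContDiffAt.comp (g := K) (0 : ℂ) (by rw [hsh0]; exact hK.of_le (by norm_num)) hshc
  have hsht : Tendsto (shear φ) (𝓝 0) (𝓝 0) := by
    have := hshc.continuousAt
    rwa [ContinuousAt, hsh0] at this
  have hφd : ∀ᶠ b in 𝓝 (0 : ℝ), DifferentiableAt ℝ φ b :=
    (hφc.eventually (by simp)).mono fun b hb => hb.differentiableAt (by norm_num)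
  have hKd : ∀ᶠ z in 𝓝 (0 : ℂ), DifferentiableAt ℝ K z :=
    (hK.eventually (by simp)).mono fun b hb => hb.differentiableAt (by norm_num)
  have him : Tendsto Complex.im (𝓝 0) (𝓝 0) := by simpa using Complex.continuous_im.tendsto 0
  have hGd : ∀ᶠ w in 𝓝 (0 : ℂ), ∀ v, fderiv ℝ G w v =
      fderiv ℝ K (shear φ w) (v + (deriv φ w.im * v.im : ℝ)) := by
    filter_upwards [him.eventually hφd, hsht.eventually hKd] with w hw1 hw2 v
    have h1 : HasFDerivAt (fun w : ℂ => φ w.im) (deriv φ w.im • Complex.imCLM) w :=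
      hw1.hasDerivAt.comp_hasFDerivAt w Complex.imCLM.hasFDerivAt
    have h2 : HasFDerivAt (shear φ) (ContinuousLinearMap.id ℝ ℂ +
        Complex.ofRealCLM.comp (deriv φ w.im • Complex.imCLM)) w :=
      (hasFDerivAt_id w).add (Complex.ofRealCLM.hasFDerivAt.comp w h1)
    have h3 : HasFDerivAt G _ w := hw2.hasFDerivAt.comp w h2
    rw [h3.fderiv]
    rfl
  have hI : Tendsto (fun b : ℝ => (b : ℂ) * Complex.I) (𝓝 0) (𝓝 0) := by
    have : Continuous fun b : ℝ => (b : ℂ) * Complex.I := by fun_prop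
    simpa using this.tendsto 0
  have hshI (b : ℝ) : shear φ (b * Complex.I) = φ b + b * Complex.I := by
    simp [shear, add_comm]
  have hG1 : ∀ᶠ w in 𝓝 (0 : ℂ), fderiv ℝ G w 1 = Ka (shear φ w) := by
    filter_upwards [hGd] with w hw
    rw [hw]
    simp [hKa]
  refine eventually_radial_deriv_pos hGc ?_ ?_ ?_
  · filter_upwards [hI.eventually hG1, hφP] with b h1 h2
    rw [h1, hshI, h2]
  · have h1 : fderiv ℝ (fun w => fderiv ℝ G w 1) 0 = fderiv ℝ (fun w => Ka (shear φ w)) 0 :=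
      Filter.EventuallyEq.fderiv_eq hG1
    have h2 : HasFDerivAt (fun w : ℂ => φ w.im) (deriv φ 0 • Complex.imCLM) 0 := by
      have : HasDerivAt φ (deriv φ 0) (Complex.im 0) := (hφd.self_of_nhds).hasDerivAt
      exact this.comp_hasFDerivAt (0 : ℂ) Complex.imCLM.hasFDerivAt
    have h3 : HasFDerivAt (shear φ) (ContinuousLinearMap.id ℝ ℂ +
        Complex.ofRealCLM.comp (deriv φ 0 • Complex.imCLM)) 0 :=
      (hasFDerivAt_id (0 : ℂ)).add (Complex.ofRealCLM.hasFDerivAt.comp (0 : ℂ) h2)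
    have h4 : HasFDerivAt Ka (fderiv ℝ Ka 0) (shear φ 0) := by
      rw [hsh0]; exact (hKac.differentiableAt (by norm_num)).hasFDerivAt
    have h5 : HasFDerivAt (fun w => Ka (shear φ w)) _ 0 := h4.comp (0 : ℂ) h3
    rw [h1, h5.fderiv]
    simpa using haa
  · -- the restriction of `K` to the straightened curve
    have hψ : ∀ᶠ b : ℝ in 𝓝 0, HasDerivAt (fun b : ℝ => G (b * Complex.I))
        (fderiv ℝ G (b * Complex.I) Complex.I) b := by
      have hGdiff : ∀ᶠ w in 𝓝 (0 : ℂ), DifferentiableAt ℝ G w :=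
        (hGc.eventually (by simp)).mono fun b hb => hb.differentiableAt (by norm_num)
      filter_upwards [hI.eventually hGdiff] with b hb
      have h5 : HasDerivAt (fun b : ℝ => (b : ℂ) * Complex.I) Complex.I b := by
        simpa using (Complex.ofRealCLM.hasDerivAt (x := b)).mul_const Complex.I
      exact HasFDerivAt.comp_hasDerivAt (l := G) b hb.hasFDerivAt h5
    refine eventually_mul_deriv_pos hψ ?_ ?_ ?_
    · have h1 : ∀ᶠ w in 𝓝 (0 : ℂ), ContinuousAt (fun w => fderiv ℝ G w Complex.I) w :=
        (hGc.eventually (by simp)).mono fun w hw =>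
          ((hw.fderiv_right (m := 2) (by norm_num)).clm_apply contDiffAt_const).continuousAt
      filter_upwards [hI.eventually h1] with b hb
      exact ContinuousAt.comp (g := fun w => fderiv ℝ G w Complex.I) hb
        (by fun_prop : Continuous fun b : ℝ => (b : ℂ) * Complex.I).continuousAt
    · rw [eventually_nhdsWithin_iff] at hiso ⊢
      have h1 : Tendsto (fun b : ℝ => shear φ (b * Complex.I)) (𝓝 0) (𝓝 0) := hsht.comp hI
      filter_upwards [hI.eventually hGd, hφP, h1.eventually hiso] with b hb1 hb2 hb3 hb0 hzero
      have hne : shear φ (b * Complex.I) ≠ 0 := by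
        intro h
        have := congrArg Complex.im h
        rw [shear_im] at this
        simp at this
        exact hb0 this
      refine hb3 hne ?_
      rw [hb1] at hzero
      have ha : fderiv ℝ K (shear φ (b * Complex.I)) 1 = 0 := by rw [hshI]; exact hb2
      have hreal (r : ℝ) : fderiv ℝ K (shear φ (b * Complex.I)) (r : ℂ) = 0 := by
        rw [show (r : ℂ) = r • (1 : ℂ) by simp, map_smul, ha, smul_zero]
      rw [map_add, hreal, add_zero] at hzero
      refine ContinuousLinearMap.ext fun v => ?_
      have hv : v = (v.re : ℂ) + v.im • Complex.I := by simp
      rw [hv, map_add, hreal, map_smul, hzero]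
      simp
    · have h1 : Tendsto (fun b : ℝ => shear φ (b * Complex.I)) (𝓝 0) (𝓝 0) := hsht.comp hI
      have h2 : ∀ᶠ b : ℝ in 𝓝 0, K 0 ≤ G (b * Complex.I) := h1.eventually hmin
      have h3 : G (((0 : ℝ) : ℂ) * Complex.I) = K 0 := by simp [hG, hsh0]
      rw [← h3] at h2
      exact h2

/-! ### Level sets in a disc -/

/-- The part of a planar family that depends on the chosen range of energies `I` and on the limit
`l` of the energy: every ray meets every level in `I`, levels near `0` belong to `I`, and the level
sets shrink to `0` as the energy tends to its limit. -/
structure IsLevelRange (G : ℂ → ℝ) (r : ℝ) (I : Set ℝ) (l : Filter ℝ) : Prop where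
  isOpen : IsOpen I
  exists_eq : ∀ e ∈ I, ∀ θ : ℝ, ∃ s : ℝ, 0 < s ∧ s < r ∧ G (s * Complex.exp (θ * Complex.I)) = e
  eventually_mem : ∀ᶠ w in 𝓝[≠] (0 : ℂ), G w ∈ I
  shrink : ∀ δ > 0, ∀ᶠ e in l, e ∈ I ∧ ∀ w, 0 < ‖w‖ → ‖w‖ < r → G w = e → ‖w‖ < δ

theorem hasDerivAt_ray {G : ℂ → ℝ} {G' : ℂ →L[ℝ] ℝ} {c : ℂ} {s : ℝ}
    (hG : HasFDerivAt G G' (s * c)) : HasDerivAt (fun s : ℝ => G (s * c)) (G' c) s := by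
  have h1 : HasDerivAt (fun s : ℝ => (s : ℂ) * c) c s := by
    simpa using (Complex.ofRealCLM.hasDerivAt (x := s)).mul_const c
  exact HasFDerivAt.comp_hasDerivAt (l := G) s hG h1

theorem norm_ofReal_mul_of_norm_one {c : ℂ} (hc : ‖c‖ = 1) {s : ℝ} (hs : 0 ≤ s) :
    ‖(s : ℂ) * c‖ = s := by
  rw [norm_mul, hc, mul_one, Complex.norm_real, Real.norm_of_nonneg hs]

theorem eq_norm_mul_unit {w : ℂ} (hw : w ≠ 0) : ∃ c : ℂ, ‖c‖ = 1 ∧ w = ‖w‖ * c := by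
  have h : (‖w‖ : ℂ) ≠ 0 := by exact_mod_cast norm_ne_zero_iff.2 hw
  refine ⟨w / ‖w‖, ?_, ?_⟩
  · rw [norm_div, Complex.norm_real, norm_norm, div_self (norm_ne_zero_iff.2 hw)]
  · field_simp

/-- If `G` increases along rays, its values along a ray are ordered as the radii. -/
theorem ray_lt_of_radial_pos {G : ℂ → ℝ} {r₀ : ℝ}
    {G' : ℂ → ℂ →L[ℝ] ℝ} (hd : ∀ w, 0 < ‖w‖ → ‖w‖ < r₀ → HasFDerivAt G (G' w) w)
    (hpos : ∀ w, 0 < ‖w‖ → ‖w‖ < r₀ → 0 < G' w w) {c : ℂ} (hcn : ‖c‖ = 1) {s t : ℝ} (hs : 0 < s)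
    (hst : s < t) (ht : t < r₀) : G (s * c) < G (t * c) := by
  have hn {x : ℝ} (hx : s ≤ x) : ‖(x : ℂ) * c‖ = x :=
    norm_ofReal_mul_of_norm_one hcn (hs.le.trans hx)
  have hD {x : ℝ} (hx : s ≤ x) (hxt : x ≤ t) :
      HasDerivAt (fun x : ℝ => G (x * c)) (G' (x * c) c) x :=
    hasDerivAt_ray (hd _ (by rw [hn hx]; linarith) (by rw [hn hx]; linarith))
  have hmono : StrictMonoOn (fun x : ℝ => G (x * c)) (Icc s t) := by
    refine strictMonoOn_of_deriv_pos (convex_Icc _ _)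
      (fun x hx => (hD hx.1 hx.2).continuousAt.continuousWithinAt) fun x hx => ?_
    rw [interior_Icc] at hx
    rw [(hD hx.1.le hx.2.le).deriv]
    have h1 := hpos (x * c) (by rw [hn hx.1.le]; linarith [hx.1])
      (by rw [hn hx.1.le]; linarith [hx.2])
    rw [← Complex.real_smul, map_smul, smul_eq_mul, Complex.real_smul] at h1
    exact pos_of_mul_pos_right h1 (by linarith [hx.1])
  exact hmono (left_mem_Icc.2 hst.le) (right_mem_Icc.2 hst.le) hst

theorem exists_min_on_circle {G : ℂ → ℝ} {r : ℝ} (hr : 0 < r)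
    (hc : ∀ w, ‖w‖ = r → ContinuousAt G w) : ∃ w, ‖w‖ = r ∧ ∀ z, ‖z‖ = r → G w ≤ G z := by
  have hne : (Metric.sphere (0 : ℂ) r).Nonempty := ⟨r, by simp [abs_of_pos hr]⟩
  obtain ⟨w, hw, hmin⟩ := (isCompact_sphere (0 : ℂ) r).exists_isMinOn hne (f := G)
    fun w hw => (hc w (by simpa using hw)).continuousWithinAt
  exact ⟨w, by simpa using hw, fun z hz => hmin (by simpa using hz)⟩

/-- Energies slightly above a minimum from which `G` increases along rays. -/
theorem exists_levelRange_min {G : ℂ → ℝ} {G' : ℂ → ℂ →L[ℝ] ℝ} {r₀ r : ℝ} (hr : 0 < r)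
    (hr0 : r < r₀) (hc : ∀ w, ‖w‖ < r₀ → ContinuousAt G w)
    (hd : ∀ w, 0 < ‖w‖ → ‖w‖ < r₀ → HasFDerivAt G (G' w) w)
    (hpos : ∀ w, 0 < ‖w‖ → ‖w‖ < r₀ → 0 < G' w w) :
    ∃ ε > 0, IsLevelRange G r (Ioo (G 0) (G 0 + ε)) (𝓝[>] (G 0)) := by
  have hlt {c : ℂ} (hcn : ‖c‖ = 1) {s t : ℝ} (hs : 0 < s) (hst : s < t) (ht : t < r₀) :
      G (s * c) < G (t * c) :=
    ray_lt_of_radial_pos hd hpos hcn hs hst ht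
  have hcr {c : ℂ} (hcn : ‖c‖ = 1) {s : ℝ} (hs : 0 ≤ s) (hs0 : s < r₀) :
      ContinuousAt (fun s : ℝ => G (s * c)) s :=
    ContinuousAt.comp (g := G) (hc _ (by rwa [norm_ofReal_mul_of_norm_one hcn hs]))
      (by fun_prop : Continuous fun s : ℝ => (s : ℂ) * c).continuousAt
  have hgt {w : ℂ} (hw : 0 < ‖w‖) (hw0 : ‖w‖ < r₀) : G 0 < G w := by
    obtain ⟨c, hcn, hwc⟩ := eq_norm_mul_unit (norm_pos_iff.1 hw)
    have h1 : G 0 ≤ G ((‖w‖ / 2 : ℝ) * c) := by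
      have ht : Tendsto (fun s : ℝ => G (s * c)) (𝓝[>] 0) (𝓝 (G 0)) := by
        have := (hcr hcn le_rfl (hw.trans hw0)).tendsto
        simp only [Complex.ofReal_zero, zero_mul] at this
        exact this.mono_left nhdsWithin_le_nhds
      refine le_of_tendsto ht ?_
      filter_upwards [Ioo_mem_nhdsGT (half_pos hw)] with s hs
      exact (hlt hcn hs.1 hs.2 (by linarith)).le
    have h2 := hlt hcn (half_pos hw) (half_lt_self hw) hw0
    rw [← hwc] at h2
    exact h1.trans_lt h2
  have key : ∀ δ > 0, δ < r₀ → ∃ ε > 0, ∀ w, δ ≤ ‖w‖ → ‖w‖ < r₀ → G 0 + ε ≤ G w := by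
    intro δ hδ hδ0
    obtain ⟨w₀, hw₀, hmin⟩ := exists_min_on_circle hδ fun w hw => hc w (by rw [hw]; exact hδ0)
    refine ⟨G w₀ - G 0, sub_pos.2 (hgt (by rwa [hw₀]) (by rwa [hw₀])), fun w hw hw0 => ?_⟩
    obtain ⟨c, hcn, hwc⟩ := eq_norm_mul_unit (norm_pos_iff.1 (hδ.trans_le hw))
    have h1 := hmin (δ * c) (norm_ofReal_mul_of_norm_one hcn hδ.le)
    have h2 : G (δ * c) ≤ G w := by
      rcases hw.eq_or_lt with h | h
      · rw [hwc, ← h]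
      · conv_rhs => rw [hwc]
        exact (hlt hcn hδ h hw0).le
    linarith
  obtain ⟨ε, hε, hεr⟩ := key r hr hr0
  refine ⟨ε, hε, isOpen_Ioo, fun e he θ => ?_, ?_, fun δ hδ => ?_⟩
  · have hcn := Complex.norm_exp_ofReal_mul_I θ
    set c := Complex.exp (θ * Complex.I)
    have h1 : G 0 + ε ≤ G (r * c) :=
      hεr _ (norm_ofReal_mul_of_norm_one hcn hr.le).ge
        (by rwa [norm_ofReal_mul_of_norm_one hcn hr.le])
    obtain ⟨s, hs, hse⟩ := intermediate_value_Ioo hr.le (f := fun s : ℝ => G (s * c))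
      (fun s hs => (hcr hcn hs.1 (hs.2.trans_lt hr0)).continuousWithinAt)
      (show e ∈ _ from ⟨by simpa using he.1, he.2.trans_le h1⟩)
    exact ⟨s, hs.1, hs.2, hse⟩
  · have h1 : ∀ᶠ w in 𝓝 (0 : ℂ), G w < G 0 + ε :=
      (hc 0 (by simpa using hr.trans hr0)).eventually (gt_mem_nhds (by linarith))
    have h2 : ∀ᶠ w in 𝓝 (0 : ℂ), ‖w‖ < r₀ :=
      continuous_norm.continuousAt.eventually (gt_mem_nhds (by simpa using hr.trans hr0))
    filter_upwards [h1.filter_mono nhdsWithin_le_nhds, h2.filter_mono nhdsWithin_le_nhds,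
      self_mem_nhdsWithin] with w hw1 hw2 hw3
    exact ⟨hgt (norm_pos_iff.2 hw3) hw2, hw1⟩
  · obtain ⟨η, hη, hηr⟩ := key (min δ r) (lt_min hδ hr) ((min_le_right _ _).trans_lt hr0)
    filter_upwards [Ioo_mem_nhdsGT (show G 0 < G 0 + min ε η by linarith [lt_min hε hη])] with e he
    refine ⟨⟨he.1, he.2.trans_le (by linarith [min_le_left ε η])⟩, fun w hw hwr hwe => ?_⟩
    by_contra hcon
    have := hηr w ((min_le_left _ _).trans (not_lt.1 hcon)) (hwr.trans hr0)
    linarith [he.2, min_le_right ε η]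

/-- High energies near a point where `G` tends to infinity, decreasing along rays. -/
theorem exists_levelRange_atTop {G : ℂ → ℝ} {G' : ℂ → ℂ →L[ℝ] ℝ} {r₀ r : ℝ} (hr : 0 < r)
    (hr0 : r < r₀) (hd : ∀ w, 0 < ‖w‖ → ‖w‖ < r₀ → HasFDerivAt G (G' w) w)
    (hneg : ∀ w, 0 < ‖w‖ → ‖w‖ < r₀ → G' w w < 0) (htop : Tendsto G (𝓝[≠] 0) atTop) :
    ∃ e₀, IsLevelRange G r (Ioi e₀) atTop := by
  have hc : ∀ w, 0 < ‖w‖ → ‖w‖ < r₀ → ContinuousAt G w := fun w hw hw0 => (hd w hw hw0).continuousAt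
  have hlt {c : ℂ} (hcn : ‖c‖ = 1) {s t : ℝ} (hs : 0 < s) (hst : s < t) (ht : t < r₀) :
      G (t * c) < G (s * c) := by
    have := ray_lt_of_radial_pos (G := fun w => -G w) (G' := fun w => -G' w)
      (fun w hw hw0 => (hd w hw hw0).neg)
      (fun w hw hw0 => by simpa using hneg w hw hw0) hcn hs hst ht
    exact neg_lt_neg_iff.1 this
  have key : ∀ δ > 0, δ < r₀ → ∃ M, ∀ w, δ ≤ ‖w‖ → ‖w‖ < r₀ → G w ≤ M := by
    intro δ hδ hδ0
    obtain ⟨w₀, hw₀, hmin⟩ := exists_min_on_circle (G := fun w => -G w) hδ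
      fun w hw => (hc w (by rwa [hw]) (by rwa [hw])).neg
    refine ⟨G w₀, fun w hw hw0 => ?_⟩
    obtain ⟨c, hcn, hwc⟩ := eq_norm_mul_unit (norm_pos_iff.1 (hδ.trans_le hw))
    have h1 := neg_le_neg_iff.1 (hmin (δ * c) (norm_ofReal_mul_of_norm_one hcn hδ.le))
    refine le_trans ?_ h1
    rcases hw.eq_or_lt with h | h
    · rw [hwc, ← h]
    · conv_lhs => rw [hwc]
      exact (hlt hcn hδ h hw0).le
  obtain ⟨e₀, he₀⟩ := key r hr hr0
  refine ⟨e₀, isOpen_Ioi, fun e he θ => ?_, htop.eventually (Ioi_mem_atTop e₀), fun δ hδ => ?_⟩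
  · have hcn := Complex.norm_exp_ofReal_mul_I θ
    set c := Complex.exp (θ * Complex.I)
    have hc0 : c ≠ 0 := Complex.exp_ne_zero _
    have hray : Tendsto (fun s : ℝ => (s : ℂ) * c) (𝓝[>] 0) (𝓝[≠] 0) := by
      refine tendsto_nhdsWithin_iff.2 ⟨?_, ?_⟩
      · have := (by fun_prop : Continuous fun s : ℝ => (s : ℂ) * c).tendsto 0
        simp only [Complex.ofReal_zero, zero_mul] at this
        exact this.mono_left nhdsWithin_le_nhds
      · filter_upwards [self_mem_nhdsWithin] with s hs
        exact mul_ne_zero (by exact_mod_cast (show (0 : ℝ) < s from hs).ne') hc0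
    obtain ⟨a, ha, har⟩ := ((htop.comp hray).eventually (Ioi_mem_atTop e)).and
      (Ioo_mem_nhdsGT hr) |>.exists
    have h1 : G (r * c) ≤ e₀ := he₀ _ (norm_ofReal_mul_of_norm_one hcn hr.le).ge
      (by rwa [norm_ofReal_mul_of_norm_one hcn hr.le])
    obtain ⟨s, hs, hse⟩ := intermediate_value_Ioo' har.2.le (f := fun s : ℝ => G (s * c))
      (fun s hs => (hasDerivAt_ray (hd _
        (by rw [norm_ofReal_mul_of_norm_one hcn (har.1.le.trans hs.1)]; exact har.1.trans_le hs.1)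
        (by rw [norm_ofReal_mul_of_norm_one hcn (har.1.le.trans hs.1)]
            exact hs.2.trans_lt hr0))).continuousAt.continuousWithinAt)
      (show e ∈ _ from ⟨h1.trans_lt he, ha⟩)
    exact ⟨s, har.1.trans hs.1, hs.2, hse⟩
  · obtain ⟨M, hM⟩ := key (min δ r) (lt_min hδ hr) ((min_le_right _ _).trans_lt hr0)
    filter_upwards [Ioi_mem_atTop e₀, Ioi_mem_atTop M] with e he heM
    refine ⟨he, fun w hw hwr hwe => ?_⟩
    by_contra hcon
    have := hM w ((min_le_left _ _).trans (not_lt.1 hcon)) (hwr.trans hr0)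
    rw [hwe] at this
    exact absurd heM (not_lt.2 this)

/-! ### Families for Hamiltonian fields in the plane -/

/-- The vector field `κ · i ∇K` in the plane, where `q` is the Wirtinger derivative of `K`, that is,
`dK(v) = 2 Re (v q)`. -/
noncomputable def hamField (κ : ℂ → ℝ) (q : ℂ → ℂ) (x : ℂ) : ℂ :=
  κ x * (2 * Complex.I * starRingEnd ℂ (q x))

/-- A family of periodic solutions of the planar Hamiltonian system `x' = κ · i ∇K`, parametrised
by the energy, which shrinks to `0` and fills a punctured neighbourhood of `0` in `D`. -/
structure IsPlanarFamily (K : ℂ → ℝ) (κ : ℂ → ℝ) (q : ℂ → ℂ) (D : Set ℂ) (I : Set ℝ)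
    (l : Filter ℝ) (x : ℝ → ℝ → ℂ) (T : ℝ → ℝ) : Prop where
  mem : ∀ e ∈ I, ∀ t, x e t ∈ D ∧ x e t ≠ 0
  level : ∀ e ∈ I, ∀ t, K (x e t) = e
  hasDerivAt : ∀ e ∈ I, ∀ t, HasDerivAt (x e) (hamField κ q (x e t)) t
  period : ∀ e ∈ I, HasLeastPeriod (x e) (T e)
  continuousOn : ContinuousOn (fun p : ℝ × ℝ => x p.1 p.2) (I ×ˢ univ)
  tendsto : TendstoUniformly x (fun _ => 0) l
  surround : ∃ U : Set ℂ, IsOpen U ∧ 0 ∈ U ∧ U \ {0} = ⋃ e ∈ I, range (x e)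

theorem shear_injective (φ : ℝ → ℝ) : Function.Injective (shear φ) := by
  intro a b h
  have him : a.im = b.im := by rw [← shear_im φ a, h, shear_im]
  simp only [shear, him] at h
  exact add_right_cancel h

/-- Periodic families around a centre whose level sets become star-shaped after a shear. Shears
preserve the area, so the system is Hamiltonian in the sheared coordinates as well. -/
theorem exists_planarFamily_of_shear {r₀ r : ℝ} {φ φ' : ℝ → ℝ} {K κ : ℂ → ℝ} {q : ℂ → ℂ}
    {D : Set ℂ} {I : Set ℝ} {l : Filter ℝ} (hr : 0 < r) (hr0 : r ≤ r₀)
    (hφ : ∀ b, |b| < r₀ → HasStrictDerivAt φ (φ' b) b)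
    (hφ' : ∀ b, |b| < r₀ → ContinuousAt φ' b) (hφ0 : φ 0 = 0)
    (hD : ∀ w, 0 < ‖w‖ → ‖w‖ < r₀ → shear φ w ∈ D)
    (hK : ∀ x ∈ D, HasStrictFDerivAt K (reForm (q x)) x)
    (hq : ∀ x ∈ D, ContinuousAt q x) (hκ : Continuous κ)
    (hpos : ∀ w, 0 < ‖w‖ → ‖w‖ < r₀ → 0 < κ (shear φ w) *
      reForm (q (shear φ w) - Complex.I * (φ' w.im * (q (shear φ w)).re : ℝ)) w)
    (hI : IsLevelRange (fun w => K (shear φ w)) r I l) :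
    ∃ (x : ℝ → ℝ → ℂ) (T : ℝ → ℝ), IsPlanarFamily K κ q D I l x T ∧
      ∀ e ∈ I, ∀ M > 0, (∀ w, 0 < ‖w‖ → ‖w‖ < r → K (shear φ w) = e →
        M * ‖w‖ ^ 2 ≤ κ (shear φ w) *
          reForm (q (shear φ w) - Complex.I * (φ' w.im * (q (shear φ w)).re : ℝ)) w) →
        T e ≤ 2 * Real.pi / M := by
  -- `p` is the Wirtinger derivative of `K ∘ shear φ` and `Z` its Hamiltonian field
  set p : ℂ → ℂ := fun w => q (shear φ w) - Complex.I * (φ' w.im * (q (shear φ w)).re : ℝ) with hp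
  set Z : ℂ → ℂ := fun w => κ (shear φ w) * (2 * Complex.I * starRingEnd ℂ (p w)) with hZ
  have him {w : ℂ} (hw : ‖w‖ < r₀) : |w.im| < r₀ := (Complex.abs_im_le_norm w).trans_lt hw
  have hsh : ∀ w, ‖w‖ < r₀ → HasStrictFDerivAt (shear φ) (ContinuousLinearMap.id ℝ ℂ +
      Complex.ofRealCLM.comp (φ' w.im • Complex.imCLM)) w := fun w hw =>
    (hasStrictFDerivAt_id w).add (Complex.ofRealCLM.hasStrictFDerivAt.comp w
      ((hφ _ (him hw)).comp_hasStrictFDerivAt w Complex.imCLM.hasStrictFDerivAt))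
  have hG : ∀ w, 0 < ‖w‖ → ‖w‖ < r → HasStrictFDerivAt (fun w => K (shear φ w))
      (reForm (p w)) w := by
    intro w hw hwr
    refine ((hK _ (hD w hw (hwr.trans_le hr0))).comp w (hsh w (hwr.trans_le hr0))).congr_fderiv ?_
    refine ContinuousLinearMap.ext fun v => ?_
    have : reForm (q (shear φ w)) (v + (φ' w.im * v.im : ℝ)) = reForm (p w) v := by
      simp only [reForm_apply, hp]
      simp
      ring
    exact this
  have hshc : ∀ w, ‖w‖ < r₀ → ContinuousAt (shear φ) w := fun w hw =>
    (hsh w hw).hasFDerivAt.continuousAt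
  have hZc : ContinuousOn Z {w | 0 < ‖w‖ ∧ ‖w‖ < r} := by
    rintro w ⟨hw, hwr⟩
    refine ContinuousAt.continuousWithinAt ?_
    have h1 : ContinuousAt (shear φ) w := hshc w (hwr.trans_le hr0)
    have h2 : ContinuousAt (fun w => q (shear φ w)) w :=
      ContinuousAt.comp (g := q) (hq _ (hD w hw (hwr.trans_le hr0))) h1
    have h3 : ContinuousAt (fun w : ℂ => φ' w.im) w :=
      ContinuousAt.comp (g := φ') (hφ' _ (him (hwr.trans_le hr0)))
        Complex.continuous_im.continuousAt
    have h4 : ContinuousAt p w := h2.sub (continuousAt_const.mul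
      (Complex.continuous_ofReal.continuousAt.comp
        (h3.mul (Complex.continuous_re.continuousAt.comp h2))))
    exact (Complex.continuous_ofReal.continuousAt.comp (hκ.continuousAt.comp h1)).mul
      (continuousAt_const.mul (Complex.continuous_conj.continuousAt.comp h4))
  have hrotZ (w : ℂ) : (starRingEnd ℂ w * Z w).im = κ (shear φ w) * reForm (p w) w := by
    simp only [hZ, reForm_apply]
    have : starRingEnd ℂ w * (κ (shear φ w) * (2 * Complex.I * starRingEnd ℂ (p w))) =
        (κ (shear φ w) * 2 : ℝ) * (Complex.I * starRingEnd ℂ (w * p w)) := by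
      rw [map_mul]; push_cast; ring
    rw [this, Complex.im_ofReal_mul]
    simp
    ring
  obtain ⟨w, T, hw1, hw2, hw3, hw4, hw5, hw6⟩ := exists_planar_family (r₀ := r)
    (G := fun w => K (shear φ w)) (G' := fun w => reForm (p w)) (Z := Z) hI.isOpen hG hZc
    (fun w hw hwr => by
      simp only [hZ, reForm_apply]
      have : κ (shear φ w) * (2 * Complex.I * starRingEnd ℂ (p w)) * p w =
        (κ (shear φ w) * 2 * Complex.normSq (p w) : ℝ) * Complex.I := by
        push_cast
        rw [← Complex.mul_conj]; ring
      rw [this, Complex.re_ofReal_mul]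
      simp)
    (fun w hw hwr => by rw [hrotZ]; exact hpos w hw (hwr.trans_le hr0))
    (fun w hw hwr h0 => by
      have := hpos w hw (hwr.trans_le hr0)
      rw [show reForm (q (shear φ w) -
        Complex.I * (φ' w.im * (q (shear φ w)).re : ℝ)) w = 0 from h0, mul_zero] at this
      exact this.false) hI.exists_eq
  have hsh0 : shear φ 0 = 0 := by simp [shear, hφ0]
  refine ⟨fun e t => shear φ (w e t), T, ⟨fun e he t => ?_, fun e he t => (hw1 e he t).2.2,
    fun e he t => ?_, fun e he => ⟨⟨(hw3 e he).1.1, fun t => ?_⟩, fun τ hτ => (hw3 e he).2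
      ⟨hτ.1, fun t => shear_injective φ (hτ.2 t)⟩⟩, ?_, ?_, ?_⟩, fun e he M hM h => ?_⟩
  · obtain ⟨h1, h2, -⟩ := hw1 e he t
    refine ⟨hD _ h1 (h2.trans_le hr0), fun h => ?_⟩
    rw [← hsh0] at h
    rw [shear_injective φ h, norm_zero] at h1
    exact h1.false
  · obtain ⟨h1, h2, -⟩ := hw1 e he t
    have h3 := HasFDerivAt.comp_hasDerivAt (l := shear φ) t
      (hsh _ (h2.trans_le hr0)).hasFDerivAt (hw2 e he t)
    refine h3.congr_deriv ?_
    have h4 : Z (w e t) + (φ' (w e t).im * (Z (w e t)).im : ℝ) =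
        hamField κ q (shear φ (w e t)) := by
      simp only [hZ, hamField, hp]
      apply Complex.ext
      · simp; ring
      · simp
    exact h4
  · simp only [(hw3 e he).1.2 t]
  · intro y hy
    obtain ⟨-, h2, -⟩ := hw1 y.1 hy.1 y.2
    exact ContinuousAt.comp_continuousWithinAt (f := fun p : ℝ × ℝ => w p.1 p.2) (x := y)
      (hshc _ (h2.trans_le hr0)) (hw4 y hy)
  · rw [Metric.tendstoUniformly_iff]
    intro ε hε
    have h1 := hshc 0 (by simpa using hr.trans_le hr0)
    rw [ContinuousAt, hsh0, Metric.tendsto_nhds] at h1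
    obtain ⟨δ, hδ, h2⟩ := Metric.eventually_nhds_iff.1 (h1 ε hε)
    filter_upwards [hI.shrink δ hδ] with e he t
    obtain ⟨h3, h4, h5⟩ := hw1 e he.1 t
    rw [dist_comm]
    exact h2 (by rw [dist_zero_right]; exact he.2 _ h3 h4 h5)
  · set ψ : ℂ → ℂ := fun z => z - φ z.im with hψ
    have hψsh (w : ℂ) : ψ (shear φ w) = w := by simp [hψ, shear]
    have hshψ (z : ℂ) : shear φ (ψ z) = z := by simp [hψ, shear]
    set W : Set ℂ := {w | ‖w‖ < r ∧ (w = 0 ∨ K (shear φ w) ∈ I)} with hW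
    have hWo : IsOpen W := by
      rw [isOpen_iff_mem_nhds]
      rintro w ⟨hwr, hw⟩
      have h1 : ∀ᶠ z in 𝓝 w, ‖z‖ < r := continuous_norm.continuousAt.eventually (gt_mem_nhds hwr)
      by_cases hw0 : w = 0
      · have h2 := hI.eventually_mem
        rw [eventually_nhdsWithin_iff, ← hw0] at h2
        filter_upwards [h1, h2] with z hz1 hz2
        refine ⟨hz1, ?_⟩
        by_cases hz0 : z = 0
        · exact Or.inl hz0
        · exact Or.inr (hz2 (by rw [hw0]; exact hz0))
      · have hc := (hG w (norm_pos_iff.2 hw0) hwr).hasFDerivAt.continuousAt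
        filter_upwards [h1, hc.eventually (hI.isOpen.mem_nhds (hw.resolve_left hw0))] with z hz1 hz2
        exact ⟨hz1, Or.inr hz2⟩
    refine ⟨{z | |z.im| < r₀} ∩ ψ ⁻¹' W, ?_, ?_, ?_⟩
    · refine ContinuousOn.isOpen_inter_preimage (fun z hz => ?_)
        (isOpen_lt (by fun_prop) continuous_const) hWo
      refine ContinuousAt.continuousWithinAt ?_
      have h1 : ContinuousAt (fun z : ℂ => φ z.im) z :=
        ContinuousAt.comp (g := φ) ((hφ _ hz).hasDerivAt.continuousAt)
          Complex.continuous_im.continuousAt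
      exact continuousAt_id.sub (Complex.continuous_ofReal.continuousAt.comp h1)
    · refine ⟨by simpa using hr.trans_le hr0, ?_⟩
      have : ψ 0 = 0 := by simp [hψ, hφ0]
      rw [mem_preimage, this]
      exact ⟨by simpa using hr, Or.inl rfl⟩
    · ext z
      simp only [Set.mem_sdiff, mem_inter_iff, mem_preimage, mem_singleton_iff, mem_iUnion,
        mem_range, exists_prop]
      constructor
      · rintro ⟨⟨-, hz⟩, hz0⟩
        have h0 : ψ z ≠ 0 := fun h => hz0 (by rw [← hshψ z, h, hsh0])
        have hzI := hz.2.resolve_left h0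
        obtain ⟨t, ht⟩ := hw5 (ψ z) (norm_pos_iff.2 h0) hz.1 hzI
        exact ⟨_, hzI, t, by rw [ht, hshψ]⟩
      · rintro ⟨e, he, t, rfl⟩
        obtain ⟨h1, h2, h3⟩ := hw1 e he t
        refine ⟨⟨?_, ?_⟩, ?_⟩
        · rw [mem_ofPred_eq, shear_im]; exact him (h2.trans_le hr0)
        · rw [hψsh]; exact ⟨h2, Or.inr (by rw [h3]; exact he)⟩
        · intro h
          rw [← hsh0] at h
          rw [shear_injective φ h, norm_zero] at h1
          exact h1.false
  · exact hw6 e he M hM fun z hz hzr hze => by rw [hrotZ]; exact h z hz hzr hze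

/-! ### Periodic families for logarithmic potentials -/

section PotentialFamilies

variable {ι : Type*} {s : Finset ι} {w : ι → ℝ} {z : ι → ℂ} {W C : ℝ}

theorem continuousAt_potGrad {x : ℂ} (hx : ∀ i ∈ s, x ≠ z i) :
    ContinuousAt (potGrad s w z W) x := by
  unfold potGrad
  refine ContinuousAt.sub (ContinuousAt.div ?_ ?_ ?_) ?_
  · exact continuousAt_const.mul Complex.continuous_conj.continuousAt
  · fun_prop
  · have : (0 : ℝ) < 1 + ‖x‖ ^ 2 := by positivity
    exact_mod_cast this.ne'
  · refine tendsto_finsetSum _ fun i hi => ?_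
    exact ContinuousAt.div continuousAt_const (by fun_prop) (sub_ne_zero.2 (hx i hi))

theorem hasStrictFDerivAt_pot {x : ℂ} (hx : ∀ i ∈ s, x ≠ z i) :
    HasStrictFDerivAt (pot s w z W C) (reForm (potGrad s w z W x)) x :=
  (contDiffAt_pot (n := 1) hx).hasStrictFDerivAt' (hasFDerivAt_pot hx) (by norm_num)

theorem eventually_ne_of_ne (hz0 : ∀ i ∈ s, z i ≠ 0) : ∀ᶠ x in 𝓝 (0 : ℂ), ∀ i ∈ s, x ≠ z i := by
  rw [Filter.eventually_all_finset]
  exact fun i hi => eventually_ne_nhds (hz0 i hi).symm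

/-- The second derivative of the potential at `0` in the real direction. The sum with the second
derivative in the imaginary direction is `4 W`, since `log |x - z i|` is harmonic. -/
theorem fderiv_fderiv_pot (hz0 : ∀ i ∈ s, z i ≠ 0) :
    fderiv ℝ (fun x => fderiv ℝ (pot s w z W C) x 1) 0 1 =
      2 * (W + (∑ i ∈ s, (w i : ℂ) / z i ^ 2).re) := by
  have h0 : ∀ i ∈ s, (0 : ℂ) ≠ z i := fun i hi => (hz0 i hi).symm
  have hd : DifferentiableAt ℝ (fun x => fderiv ℝ (pot s w z W C) x 1) 0 := by
    have : ContDiffAt ℝ 1 (fun x => fderiv ℝ (pot s w z W C) x 1) 0 :=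
      ((contDiffAt_pot (n := 2) h0).fderiv_right (m := 1) (by norm_num)).clm_apply contDiffAt_const
    exact this.differentiableAt (by norm_num)
  have h1 : HasDerivAt (fun t : ℝ => (t : ℂ)) 1 0 := Complex.ofRealCLM.hasDerivAt
  have h2 := HasFDerivAt.comp_hasDerivAt (l := fun x => fderiv ℝ (pot s w z W C) x 1) (0 : ℝ)
    (f := fun t : ℝ => (t : ℂ)) (by simpa using hd.hasFDerivAt) h1
  have hev : (fun t : ℝ => 2 * (potGrad s w z W t).re) =ᶠ[𝓝 0]
      (fun x => fderiv ℝ (pot s w z W C) x 1) ∘ fun t : ℝ => (t : ℂ) := by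
    have ht : Tendsto (fun t : ℝ => (t : ℂ)) (𝓝 0) (𝓝 0) := by
      simpa using Complex.continuous_ofReal.tendsto 0
    filter_upwards [ht.eventually (eventually_ne_of_ne hz0)] with t ht
    simp only [Function.comp, (hasFDerivAt_pot ht).fderiv, reForm_one]
  have h3 : HasDerivAt (fun t : ℝ => potGrad s w z W t) (W + ∑ i ∈ s, (w i : ℂ) / z i ^ 2) 0 := by
    have h4 : ∀ i ∈ s,
        HasDerivAt (fun t : ℝ => (w i : ℂ) / (t - z i)) (-((w i : ℂ) / z i ^ 2)) 0 := by
      intro i hi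
      have h5 := (h1.sub_const (z i)).inv (by simpa using hz0 i hi)
      have h6 := h5.const_mul (w i : ℂ)
      simp only [Complex.ofReal_zero, zero_sub] at h6
      refine h6.congr_deriv ?_
      rw [neg_sq]; ring
    have h5 : HasDerivAt
        (fun t : ℝ => (W : ℂ) * starRingEnd ℂ (t : ℂ) / (1 + ‖(t : ℂ)‖ ^ 2 : ℝ)) W 0 := by
      have h6 : (fun t : ℝ => (W : ℂ) * starRingEnd ℂ (t : ℂ) / (1 + ‖(t : ℂ)‖ ^ 2 : ℝ)) =
          fun t : ℝ => (W : ℂ) * ((t : ℂ) / (1 + (t : ℂ) ^ 2)) := by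
        funext t
        rw [Complex.conj_ofReal, Complex.norm_real, Real.norm_eq_abs, sq_abs]
        push_cast
        ring
      rw [h6]
      have h7 := (h1.div ((h1.pow 2).const_add 1) (by simp)).const_mul (W : ℂ)
      simpa using h7
    have h6 := h5.sub (HasDerivAt.fun_sum h4)
    refine h6.congr_deriv ?_
    rw [Finset.sum_neg_distrib, sub_neg_eq_add]
  have h4 : HasDerivAt (fun t : ℝ => 2 * (potGrad s w z W t).re)
      (2 * (W + ∑ i ∈ s, (w i : ℂ) / z i ^ 2).re) 0 :=
    (HasFDerivAt.comp_hasDerivAt (l := Complex.re) (0 : ℝ) Complex.reCLM.hasFDerivAt h3).const_mul 2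
  have h5 := h4.unique (h2.congr_of_eventuallyEq hev)
  rw [Complex.add_re, Complex.ofReal_re] at h5
  simpa using h5.symm

/-- The potential is strictly subharmonic, so it is strictly convex at `0` in the real or in the
imaginary direction. -/
theorem fderiv_fderiv_pot_pos_or (hz0 : ∀ i ∈ s, z i ≠ 0) (hW : 0 < W) :
    0 < fderiv ℝ (fun x => fderiv ℝ (pot s w z W C) x 1) 0 1 ∨
      0 < fderiv ℝ (fun x => fderiv ℝ (pot s w (fun i => z i / Complex.I) W C) x 1) 0 1 := by
  rw [fderiv_fderiv_pot hz0, fderiv_fderiv_pot fun i hi => div_ne_zero (hz0 i hi) Complex.I_ne_zero]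
  have h : ∑ i ∈ s, (w i : ℂ) / (z i / Complex.I) ^ 2 = -∑ i ∈ s, (w i : ℂ) / z i ^ 2 := by
    rw [← Finset.sum_neg_distrib]
    refine Finset.sum_congr rfl fun i _ => ?_
    rw [div_pow, Complex.I_sq, div_neg, div_one, div_neg]
  rw [h, Complex.neg_re]
  by_contra hcon
  push Not at hcon
  linarith [hcon.1, hcon.2]

/-- Strict convexity in one direction excludes a local maximum. -/
theorem not_isLocalMax_pot (hz0 : ∀ i ∈ s, z i ≠ 0)
    (haa : 0 < fderiv ℝ (fun x => fderiv ℝ (pot s w z W C) x 1) 0 1) :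
    ¬ IsLocalMax (pot s w z W C) 0 := by
  intro hmax
  have h0 : ∀ i ∈ s, (0 : ℂ) ≠ z i := fun i hi => (hz0 i hi).symm
  set F := fun x => fderiv ℝ (pot s w z W C) x 1 with hF
  have hFc : ContDiffAt ℝ 1 F 0 :=
    ((contDiffAt_pot (n := 2) h0).fderiv_right (m := 1) (by norm_num)).clm_apply contDiffAt_const
  have hF2c : ContinuousAt (fun x => fderiv ℝ F x 1) 0 :=
    ((hFc.fderiv_right (m := 0) (by norm_num)).clm_apply contDiffAt_const).continuousAt
  have hd : ∀ᶠ x in 𝓝 (0 : ℂ), DifferentiableAt ℝ F x :=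
    (hFc.eventually (by simp)).mono fun x hx => hx.differentiableAt (by norm_num)
  obtain ⟨δ, hδ, h⟩ := Metric.eventually_nhds_iff.1 ((eventually_ne_of_ne hz0).and
    (hd.and ((hF2c.eventually (lt_mem_nhds haa)).and hmax)))
  have hin {t : ℝ} (ht : |t| < δ) : dist (t : ℂ) 0 < δ := by
    rwa [dist_zero_right, Complex.norm_real]
  have h1 (t : ℝ) : HasDerivAt (fun t : ℝ => (t : ℂ)) 1 t := Complex.ofRealCLM.hasDerivAt
  have hδ2 : |δ / 2| < δ := by rw [abs_of_pos (half_pos hδ)]; linarith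
  have h2 := lt_of_second_deriv_pos (f := fun t : ℝ => pot s w z W C t) (f₁ := fun t : ℝ => F t)
    (f₂ := fun t : ℝ => fderiv ℝ F t 1) (δ := δ)
    (fun t ht => by
      have := HasFDerivAt.comp_hasDerivAt (l := pot s w z W C) t
        (hasFDerivAt_pot (h (hin ht)).1) (h1 t)
      rwa [← (hasFDerivAt_pot (h (hin ht)).1).fderiv] at this)
    (fun t ht => HasFDerivAt.comp_hasDerivAt (l := F) t (h (hin ht)).2.1.hasFDerivAt (h1 t))
    (fun t ht => (h (hin ht)).2.2.1)
    (by simp only [hF, Complex.ofReal_zero, hmax.fderiv_eq_zero]; simp) hδ2 (half_pos hδ).ne'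
  exact absurd (h (hin hδ2)).2.2.2 (by simpa using h2)

/-- Periodic families around a local minimum of the potential. The minimum may be degenerate: it is
an isolated critical point because there are at least three poles, and the shear makes its level
sets star-shaped. -/
theorem exists_planarFamily_min {κ : ℂ → ℝ} {D : Set ℂ} (hs : 3 ≤ s.card)
    (hw : ∀ i ∈ s, 0 < w i) (hz : Set.InjOn z s) (hz0 : ∀ i ∈ s, z i ≠ 0)
    (hW : W = ∑ i ∈ s, w i) (hκ : Continuous κ) (hκ0 : ∀ x, 0 < κ x)
    (hD : ∀ x ∈ D, ∀ i ∈ s, x ≠ z i) (hD0 : ∀ᶠ x in 𝓝[≠] 0, x ∈ D)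
    (haa : 0 < fderiv ℝ (fun x => fderiv ℝ (pot s w z W C) x 1) 0 1)
    (hmin : IsLocalMin (pot s w z W C) 0) :
    ∃ ε > 0, ∃ (x : ℝ → ℝ → ℂ) (T : ℝ → ℝ), IsPlanarFamily (pot s w z W C) κ (potGrad s w z W) D
      (Ioo (pot s w z W C 0) (pot s w z W C 0 + ε)) (𝓝[>] (pot s w z W C 0)) x T := by
  have h0 : ∀ i ∈ s, (0 : ℂ) ≠ z i := fun i hi => (hz0 i hi).symm
  have hne := eventually_ne_of_ne hz0
  have hiso : ∀ᶠ x in 𝓝[≠] (0 : ℂ), fderiv ℝ (pot s w z W C) x ≠ 0 := by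
    filter_upwards [eventually_potGrad_ne_zero hs hw hz hz0 hW,
      hne.filter_mono nhdsWithin_le_nhds] with x hx1 hx2 hx3
    rw [(hasFDerivAt_pot hx2).fderiv] at hx3
    exact hx1 (eq_zero_of_reForm_eq_zero hx3)
  obtain ⟨φ, hφc, hφ0, hφ⟩ := exists_shear (contDiffAt_pot (n := 4) h0) hmin haa hiso
  have hsh0 : shear φ 0 = 0 := by simp [shear, hφ0]
  have hφe : ∀ᶠ b in 𝓝 (0 : ℝ), ContDiffAt ℝ 3 φ b := hφc.eventually (by simp)
  rw [eventually_nhdsWithin_iff] at hφ hD0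
  have him : Tendsto Complex.im (𝓝 0) (𝓝 0) := by simpa using Complex.continuous_im.tendsto 0
  have hsht : Tendsto (shear φ) (𝓝 0) (𝓝 0) := by
    have h1 : ContinuousAt (fun w : ℂ => φ w.im) 0 :=
      ContinuousAt.comp (g := φ) (by simpa using hφc.continuousAt)
        Complex.continuous_im.continuousAt
    have h2 : ContinuousAt (shear φ) 0 :=
      continuousAt_id.add (Complex.continuous_ofReal.continuousAt.comp h1)
    rwa [ContinuousAt, hsh0] at h2
  obtain ⟨r₁, hr₁, hb1⟩ := Metric.eventually_nhds_iff.1 hφe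
  obtain ⟨r₂, hr₂, hb2⟩ := Metric.eventually_nhds_iff.1
    (hφ.and ((hsht.eventually hD0).and (hsht.eventually hne)))
  set r₀ := min r₁ r₂ with hr₀
  have hr₀pos : 0 < r₀ := lt_min hr₁ hr₂
  have hφr : ∀ b, |b| < r₀ → ContDiffAt ℝ 3 φ b := fun b hb =>
    hb1 (by rw [Real.dist_0_eq_abs]; exact hb.trans_le (min_le_left _ _))
  have hball {y : ℂ} (hy : ‖y‖ < r₀) := hb2 (y := y)
    (by rw [dist_zero_right]; exact hy.trans_le (min_le_right _ _))
  have hφd : ∀ b, |b| < r₀ → HasStrictDerivAt φ (deriv φ b) b := fun b hb =>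
    (hφr b hb).hasStrictDerivAt (by norm_num)
  have hd : ∀ y, ‖y‖ < r₀ → HasFDerivAt (fun y => pot s w z W C (shear φ y))
      (reForm (potGrad s w z W (shear φ y) -
        Complex.I * (deriv φ y.im * (potGrad s w z W (shear φ y)).re : ℝ))) y := by
    intro y hy
    have h1 : HasFDerivAt (shear φ) (ContinuousLinearMap.id ℝ ℂ +
        Complex.ofRealCLM.comp (deriv φ y.im • Complex.imCLM)) y :=
      (hasFDerivAt_id y).add (Complex.ofRealCLM.hasFDerivAt.comp y
        ((hφd _ ((Complex.abs_im_le_norm y).trans_lt hy)).hasDerivAt.comp_hasFDerivAt y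
          Complex.imCLM.hasFDerivAt))
    refine ((hasFDerivAt_pot (hball hy).2.2).comp y h1).congr_fderiv ?_
    refine ContinuousLinearMap.ext fun v => ?_
    have : reForm (potGrad s w z W (shear φ y)) (v + (deriv φ y.im * v.im : ℝ)) =
        reForm (potGrad s w z W (shear φ y) -
          Complex.I * (deriv φ y.im * (potGrad s w z W (shear φ y)).re : ℝ)) v := by
      simp only [reForm_apply]
      simp
      ring
    exact this
  have hradial : ∀ y, 0 < ‖y‖ → ‖y‖ < r₀ → 0 < reForm (potGrad s w z W (shear φ y) -
      Complex.I * (deriv φ y.im * (potGrad s w z W (shear φ y)).re : ℝ)) y := by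
    intro y hy hyr
    have := (hball hyr).1 (norm_pos_iff.1 hy)
    rwa [(hd y hyr).fderiv] at this
  obtain ⟨ε, hε, hI⟩ := exists_levelRange_min (G := fun y => pot s w z W C (shear φ y))
    (half_pos hr₀pos) (half_lt_self hr₀pos) (fun y hy => (hd y hy).continuousAt)
    (fun y _ hyr => hd y hyr) hradial
  simp only [hsh0] at hI
  obtain ⟨x, T, hx, -⟩ := exists_planarFamily_of_shear (K := pot s w z W C) (κ := κ)
    (q := potGrad s w z W) (D := D) (half_pos hr₀pos) (half_lt_self hr₀pos).le hφd
    (fun b hb => by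
      have := (hφr b hb).fderiv_right (m := 0) (by norm_num)
      have h2 := (this.clm_apply (contDiffAt_const (c := (1 : ℝ)))).continuousAt
      simpa using h2)
    hφ0
    (fun y hy hyr => (hball hyr).2.1 fun h => by
      rw [mem_singleton_iff, ← hsh0] at h
      rw [shear_injective φ h, norm_zero] at hy
      exact hy.false)
    (fun x hx => hasStrictFDerivAt_pot (hD x hx)) (fun x hx => continuousAt_potGrad (hD x hx)) hκ
    (fun y hy hyr => mul_pos (hκ0 _) (hradial y hy hyr)) hI
  exact ⟨ε, hε, x, T, hx⟩

/-- Periodic families around a pole of the potential. Their periods tend to zero, since the angular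
speed at distance `r` from the pole is at least a constant times `1 / r²`. -/
theorem exists_planarFamily_pole {κ : ℂ → ℝ} {D : Set ℂ} {i₀ : ι} (hi₀ : i₀ ∈ s)
    (hw : 0 < w i₀) (hzi₀ : z i₀ = 0) (hz0 : ∀ i ∈ s, i ≠ i₀ → z i ≠ 0)
    (hκ : Continuous κ) (hκ0 : ∀ x, κ x < 0)
    (hD : ∀ x ∈ D, ∀ i ∈ s, x ≠ z i) (hD0 : ∀ᶠ x in 𝓝[≠] 0, x ∈ D) :
    ∃ (e₀ : ℝ) (x : ℝ → ℝ → ℂ) (T : ℝ → ℝ),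
      IsPlanarFamily (pot s w z W C) κ (potGrad s w z W) D (Ioi e₀) atTop x T ∧
        Tendsto T atTop (𝓝 0) := by
  classical
  have h0 : ∀ i ∈ s.erase i₀, (0 : ℂ) ≠ z i := fun i hi =>
    (hz0 i (Finset.mem_of_mem_erase hi) (Finset.ne_of_mem_erase hi)).symm
  have hpot (x : ℂ) : pot s w z W C x =
      pot (s.erase i₀) w z W C x + w i₀ * -Real.log (‖x‖ ^ 2) := by
    unfold pot
    rw [← Finset.add_sum_erase s _ hi₀, hzi₀, sub_zero]
    ring
  have hgrad (x : ℂ) : potGrad s w z W x = potGrad (s.erase i₀) w z W x - w i₀ / x := by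
    unfold potGrad
    rw [← Finset.add_sum_erase s _ hi₀, hzi₀, sub_zero]
    ring
  have htop : Tendsto (pot s w z W C) (𝓝[≠] 0) atTop := by
    have h1 : Tendsto (pot (s.erase i₀) w z W C) (𝓝[≠] 0) (𝓝 (pot (s.erase i₀) w z W C 0)) :=
      (hasFDerivAt_pot h0).continuousAt.tendsto.mono_left nhdsWithin_le_nhds
    have h2 : Tendsto (fun x : ℂ => ‖x‖ ^ 2) (𝓝[≠] 0) (𝓝[>] 0) := by
      refine tendsto_nhdsWithin_iff.2 ⟨?_, ?_⟩
      · have : Continuous fun x : ℂ => ‖x‖ ^ 2 := by fun_prop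
        simpa using (this.tendsto 0).mono_left (nhdsWithin_le_nhds (s := {0}ᶜ))
      · filter_upwards [self_mem_nhdsWithin] with x hx
        exact pow_pos (norm_pos_iff.2 hx) 2
    have h3 : Tendsto (fun x : ℂ => w i₀ * -Real.log (‖x‖ ^ 2)) (𝓝[≠] 0) atTop :=
      (tendsto_neg_atBot_atTop.comp (Real.tendsto_log_nhdsGT_zero.comp h2)).const_mul_atTop hw
    exact (h1.add_atTop h3).congr fun x => (hpot x).symm
  have hrad : Tendsto (fun x => κ x * reForm (potGrad s w z W x) x) (𝓝[≠] 0)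
      (𝓝 (κ 0 * -(2 * w i₀))) := by
    have h1 : Tendsto (fun x => reForm (potGrad (s.erase i₀) w z W x) x - 2 * w i₀) (𝓝[≠] 0)
        (𝓝 (-(2 * w i₀))) := by
      have h2 : ContinuousAt (fun x => 2 * (x * potGrad (s.erase i₀) w z W x).re) 0 :=
        continuousAt_const.mul (Complex.continuous_re.continuousAt.comp
          (continuousAt_id.mul (continuousAt_potGrad h0)))
      have h3 := (h2.tendsto.mono_left (nhdsWithin_le_nhds (s := {0}ᶜ))).sub_const (2 * w i₀)
      simpa [reForm_apply] using h3
    refine ((hκ.tendsto 0).mono_left nhdsWithin_le_nhds).mul (h1.congr' ?_)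
    filter_upwards [self_mem_nhdsWithin] with x hx
    rw [hgrad, reForm_apply, reForm_apply, mul_sub, mul_div_cancel₀ _ hx, Complex.sub_re,
      Complex.ofReal_re]
    ring
  -- half of the limit of the angular speed times `‖x‖²`
  set c : ℝ := κ 0 * -(w i₀) with hc
  have hcpos : 0 < c := by rw [hc]; nlinarith [hκ0 0]
  have hrad' : ∀ᶠ x in 𝓝[≠] (0 : ℂ), c < κ x * reForm (potGrad s w z W x) x :=
    hrad.eventually (lt_mem_nhds (by rw [hc]; nlinarith [hκ0 0]))
  obtain ⟨r₀, hr₀, hb⟩ := Metric.eventually_nhds_iff.1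
    (eventually_nhdsWithin_iff.1 (hrad'.and hD0))
  have hball {x : ℂ} (hx : 0 < ‖x‖) (hxr : ‖x‖ < r₀) := hb (y := x) (by rwa [dist_zero_right])
    (norm_pos_iff.1 hx)
  have hsh (x : ℂ) : shear (fun _ => 0) x = x := by simp [shear]
  obtain ⟨e₀, hI⟩ := exists_levelRange_atTop (G := pot s w z W C)
    (G' := fun x => reForm (potGrad s w z W x)) (half_pos hr₀) (half_lt_self hr₀)
    (fun x hx hxr => hasFDerivAt_pot (hD x (hball hx hxr).2))
    (fun x hx hxr => by
      have := hcpos.trans (hball hx hxr).1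
      by_contra hcon
      nlinarith [hκ0 x]) htop
  obtain ⟨x, T, hx, hT⟩ := exists_planarFamily_of_shear (φ := fun _ => 0) (φ' := fun _ => 0)
    (K := pot s w z W C) (κ := κ) (q := potGrad s w z W) (D := D) (half_pos hr₀)
    (half_lt_self hr₀).le (fun b _ => hasStrictDerivAt_const b 0) (fun b _ => continuousAt_const)
    rfl
    (fun y hy hyr => by rw [hsh]; exact (hball hy hyr).2)
    (fun x hx => hasStrictFDerivAt_pot (hD x hx)) (fun x hx => continuousAt_potGrad (hD x hx)) hκ
    (fun y hy hyr => by simpa [hsh] using hcpos.trans (hball hy hyr).1)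
    (by simpa only [hsh] using hI)
  refine ⟨e₀, x, T, hx, ?_⟩
  rw [Metric.tendsto_nhds]
  intro ε hε
  -- with this angular speed the period is at most `2 π / M = ε / 2`
  set M := 4 * Real.pi / ε with hM
  have hMpos : 0 < M := by positivity
  filter_upwards [hI.shrink (Real.sqrt (c / M)) (Real.sqrt_pos.2 (div_pos hcpos hMpos))] with e he
  have h1 : T e ≤ 2 * Real.pi / M := by
    refine hT e he.1 M hMpos fun y hy hyr hye => ?_
    simp only [hsh] at hye
    have h2 := he.2 y hy hyr hye
    have h3 := (hball hy (hyr.trans (half_lt_self hr₀))).1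
    have h4 : ‖y‖ ^ 2 < c / M := by
      have := pow_lt_pow_left₀ h2 (norm_nonneg _) two_ne_zero
      rwa [Real.sq_sqrt (div_pos hcpos hMpos).le] at this
    rw [lt_div_iff₀ hMpos] at h4
    simp only [hsh]
    simp
    linarith
  have h2 : 2 * Real.pi / M = ε / 2 := by rw [hM]; field_simp; norm_num
  have h3 := (hx.period e he.1).1.1
  rw [Real.dist_0_eq_abs, abs_of_pos h3]
  linarith

end PotentialFamilies

/-! ### Stereographic coordinates -/

/-- The inverse stereographic projection with `0 ↦ u`, relative to the directions `e₁`, `e₂`. -/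
noncomputable def stereo (u e₁ e₂ : E3) (z : ℂ) : E3 :=
  (2 / (1 + ‖z‖ ^ 2)) • (z.re • e₁ + z.im • e₂ + u) - u

/-- The derivative of the inverse stereographic projection. -/
noncomputable def stereoDeriv (u e₁ e₂ : E3) (z : ℂ) : ℂ →L[ℝ] E3 :=
  (2 / (1 + ‖z‖ ^ 2)) • (Complex.reCLM.smulRight e₁ + Complex.imCLM.smulRight e₂) +
    (-(2 / (1 + ‖z‖ ^ 2) ^ 2) • reForm (starRingEnd ℂ z)).smulRight (z.re • e₁ + z.im • e₂ + u)

theorem hasFDerivAt_stereo (u e₁ e₂ : E3) (z : ℂ) :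
    HasFDerivAt (stereo u e₁ e₂) (stereoDeriv u e₁ e₂ z) z := by
  have h1 : HasFDerivAt (fun z : ℂ => 1 + ‖z‖ ^ 2) (reForm (starRingEnd ℂ z)) z := by
    have h := (hasFDerivAt_norm_sub_sq 0 z).const_add 1
    simpa only [sub_zero] using h
  have hpos : (0 : ℝ) < 1 + ‖z‖ ^ 2 := by positivity
  have h2 : HasFDerivAt (fun z : ℂ => 2 / (1 + ‖z‖ ^ 2))
      (-(2 / (1 + ‖z‖ ^ 2) ^ 2) • reForm (starRingEnd ℂ z)) z := by
    have h := ((hasDerivAt_inv hpos.ne').comp_hasFDerivAt z h1).const_mul 2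
    refine (h.congr_fderiv ?_).congr_of_eventuallyEq (Eventually.of_forall fun y => ?_)
    · ext v
      simp
      ring
    · simp [div_eq_mul_inv]
  have h3 : HasFDerivAt (fun z : ℂ => z.re • e₁ + z.im • e₂ + u)
      (Complex.reCLM.smulRight e₁ + Complex.imCLM.smulRight e₂) z :=
    ((Complex.reCLM.hasFDerivAt.smul_const e₁).add
      (Complex.imCLM.hasFDerivAt.smul_const e₂)).add_const u
  exact (h2.fun_smul h3).sub_const u

theorem continuous_stereo (u e₁ e₂ : E3) : Continuous (stereo u e₁ e₂) :=
  continuous_iff_continuousAt.2 fun z => (hasFDerivAt_stereo u e₁ e₂ z).continuousAt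

theorem stereo_zero (u e₁ e₂ : E3) : stereo u e₁ e₂ 0 = u := by
  simp [stereo, two_smul]

theorem stereo_rotate (u e₁ e₂ : E3) (z : ℂ) :
    stereo u e₂ (-e₁) z = stereo u e₁ e₂ (Complex.I * z) := by
  simp [stereo, add_comm]

namespace IsFrame

variable {u e₁ e₂ : E3} {o : ℝ}

theorem stereo_eq (z : ℂ) : stereo u e₁ e₂ z =
    (2 / (1 + ‖z‖ ^ 2) * z.re) • e₁ + (2 / (1 + ‖z‖ ^ 2) * z.im) • e₂ +
      (2 / (1 + ‖z‖ ^ 2) - 1) • u := by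
  unfold stereo; module

theorem norm_sq_eq (z : ℂ) : ‖z‖ ^ 2 = z.re ^ 2 + z.im ^ 2 := by
  rw [← Complex.normSq_eq_norm_sq, Complex.normSq_apply]; ring

theorem two_div_mul (z : ℂ) : 2 / (1 + ‖z‖ ^ 2) * (1 + (z.re ^ 2 + z.im ^ 2)) = 2 := by
  rw [← norm_sq_eq]
  have : (0 : ℝ) < 1 + ‖z‖ ^ 2 := by positivity
  field_simp

theorem stereo_mem (h : IsFrame u e₁ e₂ o) (z : ℂ) : stereo u e₁ e₂ z ∈ S2 := by
  rw [mem_sphere_zero_iff_norm, ← sq_eq_sq₀ (norm_nonneg _) zero_le_one,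
    ← real_inner_self_eq_norm_sq, stereo_eq, h.inner_lin]
  have h1 := two_div_mul z
  set r := 2 / (1 + ‖z‖ ^ 2)
  linear_combination r * h1

theorem norm_stereo_sub_sq (h : IsFrame u e₁ e₂ o) (z y : ℂ) :
    ‖stereo u e₁ e₂ z - stereo u e₁ e₂ y‖ ^ 2 =
      4 * ‖z - y‖ ^ 2 / ((1 + ‖z‖ ^ 2) * (1 + ‖y‖ ^ 2)) := by
  rw [norm_sub_sq_sphere (h.stereo_mem z) (h.stereo_mem y), stereo_eq, stereo_eq, h.inner_lin,
    norm_sq_eq z, norm_sq_eq y, norm_sq_eq (z - y), Complex.sub_re, Complex.sub_im]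
  have h1 : (0 : ℝ) < 1 + (z.re ^ 2 + z.im ^ 2) := by positivity
  have h2 : (0 : ℝ) < 1 + (y.re ^ 2 + y.im ^ 2) := by positivity
  field_simp
  ring

theorem norm_stereo_add_sq (h : IsFrame u e₁ e₂ o) (z : ℂ) :
    ‖stereo u e₁ e₂ z - -u‖ ^ 2 = 4 / (1 + ‖z‖ ^ 2) := by
  have hu : -u = (0 : ℝ) • e₁ + (0 : ℝ) • e₂ + (-1 : ℝ) • u := by module
  have hm : -u ∈ S2 := by simpa using h.mem
  rw [norm_sub_sq_sphere (h.stereo_mem z) hm, stereo_eq, hu, h.inner_lin]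
  ring

theorem stereo_injective (h : IsFrame u e₁ e₂ o) : Function.Injective (stereo u e₁ e₂) := by
  intro z y hzy
  have h1 := h.norm_stereo_sub_sq z y
  rw [hzy, sub_self, norm_zero, zero_pow two_ne_zero, eq_comm, div_eq_zero_iff] at h1
  have h2 : (0 : ℝ) < (1 + ‖z‖ ^ 2) * (1 + ‖y‖ ^ 2) := by positivity
  have h3 : ‖z - y‖ ^ 2 = 0 := by linarith [h1.resolve_right h2.ne']
  simpa [sub_eq_zero] using h3

/-- The stereographic projection from `-u` (where the value is `0` by division by zero). -/
noncomputable def proj (u e₁ e₂ x : E3) : ℂ :=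
  ⟨inner ℝ x e₁ / (1 + inner ℝ x u), inner ℝ x e₂ / (1 + inner ℝ x u)⟩

theorem stereo_proj (h : IsFrame u e₁ e₂ o) {x : E3} (hx : x ∈ S2)
    (hxu : 1 + inner ℝ x u ≠ (0 : ℝ)) :
    stereo u e₁ e₂ (proj u e₁ e₂ x) = x := by
  have hx1 := h.expand x
  have hn : inner ℝ x e₁ ^ 2 + inner ℝ x e₂ ^ 2 + inner ℝ x u ^ 2 = (1 : ℝ) := by
    have h2 := inner_self_sphere hx
    conv_lhs at h2 => rw [hx1]
    rw [h.inner_lin] at h2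
    linarith
  conv_rhs => rw [hx1]
  rw [stereo_eq, norm_sq_eq]
  simp only [proj]
  set a : ℝ := inner ℝ x e₁
  set b : ℝ := inner ℝ x e₂
  set c : ℝ := inner ℝ x u
  have h3 : 1 + ((a / (1 + c)) ^ 2 + (b / (1 + c)) ^ 2) = 2 / (1 + c) := by
    field_simp
    linear_combination hn
  rw [h3]
  have h4 : 2 / (2 / (1 + c)) = 1 + c := by field_simp
  rw [h4, mul_div_cancel₀ _ hxu, mul_div_cancel₀ _ hxu, add_sub_cancel_left]

theorem one_add_inner_ne_zero (h : IsFrame u e₁ e₂ o) {x : E3} (hx : x ∈ S2) (hxu : x ≠ -u) :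
    1 + inner ℝ x u ≠ (0 : ℝ) := by
  intro h0
  apply hxu
  have hm : -u ∈ S2 := by simpa using h.mem
  have h1 := norm_sub_sq_sphere hx hm
  rw [inner_neg_right] at h1
  have h2 : ‖x - -u‖ ^ 2 = 0 := by rw [h1]; linarith
  exact sub_eq_zero.1 (norm_eq_zero.1 ((pow_eq_zero_iff two_ne_zero).1 h2))

theorem exists_stereo_eq (h : IsFrame u e₁ e₂ o) {x : E3} (hx : x ∈ S2) (hxu : x ≠ -u) :
    ∃ z, stereo u e₁ e₂ z = x :=
  ⟨_, h.stereo_proj hx (h.one_add_inner_ne_zero hx hxu)⟩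

theorem stereo_ne_neg (h : IsFrame u e₁ e₂ o) (z : ℂ) : stereo u e₁ e₂ z ≠ -u := by
  intro h0
  have h1 := h.norm_stereo_add_sq z
  rw [h0, sub_self, norm_zero] at h1
  have h2 : (0 : ℝ) < 4 / (1 + ‖z‖ ^ 2) := by positivity
  rw [← h1] at h2
  simp at h2

/-- Stereographic coordinates map open sets to relatively open sets. -/
theorem exists_isOpen_inter (h : IsFrame u e₁ e₂ o) {U : Set ℂ} (hU : IsOpen U) :
    ∃ V : Set E3, IsOpen V ∧ V ∩ S2 = stereo u e₁ e₂ '' U := by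
  refine ⟨{x | 1 + inner ℝ x u ≠ (0 : ℝ)} ∩ proj u e₁ e₂ ⁻¹' U, ?_, ?_⟩
  · refine ContinuousOn.isOpen_inter_preimage ?_ (isOpen_ne_fun (by fun_prop) (by fun_prop)) hU
    have heq : proj u e₁ e₂ = fun x => ((inner ℝ x e₁ / (1 + inner ℝ x u) : ℝ) : ℂ) +
        ((inner ℝ x e₂ / (1 + inner ℝ x u) : ℝ) : ℂ) * Complex.I := by
      funext x
      exact (Complex.re_add_im (proj u e₁ e₂ x)).symm
    rw [heq]
    have h1 : ContinuousOn (fun x : E3 => inner ℝ x e₁ / (1 + inner ℝ x u))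
        {x | 1 + inner ℝ x u ≠ (0 : ℝ)} :=
      ContinuousOn.div (by fun_prop) (by fun_prop) fun x hx => hx
    have h2 : ContinuousOn (fun x : E3 => inner ℝ x e₂ / (1 + inner ℝ x u))
        {x | 1 + inner ℝ x u ≠ (0 : ℝ)} :=
      ContinuousOn.div (by fun_prop) (by fun_prop) fun x hx => hx
    exact (Complex.continuous_ofReal.comp_continuousOn h1).add
      ((Complex.continuous_ofReal.comp_continuousOn h2).mul continuousOn_const)
  · ext x
    constructor
    · rintro ⟨⟨hx1, hx2⟩, hx⟩
      exact ⟨_, hx2, h.stereo_proj hx hx1⟩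
    · rintro ⟨z, hz, rfl⟩
      have h1 := h.one_add_inner_ne_zero (h.stereo_mem z) (h.stereo_ne_neg z)
      refine ⟨⟨h1, ?_⟩, h.stereo_mem z⟩
      rw [mem_preimage, h.stereo_injective (h.stereo_proj (h.stereo_mem z) h1)]
      exact hz

theorem stereoDeriv_one (z : ℂ) : stereoDeriv u e₁ e₂ z 1 =
    (2 / (1 + ‖z‖ ^ 2) - (2 / (1 + ‖z‖ ^ 2)) ^ 2 * z.re ^ 2) • e₁ +
      (-((2 / (1 + ‖z‖ ^ 2)) ^ 2 * (z.re * z.im))) • e₂ +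
      (-((2 / (1 + ‖z‖ ^ 2)) ^ 2 * z.re)) • u := by
  have h1 : stereoDeriv u e₁ e₂ z 1 = (2 / (1 + ‖z‖ ^ 2)) • ((1 : ℝ) • e₁ + (0 : ℝ) • e₂) +
      (-(2 / (1 + ‖z‖ ^ 2) ^ 2) * reForm (starRingEnd ℂ z) 1) • (z.re • e₁ + z.im • e₂ + u) := rfl
  have h2 : 2 / (1 + ‖z‖ ^ 2) ^ 2 = (2 / (1 + ‖z‖ ^ 2)) ^ 2 / 2 := by rw [div_pow]; ring
  rw [h1, reForm_one, Complex.conj_re, h2]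
  module

theorem stereoDeriv_I (z : ℂ) : stereoDeriv u e₁ e₂ z Complex.I =
    (-((2 / (1 + ‖z‖ ^ 2)) ^ 2 * (z.re * z.im))) • e₁ +
      (2 / (1 + ‖z‖ ^ 2) - (2 / (1 + ‖z‖ ^ 2)) ^ 2 * z.im ^ 2) • e₂ +
      (-((2 / (1 + ‖z‖ ^ 2)) ^ 2 * z.im)) • u := by
  have h1 : stereoDeriv u e₁ e₂ z Complex.I =
      (2 / (1 + ‖z‖ ^ 2)) • ((0 : ℝ) • e₁ + (1 : ℝ) • e₂) +
      (-(2 / (1 + ‖z‖ ^ 2) ^ 2) * reForm (starRingEnd ℂ z) Complex.I) •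
        (z.re • e₁ + z.im • e₂ + u) := rfl
  have h2 : 2 / (1 + ‖z‖ ^ 2) ^ 2 = (2 / (1 + ‖z‖ ^ 2)) ^ 2 / 2 := by rw [div_pow]; ring
  rw [h1, reForm_I, Complex.conj_im, h2]
  module

/-- Stereographic coordinates are conformal: at each point they induce an orthonormal frame. -/
theorem stereo_frame (h : IsFrame u e₁ e₂ o) (z : ℂ) :
    IsFrame (stereo u e₁ e₂ z) (((1 + ‖z‖ ^ 2) / 2) • stereoDeriv u e₁ e₂ z 1)
      (((1 + ‖z‖ ^ 2) / 2) • stereoDeriv u e₁ e₂ z Complex.I) o := by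
  have hmem := h.stereo_mem z
  have hs := stereo_eq (u := u) (e₁ := e₁) (e₂ := e₂) z
  have h1 := stereoDeriv_one (u := u) (e₁ := e₁) (e₂ := e₂) z
  have hI := stereoDeriv_I (u := u) (e₁ := e₁) (e₂ := e₂) z
  have hr := two_div_mul z
  have hD : (0 : ℝ) < 1 + ‖z‖ ^ 2 := by positivity
  have hDr : (1 + ‖z‖ ^ 2) / 2 * (2 / (1 + ‖z‖ ^ 2)) = 1 := by field_simp
  set D := (1 + ‖z‖ ^ 2) / 2
  set r := 2 / (1 + ‖z‖ ^ 2)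
  set a := z.re
  set b := z.im
  have h1' : D • stereoDeriv u e₁ e₂ z 1 = (1 - r * a ^ 2) • e₁ + (-(r * (a * b))) • e₂ +
      (-(r * a)) • u := by
    rw [h1]
    match_scalars
    · linear_combination (1 - r * a ^ 2) * hDr
    · linear_combination -(r * (a * b)) * hDr
    · linear_combination -(r * a) * hDr
  have hI' : D • stereoDeriv u e₁ e₂ z Complex.I = (-(r * (a * b))) • e₁ + (1 - r * b ^ 2) • e₂ +
      (-(r * b)) • u := by
    rw [hI]
    match_scalars
    · linear_combination -(r * (a * b)) * hDr
    · linear_combination (1 - r * b ^ 2) * hDr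
    · linear_combination -(r * b) * hDr
  have hsph {x : E3} (hx : inner ℝ x x = (1 : ℝ)) : x ∈ S2 := by
    rw [mem_sphere_zero_iff_norm, ← sq_eq_sq₀ (norm_nonneg _) zero_le_one,
      ← real_inner_self_eq_norm_sq, hx, one_pow]
  rw [hs] at hmem
  rw [h1', hI', hs]
  refine ⟨hmem, hsph ?_, hsph ?_, ?_, ?_, ?_, ?_, h.sq_eq⟩
  · rw [h.inner_lin]; linear_combination (r * a ^ 2) * hr
  · rw [h.inner_lin]; linear_combination (r * b ^ 2) * hr
  · rw [h.inner_lin]; linear_combination (-(r * a)) * hr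
  · rw [h.inner_lin]; linear_combination (-(r * b)) * hr
  · rw [h.inner_lin]; linear_combination (r * a * b) * hr
  · rw [h.cross_lin]
    match_scalars
    · ring
    · ring
    · linear_combination -o * hr

end IsFrame

theorem map_eq_re_im (L : ℂ →L[ℝ] E3) (v : ℂ) : L v = v.re • L 1 + v.im • L Complex.I := by
  rw [← map_smul, ← map_smul, ← map_add]
  simp

/-- In stereographic coordinates the field `-c · u × ∇h` is a planar Hamiltonian field. The sign of
its density is determined by the orientation `o` of the frame. -/
theorem stereoDeriv_hamField {u e₁ e₂ : E3} {o c : ℝ} (h : IsFrame u e₁ e₂ o) {H : E3 → ℝ}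
    {z : ℂ} {q : ℂ → ℂ} (hH : DifferentiableAt ℝ H (stereo u e₁ e₂ z))
    (hq : HasFDerivAt (fun z => H (stereo u e₁ e₂ z)) (reForm (q z)) z) :
    stereoDeriv u e₁ e₂ z (hamField (fun z => -o * c * (1 + ‖z‖ ^ 2) ^ 2 / 4) q z) =
      -c • cross (stereo u e₁ e₂ z) (gradient H (stereo u e₁ e₂ z)) := by
  have hfr := h.stereo_frame z
  set x := stereo u e₁ e₂ z
  set D := (1 + ‖z‖ ^ 2) / 2 with hD
  set L := stereoDeriv u e₁ e₂ z with hL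
  have hg := hH.hasGradientAt.hasFDerivAt.comp z (hasFDerivAt_stereo u e₁ e₂ z)
  have hgr (v : ℂ) : inner ℝ (gradient H x) (L v) = reForm (q z) v := by
    have := hg.unique hq
    rw [← this]
    simp [hL]
  have h1 := hfr.expand (gradient H x)
  rw [inner_smul_right, inner_smul_right, hgr, hgr, reForm_one, reForm_I] at h1
  have h2 : cross x (gradient H x) =
      (D * (2 * (q z).re)) • o • D • L Complex.I + (D * (2 * (q z).im)) • o • D • L 1 := by
    have h3 : cross x (D • L Complex.I) = -(o • D • L 1) := by rw [cross_swap, hfr.cross_snd]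
    rw [h1, cross_add_right, cross_add_right, cross_smul_right _ x (D • L 1),
      cross_smul_right _ x (D • L Complex.I), cross_smul_right _ x x, cross_self_eq, h3,
      hfr.cross_fst]
    module
  have hre : (hamField (fun z => -o * c * (1 + ‖z‖ ^ 2) ^ 2 / 4) q z).re =
      -o * c * D ^ 2 * (2 * (q z).im) := by
    unfold hamField
    rw [Complex.re_ofReal_mul, hD]
    simp
    ring
  have him : (hamField (fun z => -o * c * (1 + ‖z‖ ^ 2) ^ 2 / 4) q z).im =
      -o * c * D ^ 2 * (2 * (q z).re) := by
    unfold hamField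
    rw [Complex.im_ofReal_mul, hD]
    simp
    ring
  rw [map_eq_re_im, hre, him, h2]
  module

/-! ### Points with non-trivial isotropy -/

theorem mem_nonFreePoints {K : Subgroup SO3} {u : E3} :
    u ∈ nonFreePoints K ↔ u ∈ S2 ∧ ∃ a ∈ K, a ≠ 1 ∧ rot a u = u := by
  have h1 : (1 : SO3) ∈ isotropy K u := ⟨K.one_mem, rot_one u⟩
  refine and_congr_right fun _ => ⟨fun h => ?_, ?_⟩
  · by_contra hcon
    push Not at hcon
    refine h (Set.eq_singleton_iff_unique_mem.2 ⟨h1, fun a ha => ?_⟩)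
    by_contra ha1
    exact hcon a ha.1 ha1 ha.2
  · rintro ⟨a, ha, ha1, hau⟩ h
    have : a ∈ isotropy K u := ⟨ha, hau⟩
    rw [h] at this
    exact ha1 this

theorem rot_mem_nonFreePoints {K : Subgroup SO3} {a : SO3} (ha : a ∈ K) {u : E3}
    (hu : u ∈ nonFreePoints K) : rot a u ∈ nonFreePoints K := by
  obtain ⟨huS, b, hb, hb1, hbu⟩ := mem_nonFreePoints.1 hu
  refine mem_nonFreePoints.2 ⟨rot_mem_sphere a huS, a * b * a⁻¹,
    K.mul_mem (K.mul_mem ha hb) (K.inv_mem ha), fun h => hb1 ?_, ?_⟩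
  · rwa [mul_inv_eq_one, mul_eq_left] at h
  · rw [rot_mul, rot_mul, rot_inv_rot, hbu]

theorem neg_mem_nonFreePoints {K : Subgroup SO3} {u : E3} (hu : u ∈ nonFreePoints K) :
    -u ∈ nonFreePoints K := by
  obtain ⟨huS, b, hb, hb1, hbu⟩ := mem_nonFreePoints.1 hu
  exact mem_nonFreePoints.2 ⟨by simpa using huS, b, hb, hb1, by rw [rot_neg, hbu]⟩

/-! ### Symmetric configurations -/

/-- `g` is an ordering of the group `K` and `f` an ordering of the `K`-invariant set `F` of points
with non-trivial isotropy. -/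
structure IsOrdering (K : Subgroup SO3) (F : Set E3) {m k : ℕ} (g : Fin m → SO3)
    (f : Fin k → E3) : Prop where
  g_injective : Function.Injective g
  range_g : range g = (K : Set SO3)
  f_injective : Function.Injective f
  range_f : range f = F
  subset : F ⊆ nonFreePoints K
  invariant : ∀ a ∈ K, ∀ x ∈ F, rot a x ∈ F

theorem rho_castAdd {m k : ℕ} (g : Fin m → SO3) (f : Fin k → E3) (u : E3) (j : Fin m) :
    rho g f u (Fin.castAdd k j) = rot (g j) u := by
  simp [rho]

theorem rho_natAdd {m k : ℕ} (g : Fin m → SO3) (f : Fin k → E3) (u : E3) (j : Fin k) :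
    rho g f u (Fin.natAdd m j) = f j := by
  simp [rho]

/-- The velocity that vortices at the points of `S` induce at `x`. -/
noncomputable def inducedField (S : Finset E3) (x : E3) : E3 :=
  ∑ y ∈ S, (1 / ‖x - y‖ ^ 2) • cross y x

theorem inducedField_image_rot [DecidableEq E3] (a : SO3) (S : Finset E3) (x : E3) :
    inducedField (S.image (rot a)) (rot a x) = rot a (inducedField S x) := by
  unfold inducedField
  rw [Finset.sum_image (rot_injective a).injOn, rot_sum]
  refine Finset.sum_congr rfl fun y _ => ?_
  rw [rot_smul, rot_cross, ← rot_sub, norm_rot]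

theorem inner_inducedField (S : Finset E3) (x : E3) : inner ℝ x (inducedField S x) = (0 : ℝ) := by
  unfold inducedField
  rw [inner_sum]
  refine Finset.sum_eq_zero fun y _ => ?_
  rw [inner_smul_right, inner_cross_self_right, mul_zero]

theorem vortexField_eq_sum {N : ℕ} (v : Fin N → E3) (j : Fin N) :
    vortexField v j = ∑ i, (1 / ‖v j - v i‖ ^ 2) • cross (v i) (v j) := by
  unfold vortexField
  rw [← Finset.add_sum_erase _ _ (Finset.mem_univ j), cross_self_eq, smul_zero, zero_add]

theorem vortexField_eq_inducedField [DecidableEq E3] {N : ℕ} {v : Fin N → E3}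
    (hv : Function.Injective v) (j : Fin N) :
    vortexField v j = inducedField (Finset.univ.image v) (v j) := by
  rw [vortexField_eq_sum, inducedField, Finset.sum_image hv.injOn]

/-- The sum over pairs `i < j` of a symmetric expression is half the sum over all pairs. -/
theorem sum_Ioi_eq_half {N : ℕ} {A : Fin N → Fin N → ℝ} (hs : ∀ i j, A i j = A j i)
    (h0 : ∀ i, A i i = 0) :
    ∑ i, ∑ j ∈ Finset.Ioi i, A i j = 1 / 2 * ∑ i, ∑ j, A i j := by
  have h1 : ∑ i, ∑ j ∈ Finset.Iio i, A i j = ∑ i, ∑ j ∈ Finset.Ioi i, A i j := by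
    rw [Finset.sum_comm' (s := Finset.univ) (t := fun i => Finset.Iio i) (t' := Finset.univ)
      (s' := fun j => Finset.Ioi j) (by simp)]
    exact Finset.sum_congr rfl fun i _ => Finset.sum_congr rfl fun j _ => hs j i
  have h2 : ∀ i, ∑ j, A i j = ∑ j ∈ Finset.Iio i, A i j + ∑ j ∈ Finset.Ioi i, A i j := by
    intro i
    have h3 : (Finset.univ : Finset (Fin N)) = Finset.Iio i ∪ ({i} ∪ Finset.Ioi i) := by
      ext j
      simp
      exact lt_or_ge j i
    rw [h3, Finset.sum_union, Finset.sum_union, Finset.sum_singleton, h0, zero_add]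
    · rw [Finset.disjoint_left]; intro j; simp; exact fun h => h.le
    · rw [Finset.disjoint_left]; intro j; simp
  simp only [h2, Finset.sum_add_distrib, h1]
  ring

/-- The energy as a sum over all pairs. The diagonal terms vanish because `Real.log 0 = 0`. -/
theorem energy_eq_sum {N : ℕ} (v : Fin N → E3) :
    energy v = -(1 / 4) * ∑ i, ∑ j, Real.log (‖v j - v i‖ ^ 2) := by
  unfold energy
  rw [sum_Ioi_eq_half (fun i j => by rw [norm_sub_rev]) (fun i => by simp)]
  ring

/-- The derivative of `u ↦ ρ(u)` in the `i`-th component. -/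
noncomputable def rhoDeriv {m k : ℕ} (g : Fin m → SO3) (i : Fin (m + k)) : E3 →L[ℝ] E3 :=
  Fin.append (fun j => LinearMap.toContinuousLinearMap
    (Matrix.toEuclideanLin (g j : Matrix (Fin 3) (Fin 3) ℝ))) (fun _ : Fin k => 0) i

theorem rhoDeriv_castAdd {m k : ℕ} (g : Fin m → SO3) (j : Fin m) (v : E3) :
    rhoDeriv (k := k) g (Fin.castAdd k j) v = rot (g j) v := by
  simp [rhoDeriv, rot]

theorem rhoDeriv_natAdd {m k : ℕ} (g : Fin m → SO3) (j : Fin k) (v : E3) :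
    rhoDeriv (k := k) g (Fin.natAdd m j) v = 0 := by
  simp [rhoDeriv]

theorem hasFDerivAt_rho {m k : ℕ} (g : Fin m → SO3) (f : Fin k → E3) (i : Fin (m + k)) (u : E3) :
    HasFDerivAt (fun u => rho g f u i) (rhoDeriv g i) u := by
  refine Fin.addCases (fun j => ?_) (fun j => ?_) i
  · have h1 : (fun u => rho g f u (Fin.castAdd k j)) = rhoDeriv (k := k) g (Fin.castAdd k j) := by
      funext u; rw [rho_castAdd, rhoDeriv_castAdd]
    rw [h1]
    exact (rhoDeriv g _).hasFDerivAt
  · have h1 : (fun u => rho g f u (Fin.natAdd m j)) = fun _ => f j := by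
      funext u; rw [rho_natAdd]
    have h2 : rhoDeriv (k := k) g (Fin.natAdd m j) = 0 := by
      ext1 v; rw [rhoDeriv_natAdd]; rfl
    rw [h1, h2]
    exact hasFDerivAt_const _ _

/-- The derivative of the reduced Hamiltonian at a collision-free point. -/
theorem exists_hasFDerivAt_reducedHamiltonian {m k : ℕ} {g : Fin m → SO3} {f : Fin k → E3} {u : E3}
    (hinj : Function.Injective (rho g f u)) :
    ∃ L : E3 →L[ℝ] ℝ, HasFDerivAt (reducedHamiltonian g f) L u ∧ ∀ v, L v =
      -∑ j : Fin m, ∑ i, (‖rho g f u (Fin.castAdd k j) - rho g f u i‖ ^ 2)⁻¹ *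
        inner ℝ (rho g f u (Fin.castAdd k j) - rho g f u i) (rot (g j) v) := by
  set v := rho g f u with hv
  have h1 : ∀ i, ∀ j ∈ Finset.Ioi i, HasFDerivAt
      (fun u => Real.log (‖rho g f u j - rho g f u i‖ ^ 2))
      ((‖v j - v i‖ ^ 2)⁻¹ •
        (2 • (innerSL ℝ (v j - v i)).comp (rhoDeriv g j - rhoDeriv g i))) u := by
    intro i j hj
    have h2 : v j - v i ≠ 0 := sub_ne_zero.2 fun h => by
      rw [Finset.mem_Ioi, hinj h] at hj
      exact hj.false
    exact (((hasFDerivAt_rho g f j u).sub (hasFDerivAt_rho g f i u)).norm_sq).log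
      (pow_ne_zero 2 (norm_ne_zero_iff.2 h2))
  refine ⟨_, ((HasFDerivAt.fun_sum fun i _ => HasFDerivAt.fun_sum (h1 i)).const_mul
    (-(1 / 2 : ℝ))), fun x => ?_⟩
  set A : Fin (m + k) → Fin (m + k) → ℝ := fun i j => (‖v j - v i‖ ^ 2)⁻¹ *
    inner ℝ (v j - v i) (rhoDeriv (k := k) g j x) with hA
  have h3 : ∀ i j, A i j + A j i = (‖v j - v i‖ ^ 2)⁻¹ *
      inner ℝ (v j - v i) (rhoDeriv (k := k) g j x - rhoDeriv g i x) := by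
    intro i j
    simp only [hA]
    rw [norm_sub_rev (v i) (v j), inner_sub_right, ← neg_sub (v j) (v i), inner_neg_left]
    ring
  have h4 : ∑ i, ∑ j ∈ Finset.Ioi i, (A i j + A j i) = ∑ i, ∑ j, A i j := by
    rw [sum_Ioi_eq_half (A := fun i j => A i j + A j i) (fun i j => add_comm _ _)
      (fun i => by rw [h3]; simp)]
    simp only [Finset.sum_add_distrib]
    rw [Finset.sum_comm (f := fun i j => A j i)]
    ring
  have h5 : ∑ i, ∑ j, A i j = ∑ j, ∑ i, A i j := Finset.sum_comm
  have h6 : ∑ i, ∑ j ∈ Finset.Ioi i, (‖v j - v i‖ ^ 2)⁻¹ *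
      inner ℝ (v j - v i) (rhoDeriv (k := k) g j x - rhoDeriv g i x) =
      ∑ j : Fin m, ∑ i, (‖v (Fin.castAdd k j) - v i‖ ^ 2)⁻¹ *
        inner ℝ (v (Fin.castAdd k j) - v i) (rot (g j) x) := by
    simp only [← h3]
    rw [h4, h5, Fin.sum_univ_add]
    have h7 : ∑ j : Fin k, ∑ i, A i (Fin.natAdd m j) = 0 :=
      Finset.sum_eq_zero fun j _ => Finset.sum_eq_zero fun i _ => by
        simp only [hA, rhoDeriv_natAdd, inner_zero_right, mul_zero]
    rw [h7, add_zero]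
    simp only [hA, rhoDeriv_castAdd]
  rw [← h6]
  simp only [smul_apply, sum_apply, ContinuousLinearMap.comp_apply, innerSL_apply_apply,
    sub_apply, smul_eq_mul, nsmul_eq_mul]
  simp only [Finset.mul_sum, ← Finset.sum_neg_distrib]
  refine Finset.sum_congr rfl fun i _ => Finset.sum_congr rfl fun j _ => ?_
  push_cast
  ring

namespace IsOrdering

variable {K : Subgroup SO3} {F : Set E3} {m k : ℕ} {g : Fin m → SO3} {f : Fin k → E3}

theorem g_mem (h : IsOrdering K F g f) (j : Fin m) : g j ∈ K := by
  have : g j ∈ range g := mem_range_self j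
  rw [h.range_g] at this
  exact this

theorem exists_g_eq (h : IsOrdering K F g f) {a : SO3} (ha : a ∈ K) : ∃ j, g j = a := by
  have : a ∈ range g := by rw [h.range_g]; exact ha
  exact this

theorem f_mem (h : IsOrdering K F g f) (j : Fin k) : f j ∈ F := by
  rw [← h.range_f]; exact mem_range_self j

theorem exists_f_eq (h : IsOrdering K F g f) {x : E3} (hx : x ∈ F) : ∃ j, f j = x := by
  rw [← h.range_f] at hx; exact hx

theorem rho_mem_phaseSpace (h : IsOrdering K F g f) {u : E3} (hu : u ∈ S2) :
    rho g f u ∈ phaseSpace (m + k) := by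
  intro i
  refine Fin.addCases (fun j => ?_) (fun j => ?_) i
  · rw [rho_castAdd]; exact rot_mem_sphere _ hu
  · rw [rho_natAdd]; exact (h.subset (h.f_mem j)).1

theorem rho_injective (h : IsOrdering K F g f) {u : E3} (hu : u ∈ S2 \ nonFreePoints K) :
    Function.Injective (rho g f u) := by
  have h1 : ∀ j l, rot (g j) u ≠ f l := fun j l hjl => by
    have h2 := rot_mem_nonFreePoints (K.inv_mem (h.g_mem j)) (h.subset (h.f_mem l))
    rw [← hjl, rot_inv_rot] at h2
    exact hu.2 h2
  intro a b
  refine Fin.addCases (fun i => ?_) (fun i => ?_) a <;>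
    refine Fin.addCases (fun j => ?_) (fun j => ?_) b <;>
    simp only [rho_castAdd, rho_natAdd] <;> intro hab
  · have h2 : rot ((g j)⁻¹ * g i) u = u := by rw [rot_mul, hab, rot_inv_rot]
    have h3 : (g j)⁻¹ * g i = 1 := by
      by_contra hne
      exact hu.2 (mem_nonFreePoints.2 ⟨hu.1, _,
        K.mul_mem (K.inv_mem (h.g_mem j)) (h.g_mem i), hne, h2⟩)
    rw [h.g_injective (inv_mul_eq_one.1 h3)]
  · exact absurd hab (h1 i j)
  · exact absurd hab.symm (h1 j i)
  · rw [h.f_injective hab]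

theorem rho_mem (h : IsOrdering K F g f) {u : E3} (hu : u ∈ S2 \ nonFreePoints K) :
    rho g f u ∈ phaseSpace (m + k) \ collisionSet (m + k) :=
  ⟨h.rho_mem_phaseSpace hu.1, fun ⟨_, _, _, hij, heq⟩ => hij (h.rho_injective hu heq)⟩

theorem range_rho (h : IsOrdering K F g f) (u : E3) : range (rho g f u) = orbit K u ∪ F := by
  ext x
  constructor
  · rintro ⟨i, rfl⟩
    refine Fin.addCases (fun j => ?_) (fun j => ?_) i
    · rw [rho_castAdd]; exact Or.inl ⟨g j, h.g_mem j, rfl⟩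
    · rw [rho_natAdd]; exact Or.inr (h.f_mem j)
  · rintro (⟨a, ha, rfl⟩ | hx)
    · obtain ⟨j, rfl⟩ := h.exists_g_eq ha
      exact ⟨_, rho_castAdd g f u j⟩
    · obtain ⟨j, rfl⟩ := h.exists_f_eq hx
      exact ⟨_, rho_natAdd g f u j⟩

theorem rot_mem_range_rho (h : IsOrdering K F g f) {a : SO3} (ha : a ∈ K) {u x : E3}
    (hx : x ∈ range (rho g f u)) : rot a x ∈ range (rho g f u) := by
  rw [h.range_rho] at *
  rcases hx with ⟨b, hb, rfl⟩ | hx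
  · exact Or.inl ⟨a * b, K.mul_mem ha hb, (rot_mul a b u).symm⟩
  · exact Or.inr (h.invariant a ha x hx)

theorem image_rot_rho [DecidableEq E3] (h : IsOrdering K F g f) {a : SO3} (ha : a ∈ K) (u : E3) :
    (Finset.univ.image (rho g f u)).image (rot a) = Finset.univ.image (rho g f u) := by
  have hmem {x : E3} : x ∈ Finset.univ.image (rho g f u) ↔ x ∈ range (rho g f u) := by simp
  ext x
  rw [Finset.mem_image]
  constructor
  · rintro ⟨y, hy, rfl⟩
    exact hmem.2 (h.rot_mem_range_rho ha (hmem.1 hy))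
  · intro hx
    exact ⟨rot a⁻¹ x, hmem.2 (h.rot_mem_range_rho (K.inv_mem ha) (hmem.1 hx)), rot_rot_inv a x⟩

theorem inducedField_rot [DecidableEq E3] (h : IsOrdering K F g f) {a : SO3} (ha : a ∈ K)
    (u x : E3) : inducedField (Finset.univ.image (rho g f u)) (rot a x) =
      rot a (inducedField (Finset.univ.image (rho g f u)) x) := by
  conv_lhs => rw [← h.image_rot_rho ha u]
  exact inducedField_image_rot a _ x

/-- The free vortices move as the rotated copies of the first one. -/
theorem vortexField_castAdd [DecidableEq E3] (h : IsOrdering K F g f) {u : E3}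
    (hu : u ∈ S2 \ nonFreePoints K) (j : Fin m) :
    vortexField (rho g f u) (Fin.castAdd k j) =
      rot (g j) (inducedField (Finset.univ.image (rho g f u)) u) := by
  rw [vortexField_eq_inducedField (h.rho_injective hu), rho_castAdd, h.inducedField_rot (h.g_mem j)]

/-- The vortices at points of `F` do not move: their velocity is tangent to the sphere and fixed by
a non-trivial rotation about their position. -/
theorem vortexField_natAdd (h : IsOrdering K F g f) {u : E3}
    (hu : u ∈ S2 \ nonFreePoints K) (j : Fin k) :
    vortexField (rho g f u) (Fin.natAdd m j) = 0 := by
  classical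
  rw [vortexField_eq_inducedField (h.rho_injective hu), rho_natAdd]
  obtain ⟨hS, a, ha, ha1, haf⟩ := mem_nonFreePoints.1 (h.subset (h.f_mem j))
  have h1 := h.inducedField_rot ha u (f j)
  rw [haf] at h1
  have h2 := eq_smul_of_rot_eq hS haf ha1 h1.symm
  rwa [inner_inducedField, zero_smul] at h2

theorem differentiableAt (h : IsOrdering K F g f) {u : E3} (hu : u ∈ S2 \ nonFreePoints K) :
    DifferentiableAt ℝ (reducedHamiltonian g f) u := by
  obtain ⟨L, hL, -⟩ := exists_hasFDerivAt_reducedHamiltonian (h.rho_injective hu)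
  exact hL.differentiableAt

/-- The reduced field is the velocity of the first free vortex. -/
theorem reducedField_eq [DecidableEq E3] (h : IsOrdering K F g f) (hm : m ≠ 0) {u : E3}
    (hu : u ∈ S2 \ nonFreePoints K) :
    -(1 / (m : ℝ)) • cross u (gradient (reducedHamiltonian g f) u) =
      inducedField (Finset.univ.image (rho g f u)) u := by
  obtain ⟨L, hL, hLv⟩ := exists_hasFDerivAt_reducedHamiltonian (h.rho_injective hu)
  set X := inducedField (Finset.univ.image (rho g f u)) u with hX
  have hm' : (m : ℝ) ≠ 0 := by exact_mod_cast hm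
  have hgrad (v : E3) : inner ℝ (gradient (reducedHamiltonian g f) u) v = L v := by
    have := hL.differentiableAt.hasGradientAt.hasFDerivAt.unique hL
    rw [← this]
    simp
  refine ext_inner_right ℝ fun w => ?_
  have h1 : L (cross w u) = -(m * inner ℝ X w) := by
    rw [hLv]
    have h2 : ∀ j : Fin m, ∑ i, (‖rho g f u (Fin.castAdd k j) - rho g f u i‖ ^ 2)⁻¹ *
        inner ℝ (rho g f u (Fin.castAdd k j) - rho g f u i) (rot (g j) (cross w u)) =
        inner ℝ X w := by
      intro j
      have h3 := h.vortexField_castAdd hu j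
      rw [vortexField_eq_sum] at h3
      rw [← inner_rot_rot (g j) X w, hX, ← h3, sum_inner]
      refine Finset.sum_congr rfl fun i _ => ?_
      rw [inner_smul_left, rot_cross, ← rho_castAdd g f u j, ← inner_cross_rotate,
        cross_sub_right, cross_self_eq, zero_sub, ← cross_swap]
      simp
    simp only [h2]
    simp
  rw [inner_smul_left, inner_cross_rotate, hgrad, h1]
  simp
  field_simp

/-- Solutions of the reduced system give solutions of the `N`-vortex problem. -/
theorem isVortexSolution (h : IsOrdering K F g f) (hm : m ≠ 0) {u : ℝ → E3}
    (hu : IsReducedSolution K g f u) : IsVortexSolution (fun t => rho g f (u t)) := by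
  classical
  intro t
  obtain ⟨hut, hd⟩ := hu t
  refine ⟨h.rho_mem hut, fun i => ?_⟩
  have h1 := (hasFDerivAt_rho g f i (u t)).comp_hasDerivAt t hd
  refine h1.congr_deriv ?_
  refine Fin.addCases (fun j => ?_) (fun j => ?_) i
  · rw [rhoDeriv_castAdd, h.vortexField_castAdd hut, h.reducedField_eq hm hut]
  · rw [rhoDeriv_natAdd, h.vortexField_natAdd hut]

/-- Zeros of the reduced field give equilibria of the `N`-vortex problem. -/
theorem isVortexEquilibrium (h : IsOrdering K F g f) (hm : m ≠ 0) {u : E3}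
    (hu : u ∈ S2 \ nonFreePoints K)
    (h0 : -(1 / (m : ℝ)) • cross u (gradient (reducedHamiltonian g f) u) = 0) :
    IsVortexEquilibrium (rho g f u) := by
  classical
  refine ⟨h.rho_mem hu, fun i => ?_⟩
  refine Fin.addCases (fun j => ?_) (fun j => ?_) i
  · rw [h.vortexField_castAdd hu, ← h.reducedField_eq hm hu, h0, ← zero_smul ℝ (0 : E3), rot_smul,
      zero_smul, zero_smul]
  · exact h.vortexField_natAdd hu j

theorem sum_g_eq [DecidableEq SO3] (h : IsOrdering K F g f) (φ : SO3 → ℝ) :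
    ∑ j, φ (g j) = ∑ a ∈ Finset.univ.image g, φ a :=
  (Finset.sum_image h.g_injective.injOn).symm

theorem mem_image_g [DecidableEq SO3] (h : IsOrdering K F g f) {a : SO3} :
    a ∈ Finset.univ.image g ↔ a ∈ K := by
  have h1 : a ∈ range g ↔ a ∈ K := by rw [h.range_g]; rfl
  simpa using h1

/-- The points with non-trivial isotropy are the finitely many points on the axes of `K`. -/
theorem finite_nonFreePoints (h : IsOrdering K F g f) : (nonFreePoints K).Finite := by
  classical
  choose p hp hap using exists_axis
  refine ((Finset.univ.image g).finite_toSet.biUnion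
    (t := fun a => ({p a, -p a} : Set E3)) fun a _ => Set.toFinite _).subset fun u hu => ?_
  obtain ⟨huS, a, ha, ha1, hau⟩ := mem_nonFreePoints.1 hu
  exact Set.mem_biUnion (h.mem_image_g.2 ha) (eq_or_eq_neg_of_rot_eq (hp a) (hap a) ha1 huS hau)

/-- On the sphere the reduced Hamiltonian is a logarithmic potential with poles at all points with
non-trivial isotropy: the interaction of the images of `u` under a rotation is that of `u` with the
two fixed points of the rotation. -/
theorem exists_reducedHamiltonian_eq (h : IsOrdering K F g f) (hm : m ≠ 0) :
    ∃ (P : Finset E3) (w : E3 → ℝ) (C : ℝ), (P : Set E3) = nonFreePoints K ∧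
      (∀ p ∈ P, 0 < w p) ∧ ∀ u ∈ S2 \ nonFreePoints K,
        reducedHamiltonian g f u = C - ∑ p ∈ P, w p * Real.log (‖u - p‖ ^ 2) := by
  classical
  set P := h.finite_nonFreePoints.toFinset with hP
  have hPmem {p : E3} : p ∈ P ↔ p ∈ nonFreePoints K := Set.Finite.mem_toFinset _
  set KS := Finset.univ.image g with hKS
  have hKSmem {a : SO3} : a ∈ KS ↔ a ∈ K := h.mem_image_g
  set FS := Finset.univ.image f with hFS
  have hFSmem {p : E3} : p ∈ FS ↔ p ∈ F := by rw [← h.range_f]; simp [hFS]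
  have hFSP : FS ⊆ P := fun p hp => hPmem.2 (h.subset (hFSmem.1 hp))
  have hmpos : (0 : ℝ) < m := by exact_mod_cast Nat.pos_of_ne_zero hm
  -- the contribution of the rotations `a ≠ 1`
  have hax : ∀ a ∈ KS.erase 1, ∃ s : ℝ, ∀ u ∈ S2 \ nonFreePoints K,
      Real.log (‖u - rot a u‖ ^ 2) =
        s + ∑ p ∈ P with rot a p = p, Real.log (‖u - p‖ ^ 2) := by
    intro a ha
    rw [Finset.mem_erase, hKSmem] at ha
    obtain ⟨p, hp, hap⟩ := exists_axis a
    obtain ⟨s, hs, hsu⟩ := exists_norm_sub_rot_sq_sphere hp hap ha.1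
    have hpP : p ∈ nonFreePoints K := mem_nonFreePoints.2 ⟨hp, a, ha.2, ha.1, hap⟩
    have hnP := neg_mem_nonFreePoints hpP
    have hfil : (P.filter fun q => rot a q = q) = {p, -p} := by
      ext q
      rw [Finset.mem_filter, hPmem, Finset.mem_insert, Finset.mem_singleton]
      constructor
      · rintro ⟨hq, haq⟩
        exact eq_or_eq_neg_of_rot_eq hp hap ha.1 hq.1 haq
      · rintro (rfl | rfl)
        · exact ⟨hpP, hap⟩
        · exact ⟨hnP, by rw [rot_neg, hap]⟩
    have hpn : p ≠ -p := ne_neg_of_mem_S2 hp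
    refine ⟨Real.log s, fun u hu => ?_⟩
    have hne {q : E3} (hq : q ∈ nonFreePoints K) : ‖u - q‖ ^ 2 ≠ 0 :=
      pow_ne_zero 2 (norm_ne_zero_iff.2 (sub_ne_zero.2 fun hh => hu.2 (hh ▸ hq)))
    rw [hfil, Finset.sum_pair hpn, hsu u hu.1,
      Real.log_mul hs.ne' (mul_ne_zero (hne hpP) (hne hnP)), Real.log_mul (hne hpP) (hne hnP)]
  choose! s hs using hax
  -- each rotation about `p` contributes `m / 4` to the weight of `p`, a vortex at `p` contributes
  -- `m / 2`
  set w : E3 → ℝ := fun p => m / 4 * ((KS.erase 1).filter fun a => rot a p = p).card +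
    if p ∈ FS then (m : ℝ) / 2 else 0 with hw
  refine ⟨P, w, -(1 / 4) * (m * ∑ a ∈ KS.erase 1, s a +
    ∑ i, ∑ j, Real.log (‖f j - f i‖ ^ 2)), by rw [hP, Set.Finite.coe_toFinset], fun p hp => ?_,
    fun u hu => ?_⟩
  · obtain ⟨-, a, ha, ha1, hap⟩ := mem_nonFreePoints.1 (hPmem.1 hp)
    have h1 : 0 < ((KS.erase 1).filter fun a => rot a p = p).card :=
      Finset.card_pos.2 ⟨a, by simp [hKSmem.2 ha, ha1, hap]⟩
    have h2 : (0 : ℝ) < m / 4 * ((KS.erase 1).filter fun a => rot a p = p).card := by positivity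
    have h3 : (0 : ℝ) ≤ if p ∈ FS then (m : ℝ) / 2 else 0 := by split_ifs <;> positivity
    exact add_pos_of_pos_of_nonneg h2 h3
  · have hgg : ∑ i, ∑ j, Real.log (‖rot (g j) u - rot (g i) u‖ ^ 2) =
        m * ∑ a ∈ KS, Real.log (‖u - rot a u‖ ^ 2) := by
      have h1 : ∀ i, ∑ j, Real.log (‖rot (g j) u - rot (g i) u‖ ^ 2) =
          ∑ a ∈ KS, Real.log (‖u - rot a u‖ ^ 2) := by
        intro i
        rw [h.sum_g_eq fun a => Real.log (‖rot a u - rot (g i) u‖ ^ 2)]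
        refine Finset.sum_nbij' (fun a => (g i)⁻¹ * a) (fun a => g i * a)
          (fun a ha => hKSmem.2 (K.mul_mem (K.inv_mem (h.g_mem i)) (hKSmem.1 ha)))
          (fun a ha => hKSmem.2 (K.mul_mem (h.g_mem i) (hKSmem.1 ha)))
          (fun a _ => by simp) (fun a _ => by simp) fun a _ => ?_
        rw [rot_mul, ← norm_rot (g i) (u - _), rot_sub, rot_rot_inv, norm_sub_rev]
      simp only [h1]
      simp
    have hgf : ∀ i, ∑ j, Real.log (‖f j - rot (g i) u‖ ^ 2) =
        ∑ p ∈ FS, Real.log (‖u - p‖ ^ 2) := by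
      intro i
      rw [← Finset.sum_image (s := Finset.univ) (g := f)
        (f := fun p => Real.log (‖p - rot (g i) u‖ ^ 2)) h.f_injective.injOn]
      refine Finset.sum_nbij' (fun p => rot (g i)⁻¹ p) (fun p => rot (g i) p)
        (fun p hp => hFSmem.2 (h.invariant _ (K.inv_mem (h.g_mem i)) _ (hFSmem.1 hp)))
        (fun p hp => hFSmem.2 (h.invariant _ (h.g_mem i) _ (hFSmem.1 hp)))
        (fun p _ => rot_rot_inv _ _) (fun p _ => rot_inv_rot _ _) fun p _ => ?_
      rw [← norm_rot (g i) (u - _), rot_sub, rot_rot_inv, norm_sub_rev]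
    have hK1 : ∑ a ∈ KS, Real.log (‖u - rot a u‖ ^ 2) = ∑ a ∈ KS.erase 1, s a +
        ∑ p ∈ P, ((KS.erase 1).filter fun a => rot a p = p).card * Real.log (‖u - p‖ ^ 2) := by
      -- the term of the identity is `Real.log 0 = 0`
      rw [← Finset.add_sum_erase KS _ (hKSmem.2 K.one_mem), rot_one, sub_self, norm_zero,
        zero_pow two_ne_zero, Real.log_zero, zero_add,
        Finset.sum_congr rfl fun a ha => hs a ha u hu, Finset.sum_add_distrib]
      congr 1
      simp only [Finset.sum_filter]
      rw [Finset.sum_comm]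
      refine Finset.sum_congr rfl fun p _ => ?_
      rw [← Finset.sum_filter, Finset.sum_const, nsmul_eq_mul]
    have hF1 : ∑ p ∈ FS, Real.log (‖u - p‖ ^ 2) =
        ∑ p ∈ P, if p ∈ FS then Real.log (‖u - p‖ ^ 2) else 0 := by
      rw [← Finset.sum_filter, Finset.filter_mem_eq_inter, Finset.inter_eq_right.2 hFSP]
    unfold reducedHamiltonian
    rw [energy_eq_sum, Fin.sum_univ_add]
    simp only [Fin.sum_univ_add, rho_castAdd, rho_natAdd, Finset.sum_add_distrib]
    rw [Finset.sum_comm (s := (Finset.univ : Finset (Fin k))) (t := (Finset.univ : Finset (Fin m)))]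
    simp only [norm_sub_rev (rot (g _) u) (f _), hgf, hgg]
    rw [hK1, hF1]
    simp only [Finset.sum_const, Finset.card_univ, Fintype.card_fin, nsmul_eq_mul]
    have hsum : ∑ p ∈ P, w p * Real.log (‖u - p‖ ^ 2) = m / 4 *
        ∑ p ∈ P, ((KS.erase 1).filter fun a => rot a p = p).card * Real.log (‖u - p‖ ^ 2) +
        m / 2 * ∑ p ∈ P, if p ∈ FS then Real.log (‖u - p‖ ^ 2) else 0 := by
      rw [Finset.mul_sum, Finset.mul_sum, ← Finset.sum_add_distrib]
      refine Finset.sum_congr rfl fun p _ => ?_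
      simp only [hw]
      split_ifs <;> ring
    rw [hsum]
    ring

end IsOrdering

/-! ### Symmetric collisions -/

namespace IsOrdering

variable {K : Subgroup SO3} {F : Set E3} {m k : ℕ} {g : Fin m → SO3} {f : Fin k → E3}

theorem ncard_rho_eq (g : Fin m → SO3) (f : Fin k → E3) (u x : E3) :
    {i | rho g f u i = x}.ncard = {j | rot (g j) u = x}.ncard + {j | f j = x}.ncard := by
  have h1 : {i | rho g f u i = x} =
      Fin.castAdd k '' {j | rot (g j) u = x} ∪ Fin.natAdd m '' {j | f j = x} := by
    ext i
    refine Fin.addCases (fun j => ?_) (fun j => ?_) i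
    · have h1 : ∀ y : Fin k, m + (y : ℕ) ≠ j := fun y => by omega
      simp [rho_castAdd, Fin.ext_iff, h1]
      simp [← Fin.ext_iff]
    · have h1 : ∀ y : Fin m, (y : ℕ) ≠ m + j := fun y => by omega
      simp [rho_natAdd, Fin.ext_iff, h1]
      simp [← Fin.ext_iff]
  rw [h1, ncard_union_eq _ (toFinite _) (toFinite _),
    ncard_image_of_injective _ (Fin.castAdd_injective m k),
    ncard_image_of_injective _ (Fin.natAdd_injective k m)]
  rw [Set.disjoint_left]
  rintro _ ⟨a, -, rfl⟩ ⟨b, -, hb⟩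
  have := congrArg Fin.val hb
  simp at this
  omega

theorem ncard_rot_eq (h : IsOrdering K F g f) {b : SO3} (hb : b ∈ K) (u : E3) :
    {j | rot (g j) u = rot b u}.ncard = (isotropy K u).ncard := by
  rw [← ncard_image_of_injective {j | rot (g j) u = rot b u}
    ((mul_right_injective b⁻¹).comp h.g_injective)]
  congr 1
  ext a
  constructor
  · rintro ⟨j, hj, rfl⟩
    refine ⟨K.mul_mem (K.inv_mem hb) (h.g_mem j), ?_⟩
    simp only [Function.comp_apply]
    rw [rot_mul, hj, rot_inv_rot]
  · rintro ⟨ha, hau⟩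
    obtain ⟨j, hj⟩ := h.exists_g_eq (K.mul_mem hb ha)
    refine ⟨j, ?_, ?_⟩
    · simp only [mem_ofPred_eq]
      rw [hj, rot_mul, hau]
    · simp [hj]

theorem ncard_f_eq_one (h : IsOrdering K F g f) {x : E3} (hx : x ∈ F) :
    {j | f j = x}.ncard = 1 := by
  obtain ⟨j, hj⟩ := h.exists_f_eq hx
  refine ncard_eq_one.2 ⟨j, ?_⟩
  ext i
  simp only [mem_ofPred_eq, mem_singleton_iff, ← hj, h.f_injective.eq_iff]

theorem ncard_f_eq_zero (h : IsOrdering K F g f) {x : E3} (hx : x ∉ F) :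
    {j | f j = x}.ncard = 0 := by
  rw [ncard_eq_zero]
  ext i
  simp only [mem_ofPred_eq, mem_empty_iff_false, iff_false]
  rintro rfl
  exact hx (h.f_mem i)

theorem mem_of_rot_mem (h : IsOrdering K F g f) {a : SO3} (ha : a ∈ K) {x : E3}
    (hx : rot a x ∈ F) : x ∈ F := by
  have h1 := h.invariant _ (K.inv_mem ha) _ hx
  rwa [rot_inv_rot] at h1

theorem isSymmetricCollision (h : IsOrdering K F g f) {u : E3} (hu : u ∈ nonFreePoints K) :
    IsSymmetricCollision K F g f u := by
  obtain ⟨huS, a, ha, ha1, hau⟩ := mem_nonFreePoints.1 hu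
  obtain ⟨i, hi⟩ := h.exists_g_eq ha
  obtain ⟨j, hj⟩ := h.exists_g_eq K.one_mem
  have hij : i ≠ j := by
    rintro rfl
    exact ha1 (hi.symm.trans hj)
  refine ⟨⟨h.rho_mem_phaseSpace huS, Fin.castAdd k i, Fin.castAdd k j, ?_, ?_⟩, ?_, ?_, ?_, ?_⟩
  · exact fun h1 => hij (Fin.castAdd_injective m k h1)
  · rw [rho_castAdd, rho_castAdd, hi, hj, hau, rot_one]
  · intro x hx
    have h1 : {j | rot (g j) u = x} = ∅ := by
      ext j
      simp only [mem_ofPred_eq, mem_empty_iff_false, iff_false]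
      exact fun h1 => hx ⟨g j, h.g_mem j, h1.symm⟩
    rw [ncard_rho_eq, h1, ncard_empty, zero_add]
    by_cases hxF : x ∈ F
    · rw [h.ncard_f_eq_one hxF]
    · rw [h.ncard_f_eq_zero hxF]
      exact zero_le_one
  · have h1 := h.ncard_rot_eq K.one_mem u
    rw [← h1]
    refine (one_lt_ncard (toFinite _)).2 ⟨i, ?_, j, ?_, hij⟩
    · simp only [mem_ofPred_eq]
      rw [hi, hau, rot_one]
    · simp only [mem_ofPred_eq]
      rw [hj]
  · rintro huF x ⟨b, hb, rfl⟩
    rw [ncard_rho_eq, h.ncard_rot_eq hb, h.ncard_f_eq_zero fun h1 => huF (h.mem_of_rot_mem hb h1),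
      add_zero]
  · rintro huF x ⟨b, hb, rfl⟩
    rw [ncard_rho_eq, h.ncard_rot_eq hb, h.ncard_f_eq_one (h.invariant b hb u huF)]

end IsOrdering

/-! ### The axes of a dihedral or polyhedral group -/

theorem nonFreePoints_map_conj (G : Subgroup SO3) (R : SO3) {p : E3} (hp : p ∈ nonFreePoints G) :
    rot R p ∈ nonFreePoints (G.map (MulAut.conj R).toMonoidHom) := by
  obtain ⟨hpS, a, ha, ha1, hap⟩ := mem_nonFreePoints.1 hp
  refine mem_nonFreePoints.2 ⟨rot_mem_sphere R hpS, R * a * R⁻¹, ⟨a, ha, rfl⟩, ?_, ?_⟩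
  · intro h
    exact ha1 (by simpa [mul_inv_eq_one] using h)
  · rw [rot_mul, rot_mul, rot_inv_rot, hap]

theorem rot_halfTurnX (x : E3) : rot halfTurnX x = !₂[x 0, -x 1, -x 2] := by
  ext i
  fin_cases i <;>
    simp [rot, halfTurnX, Matrix.toLpLin_apply, dotProduct, Fin.sum_univ_three]

theorem rot_cyclicPerm (x : E3) : rot cyclicPerm x = !₂[x 1, x 2, x 0] := by
  ext i
  fin_cases i <;>
    simp [rot, cyclicPerm, Matrix.toLpLin_apply, dotProduct, Fin.sum_univ_three]

theorem rot_rotZ (θ : ℝ) (x : E3) : rot (rotZ θ) x =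
    !₂[Real.cos θ * x 0 - Real.sin θ * x 1, Real.sin θ * x 0 + Real.cos θ * x 1, x 2] := by
  ext i
  fin_cases i <;>
    simp [rot, rotZ, Matrix.toLpLin_apply, dotProduct, Fin.sum_univ_three,
      sub_eq_add_neg]

theorem mem_S2_iff {x : E3} : x ∈ S2 ↔ x 0 ^ 2 + x 1 ^ 2 + x 2 ^ 2 = 1 := by
  rw [mem_sphere_zero_iff_norm, ← sq_eq_sq₀ (norm_nonneg x) zero_le_one, EuclideanSpace.norm_sq_eq,
    Fin.sum_univ_three]
  simp

theorem mem_rotationGroup_of_pow_eq_one {V : Set E3} {a : SO3} (h1 : ∀ x ∈ V, rot a x ∈ V) {n : ℕ}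
    (hn : a ^ (n + 1) = 1) : a ∈ rotationGroup V := by
  have h2 : ∀ n : ℕ, ∀ x ∈ V, rot (a ^ n) x ∈ V := by
    intro n
    induction n with
    | zero => simp [rot_one]
    | succ n ih => exact fun x hx => by rw [pow_succ, rot_mul]; exact ih _ (h1 x hx)
  refine Subset.antisymm ?_ fun x hx => ⟨_, h2 n x hx, ?_⟩
  · rintro _ ⟨x, hx, rfl⟩
    exact h1 x hx
  · rw [← rot_mul, ← pow_succ', hn, rot_one]

theorem halfTurnX_sq : halfTurnX ^ 2 = 1 := by
  refine rot_ext fun x => ?_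
  rw [pow_two, rot_mul, rot_one, rot_halfTurnX, rot_halfTurnX]
  ext i
  fin_cases i <;> simp

theorem cyclicPerm_pow_three : cyclicPerm ^ 3 = 1 := by
  refine rot_ext fun x => ?_
  rw [pow_succ, pow_two, rot_mul, rot_mul, rot_one, rot_cyclicPerm, rot_cyclicPerm, rot_cyclicPerm]
  ext i
  fin_cases i <;> simp

theorem halfTurnX_mem_octahedral : halfTurnX ∈ octahedral := by
  refine mem_rotationGroup_of_pow_eq_one ?_ halfTurnX_sq
  rintro x ⟨s, hs, rfl | rfl | rfl⟩
  · exact ⟨s, hs, .inl (by rw [rot_halfTurnX]; simp)⟩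
  · exact ⟨-s, by simpa using hs, .inr (.inl (by rw [rot_halfTurnX]; simp))⟩
  · exact ⟨-s, by simpa using hs, .inr (.inr (by rw [rot_halfTurnX]; simp))⟩

theorem cyclicPerm_mem_octahedral : cyclicPerm ∈ octahedral := by
  refine mem_rotationGroup_of_pow_eq_one ?_ cyclicPerm_pow_three
  rintro x ⟨s, hs, rfl | rfl | rfl⟩
  · exact ⟨s, hs, .inr (.inr (by rw [rot_cyclicPerm]; simp))⟩
  · exact ⟨s, hs, .inl (by rw [rot_cyclicPerm]; simp)⟩
  · exact ⟨s, hs, .inr (.inl (by rw [rot_cyclicPerm]; simp))⟩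

theorem halfTurnX_mem_icosahedral : halfTurnX ∈ icosahedral := by
  refine mem_rotationGroup_of_pow_eq_one ?_ halfTurnX_sq
  rintro x ⟨s, t, hs, ht, rfl | rfl | rfl⟩
  · exact ⟨-s, -t, by simpa using hs, by simpa using ht, .inl (by rw [rot_halfTurnX]; simp)⟩
  · exact ⟨s, -t, hs, by simpa using ht, .inr (.inl (by rw [rot_halfTurnX]; simp))⟩
  · exact ⟨-s, t, by simpa using hs, ht, .inr (.inr (by rw [rot_halfTurnX]; simp))⟩

theorem cyclicPerm_mem_icosahedral : cyclicPerm ∈ icosahedral := by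
  refine mem_rotationGroup_of_pow_eq_one ?_ cyclicPerm_pow_three
  rintro x ⟨s, t, hs, ht, rfl | rfl | rfl⟩
  · exact ⟨s, t, hs, ht, .inr (.inl (by rw [rot_cyclicPerm]; simp))⟩
  · exact ⟨s, t, hs, ht, .inr (.inr (by rw [rot_cyclicPerm]; simp))⟩
  · exact ⟨s, t, hs, ht, .inl (by rw [rot_cyclicPerm]; simp)⟩

theorem xAxis_mem_nonFreePoints {G : Subgroup SO3} (hG : halfTurnX ∈ G) :
    !₂[(1 : ℝ), 0, 0] ∈ nonFreePoints G := by
  refine mem_nonFreePoints.2 ⟨mem_S2_iff.2 (by simp), _, hG, fun h => ?_, by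
    rw [rot_halfTurnX]; simp⟩
  have h1 := congrArg (fun a => rot a !₂[(0 : ℝ), 1, 0] 1) h
  simp only [rot_halfTurnX, rot_one] at h1
  norm_num at h1

theorem diagonal_mem_nonFreePoints {G : Subgroup SO3} (hG : cyclicPerm ∈ G) :
    !₂[√(1 / 3 : ℝ), √(1 / 3), √(1 / 3)] ∈ nonFreePoints G := by
  refine mem_nonFreePoints.2 ⟨mem_S2_iff.2 ?_, _, hG, fun h => ?_, by
    rw [rot_cyclicPerm]; simp⟩
  · have := Real.sq_sqrt (show (0 : ℝ) ≤ 1 / 3 by norm_num)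
    simp only [Matrix.cons_val_zero, Matrix.cons_val_one, Matrix.cons_val, this]
    norm_num
  · have h1 := congrArg (fun a => rot a !₂[(1 : ℝ), 0, 0] 0) h
    simp only [rot_cyclicPerm, rot_one] at h1
    norm_num at h1

theorem zAxis_mem_nonFreePoints {n : ℕ} (hn : 2 ≤ n) :
    !₂[(0 : ℝ), 0, 1] ∈ nonFreePoints (dihedral n) := by
  refine mem_nonFreePoints.2 ⟨mem_S2_iff.2 (by simp), rotZ (2 * Real.pi / n),
    Subgroup.subset_closure (by simp), fun h => ?_, by rw [rot_rotZ]; simp⟩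
  have h1 := congrArg (fun a => rot a !₂[(1 : ℝ), 0, 0] 0) h
  simp only [rot_rotZ, rot_one] at h1
  have hn' : (2 : ℝ) ≤ n := by exact_mod_cast hn
  have h2 : Real.cos (2 * Real.pi / n) < 1 := by
    rw [← Real.cos_zero]
    refine Real.cos_lt_cos_of_nonneg_of_le_pi le_rfl ?_ (by positivity)
    rw [div_le_iff₀ (by positivity)]
    nlinarith [Real.pi_pos]
  have h3 : Real.cos (2 * Real.pi / n) = 1 := by simpa using h1
  exact h2.ne h3

/-- A dihedral or polyhedral group has at least two axes. -/
theorem IsDihedralOrPolyhedral.exists_mem_nonFreePoints {K : Subgroup SO3}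
    (hK : IsDihedralOrPolyhedral K) :
    ∃ p ∈ nonFreePoints K, ∃ q ∈ nonFreePoints K, q ≠ p ∧ q ≠ -p := by
  obtain ⟨R, G, hG, rfl⟩ := hK
  have key : ∃ p ∈ nonFreePoints G, ∃ q ∈ nonFreePoints G, q ≠ p ∧ q ≠ -p := by
    have hd : ∀ {G : Subgroup SO3}, halfTurnX ∈ G → cyclicPerm ∈ G →
        ∃ p ∈ nonFreePoints G, ∃ q ∈ nonFreePoints G, q ≠ p ∧ q ≠ -p := by
      intro G h1 h2
      refine ⟨_, xAxis_mem_nonFreePoints h1, _, diagonal_mem_nonFreePoints h2, fun h => ?_,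
        fun h => ?_⟩ <;>
      · have := congrArg (fun x : E3 => x 1) h
        simp at this
    rcases hG with ⟨n, hn, rfl⟩ | rfl | rfl | rfl
    · refine ⟨_, xAxis_mem_nonFreePoints (Subgroup.subset_closure (by simp)), _,
        zAxis_mem_nonFreePoints hn, fun h => ?_, fun h => ?_⟩ <;>
      · have := congrArg (fun x : E3 => x 2) h
        simp at this
    · exact hd (Subgroup.subset_closure (by simp)) (Subgroup.subset_closure (by simp))
    · exact hd halfTurnX_mem_octahedral cyclicPerm_mem_octahedral
    · exact hd halfTurnX_mem_icosahedral cyclicPerm_mem_icosahedral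
  obtain ⟨p, hp, q, hq, h1, h2⟩ := key
  refine ⟨_, nonFreePoints_map_conj G R hp, _, nonFreePoints_map_conj G R hq, fun h => ?_,
    fun h => ?_⟩
  · exact h1 (rot_injective R h)
  · rw [← rot_neg] at h
    exact h2 (rot_injective R h)

/-- Two axes meet the sphere in four points, so at least three remain when one is left out. -/
theorem IsDihedralOrPolyhedral.three_le_card_erase [DecidableEq E3] {K : Subgroup SO3}
    (hK : IsDihedralOrPolyhedral K) {P : Finset E3} (hP : (P : Set E3) = nonFreePoints K)
    (x : E3) : 3 ≤ (P.erase x).card := by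
  obtain ⟨p, hp, q, hq, h1, h2⟩ := hK.exists_mem_nonFreePoints
  have hp0 := ne_neg_of_mem_S2 hp.1
  have hq0 := ne_neg_of_mem_S2 hq.1
  have hsub : ({p, -p, q, -q} : Finset E3) ⊆ P := by
    rw [← Finset.coe_subset, hP]
    intro y hy
    simp at hy
    rcases hy with rfl | rfl | rfl | rfl
    · exact hp
    · exact neg_mem_nonFreePoints hp
    · exact hq
    · exact neg_mem_nonFreePoints hq
  have hcard : ({p, -p, q, -q} : Finset E3).card = 4 := by
    rw [Finset.card_insert_of_notMem, Finset.card_insert_of_notMem, Finset.card_pair hq0]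
    · simp only [Finset.mem_insert, Finset.mem_singleton, not_or]
      exact ⟨h2.symm, fun h => h1 (neg_injective h).symm⟩
    · simp only [Finset.mem_insert, Finset.mem_singleton, not_or]
      exact ⟨hp0, h1.symm, fun h => h2 (by rw [h, neg_neg])⟩
  have h3 := Finset.card_le_card hsub
  have h4 := Finset.pred_card_le_card_erase (s := P) (a := x)
  omega

/-! ### The reduced system in stereographic coordinates -/

/-- In the stereographic coordinates centred at `u` that belong to the frame `u, e₁, e₂`, the
reduced Hamiltonian is the planar potential `pot s w z W C`. Its poles are indexed by the points `p`
with non-trivial isotropy other than `-u`, which lies at infinity, and `z p` is the coordinate of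
`p`. -/
structure IsPotentialChart (K : Subgroup SO3) {m k : ℕ} (g : Fin m → SO3) (f : Fin k → E3)
    (u e₁ e₂ : E3) (o : ℝ) (s : Finset E3) (w : E3 → ℝ) (z : E3 → ℂ) (W C : ℝ) : Prop where
  frame : IsFrame u e₁ e₂ o
  mem_iff : ∀ p, p ∈ s ↔ p ∈ nonFreePoints K ∧ p ≠ -u
  weight_pos : ∀ p ∈ s, 0 < w p
  stereo_pole : ∀ p ∈ s, stereo u e₁ e₂ (z p) = p
  eq_pot : ∀ x, stereo u e₁ e₂ x ∉ nonFreePoints K →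
    reducedHamiltonian g f (stereo u e₁ e₂ x) = pot s w z W C x

/-- If `-u` is not a pole, then `W` is the total weight of the poles in the plane. -/
theorem IsOrdering.exists_isPotentialChart {K : Subgroup SO3} {F : Set E3} {m k : ℕ}
    {g : Fin m → SO3} {f : Fin k → E3} (h : IsOrdering K F g f) (hm : m ≠ 0) {u e₁ e₂ : E3} {o : ℝ}
    (hfr : IsFrame u e₁ e₂ o) :
    ∃ (s : Finset E3) (w : E3 → ℝ) (z : E3 → ℂ) (W C : ℝ),
      IsPotentialChart K g f u e₁ e₂ o s w z W C ∧ (u ∉ nonFreePoints K → W = ∑ p ∈ s, w p) := by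
  classical
  obtain ⟨P, w, C, hP, hw, hH⟩ := h.exists_reducedHamiltonian_eq hm
  have hPmem (p : E3) : p ∈ P ↔ p ∈ nonFreePoints K := by rw [← hP]; rfl
  have hz : ∀ p : E3, ∃ z : ℂ, p ∈ P.erase (-u) → stereo u e₁ e₂ z = p := by
    intro p
    by_cases hp : p ∈ P.erase (-u)
    · rw [Finset.mem_erase, hPmem] at hp
      obtain ⟨z, hz⟩ := hfr.exists_stereo_eq hp.2.1 hp.1
      exact ⟨z, fun _ => hz⟩
    · exact ⟨0, fun hp' => absurd hp' hp⟩
  choose z hz using hz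
  refine ⟨P.erase (-u), w, z, ∑ p ∈ P, w p, C - ∑ p ∈ P, w p * Real.log 4 +
    ∑ p ∈ P.erase (-u), w p * Real.log (1 + ‖z p‖ ^ 2),
    ⟨hfr, fun p => by rw [Finset.mem_erase, hPmem, and_comm],
      fun p hp => hw p (Finset.mem_of_mem_erase hp), hz, fun x hx => ?_⟩, fun hu => ?_⟩
  · have hlog : ∀ p ∈ P, Real.log (‖stereo u e₁ e₂ x - p‖ ^ 2) =
        Real.log 4 - Real.log (1 + ‖x‖ ^ 2) +
          if p = -u then 0 else Real.log (‖x - z p‖ ^ 2) - Real.log (1 + ‖z p‖ ^ 2) := by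
      intro p hp
      have h1 : (1 + ‖x‖ ^ 2) ≠ 0 := by positivity
      split_ifs with hpu
      · rw [hpu, hfr.norm_stereo_add_sq, Real.log_div (by norm_num) h1, add_zero]
      · have hzp := hz p (Finset.mem_erase.2 ⟨hpu, hp⟩)
        have h2 : (1 + ‖z p‖ ^ 2) ≠ 0 := by positivity
        have h3 : ‖x - z p‖ ^ 2 ≠ 0 := by
          refine pow_ne_zero 2 (norm_ne_zero_iff.2 (sub_ne_zero.2 ?_))
          rintro rfl
          exact hx ((hPmem _).1 (hzp.symm ▸ hp))
        conv_lhs => rw [← hzp]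
        rw [hfr.norm_stereo_sub_sq, Real.log_div (mul_ne_zero (by norm_num) h3) (mul_ne_zero h1 h2),
          Real.log_mul (by norm_num) h3, Real.log_mul h1 h2]
        ring
    have hsum : ∑ p ∈ P, w p * (if p = -u then 0 else
        Real.log (‖x - z p‖ ^ 2) - Real.log (1 + ‖z p‖ ^ 2)) =
        ∑ p ∈ P.erase (-u), w p * Real.log (‖x - z p‖ ^ 2) -
          ∑ p ∈ P.erase (-u), w p * Real.log (1 + ‖z p‖ ^ 2) := by
      rw [← Finset.sum_erase P (a := -u) (by simp), ← Finset.sum_sub_distrib]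
      refine Finset.sum_congr rfl fun p hp => ?_
      rw [if_neg (Finset.ne_of_mem_erase hp), mul_sub]
    rw [hH _ ⟨hfr.stereo_mem x, hx⟩, Finset.sum_congr rfl fun p hp => by rw [hlog p hp, mul_add],
      Finset.sum_add_distrib, hsum, ← Finset.sum_mul, pot, ← Finset.sum_mul]
    ring
  · rw [Finset.erase_eq_of_notMem]
    rw [hPmem]
    exact fun h1 => hu (by simpa using neg_mem_nonFreePoints h1)

namespace IsPotentialChart

variable {K : Subgroup SO3} {F : Set E3} {m k : ℕ} {g : Fin m → SO3} {f : Fin k → E3}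
  {u e₁ e₂ : E3} {o : ℝ} {s : Finset E3} {w : E3 → ℝ} {z : E3 → ℂ} {W C : ℝ}

theorem rotate (h : IsPotentialChart K g f u e₁ e₂ o s w z W C) :
    IsPotentialChart K g f u e₂ (-e₁) o s w (fun p => z p / Complex.I) W C := by
  refine ⟨h.frame.rotate, h.mem_iff, h.weight_pos, fun p hp => ?_, fun x hx => ?_⟩
  · rw [stereo_rotate, mul_div_cancel₀ _ Complex.I_ne_zero, h.stereo_pole p hp]
  · rw [stereo_rotate] at hx ⊢
    rw [h.eq_pot _ hx, pot, pot]
    have h1 (a : ℂ) : ‖Complex.I * x - a‖ = ‖x - a / Complex.I‖ := by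
      rw [show Complex.I * x - a = Complex.I * (x - a / Complex.I) by
        rw [mul_sub, mul_div_cancel₀ _ Complex.I_ne_zero], norm_mul, Complex.norm_I, one_mul]
    simp only [h1, norm_mul, Complex.norm_I, one_mul]

theorem stereo_notMem_iff (h : IsPotentialChart K g f u e₁ e₂ o s w z W C) {x : ℂ} :
    stereo u e₁ e₂ x ∉ nonFreePoints K ↔ ∀ p ∈ s, x ≠ z p := by
  constructor
  · rintro hx p hp rfl
    rw [h.stereo_pole p hp] at hx
    exact hx ((h.mem_iff p).1 hp).1
  · intro hx h1
    have hs := (h.mem_iff _).2 ⟨h1, h.frame.stereo_ne_neg x⟩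
    exact hx _ hs (h.frame.stereo_injective (h.stereo_pole _ hs).symm)

theorem stereo_mem (h : IsPotentialChart K g f u e₁ e₂ o s w z W C) {x : ℂ}
    (hx : ∀ p ∈ s, x ≠ z p) : stereo u e₁ e₂ x ∈ S2 \ nonFreePoints K :=
  ⟨h.frame.stereo_mem x, h.stereo_notMem_iff.2 hx⟩

theorem injOn_pole (h : IsPotentialChart K g f u e₁ e₂ o s w z W C) : Set.InjOn z s := by
  intro p hp q hq hpq
  rw [← h.stereo_pole p hp, ← h.stereo_pole q hq, hpq]

theorem pole_ne_zero (h : IsPotentialChart K g f u e₁ e₂ o s w z W C) {p : E3} (hp : p ∈ s)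
    (hpu : p ≠ u) : z p ≠ 0 := by
  intro h0
  have h1 := h.stereo_pole p hp
  rw [h0, stereo_zero] at h1
  exact hpu h1.symm

/-- The planar Hamiltonian field represents the reduced field. -/
theorem field_eq (h : IsPotentialChart K g f u e₁ e₂ o s w z W C) (ho : IsOrdering K F g f) (c : ℝ)
    {x : ℂ} (hx : ∀ p ∈ s, x ≠ z p) :
    stereoDeriv u e₁ e₂ x
      (hamField (fun x => -o * c * (1 + ‖x‖ ^ 2) ^ 2 / 4) (potGrad s w z W) x) =
      -c • cross (stereo u e₁ e₂ x) (gradient (reducedHamiltonian g f) (stereo u e₁ e₂ x)) := by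
  refine stereoDeriv_hamField h.frame (ho.differentiableAt (h.stereo_mem hx))
    ((hasFDerivAt_pot (C := C) hx).congr_of_eventuallyEq ?_)
  have h1 : ∀ᶠ y in 𝓝 x, ∀ p ∈ s, y ≠ z p := by
    rw [Filter.eventually_all_finset]
    exact fun p hp => eventually_ne_nhds (hx p hp)
  exact h1.mono fun y hy => h.eq_pot y (h.stereo_notMem_iff.2 hy)

end IsPotentialChart

/-! ### From the plane to the sphere and to the vortex problem -/

theorem HasLeastPeriod.comp_injective {α β : Type*} {φ : α → β} (hφ : Function.Injective φ)
    {x : ℝ → α} {T : ℝ} (h : HasLeastPeriod x T) : HasLeastPeriod (fun t => φ (x t)) T := by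
  have h1 : {τ : ℝ | 0 < τ ∧ ∀ t, φ (x (t + τ)) = φ (x t)} =
      {τ : ℝ | 0 < τ ∧ ∀ t, x (t + τ) = x t} := by
    simp only [hφ.eq_iff]
  unfold HasLeastPeriod
  rw [h1]
  exact h

theorem tendstoUniformly_comp {α β : Type*} [UniformSpace α] [UniformSpace β] {φ : α → β} {a : α}
    (hφ : ContinuousAt φ a) {x : ℝ → ℝ → α} {l : Filter ℝ}
    (h : TendstoUniformly x (fun _ => a) l) :
    TendstoUniformly (fun e t => φ (x e t)) (fun _ => φ a) l := by
  rw [← tendsto_prod_top_iff] at h ⊢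
  exact hφ.tendsto.comp h

theorem rho_left_injective {m k : ℕ} [NeZero m] (g : Fin m → SO3) (f : Fin k → E3) :
    Function.Injective (rho g f) := by
  intro x y hxy
  have h1 := congrFun hxy (Fin.castAdd k 0)
  rw [rho_castAdd, rho_castAdd] at h1
  exact rot_injective _ h1

theorem continuous_rho {m k : ℕ} (g : Fin m → SO3) (f : Fin k → E3) : Continuous (rho g f) :=
  continuous_pi fun i => continuous_iff_continuousAt.2 fun u =>
    (hasFDerivAt_rho g f i u).continuousAt

namespace IsPotentialChart

variable {K : Subgroup SO3} {F : Set E3} {m k : ℕ} {g : Fin m → SO3} {f : Fin k → E3}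
  {u e₁ e₂ : E3} {o : ℝ} {s : Finset E3} {w : E3 → ℝ} {z : E3 → ℂ} {W C : ℝ}

/-- Stereographic projection turns planar periodic families into periodic families of the reduced
system. -/
theorem isPeriodicFamily [NeZero m] (h : IsPotentialChart K g f u e₁ e₂ o s w z W C)
    (ho : IsOrdering K F g f) {I : Set ℝ} {l : Filter ℝ} {x : ℝ → ℝ → ℂ} {T : ℝ → ℝ}
    (hx : IsPlanarFamily (pot s w z W C) (fun x => -o * (1 / (m : ℝ)) * (1 + ‖x‖ ^ 2) ^ 2 / 4)
      (potGrad s w z W) {x | ∀ p ∈ s, x ≠ z p} I l x T) :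
    IsPeriodicFamily K g f u I l (fun e t => stereo u e₁ e₂ (x e t)) T := by
  have hred : ∀ e ∈ I, IsReducedSolution K g f fun t => stereo u e₁ e₂ (x e t) := by
    intro e he t
    have hD := (hx.mem e he t).1
    refine ⟨h.stereo_mem hD, ?_⟩
    rw [← h.field_eq ho _ hD]
    exact (hasFDerivAt_stereo u e₁ e₂ (x e t)).comp_hasDerivAt t (hx.hasDerivAt e he t)
  have hper : ∀ e ∈ I, HasLeastPeriod (fun t => stereo u e₁ e₂ (x e t)) (T e) := fun e he =>
    (hx.period e he).comp_injective h.frame.stereo_injective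
  have htends : TendstoUniformly (fun e t => stereo u e₁ e₂ (x e t)) (fun _ => u) l := by
    have := tendstoUniformly_comp (continuous_stereo u e₁ e₂).continuousAt hx.tendsto
    rwa [stereo_zero] at this
  refine ⟨hred, fun e he => ho.isVortexSolution (NeZero.ne m) (hred e he), hper,
    fun e he => (hper e he).comp_injective (rho_left_injective g f), fun e he t => ?_,
    (continuous_stereo u e₁ e₂).comp_continuousOn hx.continuousOn, htends,
    tendstoUniformly_comp (continuous_rho g f).continuousAt htends, ?_⟩
  · exact (h.eq_pot _ (h.stereo_notMem_iff.2 (hx.mem e he t).1)).trans (hx.level e he t)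
  · obtain ⟨U, hU, hU0, hUx⟩ := hx.surround
    obtain ⟨V, hV, hVU⟩ := h.frame.exists_isOpen_inter hU
    have huV : u ∈ V ∩ S2 := by
      rw [hVU]
      exact ⟨0, hU0, stereo_zero u e₁ e₂⟩
    refine ⟨V, hV, huV.1, ?_⟩
    have h1 : (V ∩ S2) \ {u} = stereo u e₁ e₂ '' (U \ {0}) := by
      rw [image_sdiff h.frame.stereo_injective, hVU, image_singleton, stereo_zero]
    rw [h1, hUx, image_iUnion₂]
    simp only [← range_comp]
    rfl

theorem zero_ne_pole (h : IsPotentialChart K g f u e₁ e₂ o s w z W C) (hu : u ∉ nonFreePoints K) :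
    ∀ p ∈ s, (0 : ℂ) ≠ z p := fun p hp =>
  (h.pole_ne_zero hp (by rintro rfl; exact hu ((h.mem_iff p).1 hp).1)).symm

theorem tendsto_stereo (h : IsPotentialChart K g f u e₁ e₂ o s w z W C) (hu : u ∉ nonFreePoints K) :
    Tendsto (stereo u e₁ e₂) (𝓝 0) (𝓝[S2 \ nonFreePoints K] u) := by
  refine tendsto_nhdsWithin_iff.2 ⟨?_, ?_⟩
  · simpa only [stereo_zero] using (continuous_stereo u e₁ e₂).tendsto 0
  · exact (eventually_ne_of_ne fun p hp => (h.zero_ne_pole hu p hp).symm).mono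
      fun x hx => h.stereo_mem hx

theorem eventually_eq_pot (h : IsPotentialChart K g f u e₁ e₂ o s w z W C)
    (hu : u ∉ nonFreePoints K) :
    (fun x => reducedHamiltonian g f (stereo u e₁ e₂ x)) =ᶠ[𝓝 0] pot s w z W C :=
  (eventually_ne_of_ne fun p hp => (h.zero_ne_pole hu p hp).symm).mono
    fun x hx => h.eq_pot x (h.stereo_notMem_iff.2 hx)

theorem eq_pot_zero (h : IsPotentialChart K g f u e₁ e₂ o s w z W C)
    (hu : u ∉ nonFreePoints K) : reducedHamiltonian g f u = pot s w z W C 0 := by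
  simpa only [stereo_zero] using (h.eventually_eq_pot hu).eq_of_nhds

theorem isLocalMin_pot (h : IsPotentialChart K g f u e₁ e₂ o s w z W C) (hu : u ∉ nonFreePoints K)
    (hmin : IsLocalMinOn (reducedHamiltonian g f) (S2 \ nonFreePoints K) u) :
    IsLocalMin (pot s w z W C) 0 := by
  have h1 := (h.tendsto_stereo hu).eventually hmin
  filter_upwards [h1, h.eventually_eq_pot hu] with x hx1 hx2
  rw [← h.eq_pot_zero hu, ← hx2]
  exact hx1

theorem isLocalMax_pot (h : IsPotentialChart K g f u e₁ e₂ o s w z W C) (hu : u ∉ nonFreePoints K)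
    (hmax : IsLocalMaxOn (reducedHamiltonian g f) (S2 \ nonFreePoints K) u) :
    IsLocalMax (pot s w z W C) 0 := by
  have h1 := (h.tendsto_stereo hu).eventually hmax
  filter_upwards [h1, h.eventually_eq_pot hu] with x hx1 hx2
  rw [← h.eq_pot_zero hu, ← hx2]
  exact hx1

/-- A critical point of the potential gives an equilibrium. -/
theorem isVortexEquilibrium [NeZero m] (h : IsPotentialChart K g f u e₁ e₂ o s w z W C)
    (ho : IsOrdering K F g f) (hu : u ∉ nonFreePoints K) (hmin : IsLocalMin (pot s w z W C) 0) :
    IsVortexEquilibrium (rho g f u) := by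
  have h0 := h.zero_ne_pole hu
  have hd : reForm (potGrad s w z W 0) = 0 := hmin.hasFDerivAt_eq_zero (hasFDerivAt_pot h0)
  have hq := eq_zero_of_reForm_eq_zero hd
  have h1 := h.field_eq ho (1 / (m : ℝ)) h0
  rw [stereo_zero, hamField, hq] at h1
  refine ho.isVortexEquilibrium (NeZero.ne m) ⟨h.frame.mem, hu⟩ ?_
  rw [← h1]
  simp

end IsPotentialChart

namespace IsOrdering

variable {K : Subgroup SO3} {F : Set E3} {m k : ℕ} {g : Fin m → SO3} {f : Fin k → E3} {u : E3}

/-- Since the sum of the second derivatives along the coordinate axes is positive, the coordinates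
can be rotated so that the second derivative along the first axis is positive. The frame is
negatively oriented, which makes the orbits around a minimum turn counterclockwise. -/
theorem exists_isPotentialChart_pos (h : IsOrdering K F g f) (hK : IsDihedralOrPolyhedral K)
    (hm : m ≠ 0) (hu : u ∈ S2 \ nonFreePoints K) :
    ∃ (e₁ e₂ : E3) (s : Finset E3) (w : E3 → ℝ) (z : E3 → ℂ) (W C : ℝ),
      IsPotentialChart K g f u e₁ e₂ (-1) s w z W C ∧ 3 ≤ s.card ∧ W = ∑ p ∈ s, w p ∧
        0 < fderiv ℝ (fun x => fderiv ℝ (pot s w z W C) x 1) 0 1 := by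
  classical
  obtain ⟨e, he⟩ := exists_frame hu.1
  obtain ⟨s, w, z, W, C, hc, hW⟩ := h.exists_isPotentialChart hm he.swap
  have hs : 3 ≤ s.card := by
    have hP : (h.finite_nonFreePoints.toFinset : Set E3) = nonFreePoints K := Finite.coe_toFinset _
    have h1 : s = h.finite_nonFreePoints.toFinset.erase (-u) := by
      ext p
      rw [hc.mem_iff, Finset.mem_erase, Finite.mem_toFinset, and_comm]
    rw [h1]
    exact hK.three_le_card_erase hP _
  have hW0 : 0 < W := by
    rw [hW hu.2]
    exact Finset.sum_pos hc.weight_pos (Finset.card_pos.1 (by omega))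
  rcases fderiv_fderiv_pot_pos_or (C := C) (fun p hp => (hc.zero_ne_pole hu.2 p hp).symm) hW0 with
    h1 | h1
  · exact ⟨_, _, s, w, z, W, C, hc, hs, hW hu.2, h1⟩
  · exact ⟨_, _, s, w, _, W, C, hc.rotate, hs, hW hu.2, h1⟩

/-- Periodic solutions near a local minimum of the reduced Hamiltonian. -/
theorem exists_isPeriodicFamily_min [NeZero m] (h : IsOrdering K F g f)
    (hK : IsDihedralOrPolyhedral K) (hu : u ∈ S2 \ nonFreePoints K)
    (hmin : IsLocalMinOn (reducedHamiltonian g f) (S2 \ nonFreePoints K) u) :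
    IsVortexEquilibrium (rho g f u) ∧
      ∃ ε > 0, ∃ (v : ℝ → ℝ → E3) (T : ℝ → ℝ),
        IsPeriodicFamily K g f u
          (Ioo (reducedHamiltonian g f u) (reducedHamiltonian g f u + ε))
          (𝓝[>] (reducedHamiltonian g f u)) v T := by
  obtain ⟨e₁, e₂, s, w, z, W, C, hc, hs, hW, haa⟩ :=
    h.exists_isPotentialChart_pos hK (NeZero.ne m) hu
  have hmin' := hc.isLocalMin_pot hu.2 hmin
  have hz0 : ∀ p ∈ s, z p ≠ 0 := fun p hp => (hc.zero_ne_pole hu.2 p hp).symm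
  have hmpos : (0 : ℝ) < m := by exact_mod_cast NeZero.pos m
  refine ⟨hc.isVortexEquilibrium h hu.2 hmin', ?_⟩
  obtain ⟨ε, hε, x, T, hx⟩ := exists_planarFamily_min hs hc.weight_pos hc.injOn_pole hz0 hW
    (κ := fun x => -(-1) * (1 / (m : ℝ)) * (1 + ‖x‖ ^ 2) ^ 2 / 4) (by fun_prop)
    (fun x => by rw [neg_neg]; positivity) (D := {x | ∀ p ∈ s, x ≠ z p}) (fun x hx => hx)
    ((eventually_ne_of_ne hz0).filter_mono nhdsWithin_le_nhds) haa hmin'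
  rw [hc.eq_pot_zero hu.2]
  exact ⟨ε, hε, _, T, hc.isPeriodicFamily h hx⟩

/-- The reduced Hamiltonian is strictly subharmonic in stereographic coordinates, hence it has no
local maximum. -/
theorem not_isLocalMaxOn [NeZero m] (h : IsOrdering K F g f) (hK : IsDihedralOrPolyhedral K)
    (hu : u ∈ S2 \ nonFreePoints K) :
    ¬ IsLocalMaxOn (reducedHamiltonian g f) (S2 \ nonFreePoints K) u := by
  obtain ⟨e₁, e₂, s, w, z, W, C, hc, hs, hW, haa⟩ :=
    h.exists_isPotentialChart_pos hK (NeZero.ne m) hu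
  exact fun hmax => not_isLocalMax_pot (fun p hp => (hc.zero_ne_pole hu.2 p hp).symm) haa
    (hc.isLocalMax_pot hu.2 hmax)

/-- Periodic solutions near a symmetric collision. -/
theorem exists_isPeriodicFamily_collision [NeZero m] (h : IsOrdering K F g f)
    (hu : u ∈ nonFreePoints K) :
    ∃ (e₀ : ℝ) (v : ℝ → ℝ → E3) (T : ℝ → ℝ),
      IsPeriodicFamily K g f u (Ioi e₀) atTop v T ∧ Tendsto T atTop (𝓝 0) := by
  -- at a pole the energy decreases outwards, so here the frame is positively oriented
  obtain ⟨e, he⟩ := exists_frame hu.1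
  obtain ⟨s, w, z, W, C, hc, -⟩ := h.exists_isPotentialChart (NeZero.ne m) he
  have hus : u ∈ s := (hc.mem_iff u).2 ⟨hu, ne_neg_of_mem_S2 hu.1⟩
  have hzu : z u = 0 := he.stereo_injective (by rw [hc.stereo_pole u hus, stereo_zero])
  have hz0 : ∀ p ∈ s, p ≠ u → z p ≠ 0 := fun p hp => hc.pole_ne_zero hp
  have hmpos : (0 : ℝ) < m := by exact_mod_cast NeZero.pos m
  have hD0 : ∀ᶠ x in 𝓝[≠] (0 : ℂ), ∀ p ∈ s, x ≠ z p := by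
    rw [Filter.eventually_all_finset]
    intro p hp
    by_cases hpu : p = u
    · rw [hpu, hzu]
      exact eventually_mem_nhdsWithin
    · exact (eventually_ne_nhds (hz0 p hp hpu).symm).filter_mono nhdsWithin_le_nhds
  obtain ⟨e₀, x, T, hx, hT⟩ := exists_planarFamily_pole hus (hc.weight_pos u hus) hzu hz0
    (κ := fun x => -1 * (1 / (m : ℝ)) * (1 + ‖x‖ ^ 2) ^ 2 / 4) (by fun_prop)
    (fun x => by
      have : 0 < 1 * (1 / (m : ℝ)) * (1 + ‖x‖ ^ 2) ^ 2 / 4 := by positivity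
      linarith) (D := {x | ∀ p ∈ s, x ≠ z p}) (fun x hx => hx) hD0 (W := W) (C := C)
  exact ⟨e₀, _, T, hc.isPeriodicFamily h hx, hT⟩

end IsOrdering

end VortexSphere

/-- Here `K` is one of the groups `𝔻_n` (`n ≥ 2`), `𝕋`, `𝕆`, `𝕀` in `SO(3)`, `F ⊆ 𝓕[K]` is
`K`-invariant, `g` is an ordering of `K` starting with the identity and `f` an ordering of `F`. -/
theorem corollary3p9 (K : Subgroup SO3) (hK : IsDihedralOrPolyhedral K)
    (F : Set E3) (hF : F ⊆ nonFreePoints K) (hFK : ∀ a ∈ K, ∀ x ∈ F, rot a x ∈ F)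
    (m k : ℕ) [NeZero m]
    (g : Fin m → SO3) (hg : Function.Injective g) (hgK : range g = (K : Set SO3)) (hg1 : g 0 = 1)
    (f : Fin k → E3) (hf : Function.Injective f) (hfF : range f = F)
    (u₀ : E3) :
    (u₀ ∈ S2 \ nonFreePoints K →
      (IsLocalMinOn (reducedHamiltonian g f) (S2 \ nonFreePoints K) u₀ →
        IsVortexEquilibrium (rho g f u₀) ∧
        ∃ ε > 0, ∃ (u : ℝ → ℝ → E3) (T : ℝ → ℝ),
          IsPeriodicFamily K g f u₀
            (Ioo (reducedHamiltonian g f u₀) (reducedHamiltonian g f u₀ + ε))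
            (𝓝[>] (reducedHamiltonian g f u₀)) u T) ∧
      (IsLocalMaxOn (reducedHamiltonian g f) (S2 \ nonFreePoints K) u₀ →
        IsVortexEquilibrium (rho g f u₀) ∧
        ∃ ε > 0, ∃ (u : ℝ → ℝ → E3) (T : ℝ → ℝ),
          IsPeriodicFamily K g f u₀
            (Ioo (reducedHamiltonian g f u₀ - ε) (reducedHamiltonian g f u₀))
            (𝓝[<] (reducedHamiltonian g f u₀)) u T)) ∧
    (u₀ ∈ nonFreePoints K →
      IsSymmetricCollision K F g f u₀ ∧
      ∃ (e₀ : ℝ) (u : ℝ → ℝ → E3) (T : ℝ → ℝ),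
        IsPeriodicFamily K g f u₀ (Ioi e₀) atTop u T ∧ Tendsto T atTop (𝓝 0)) := by
  have h : IsOrdering K F g f := ⟨hg, hgK, hf, hfF, hF, hFK⟩
  exact ⟨fun hu => ⟨h.exists_isPeriodicFamily_min hK hu,
      fun hmax => absurd hmax (h.not_isLocalMaxOn hK hu)⟩,
    fun hu => ⟨h.isSymmetricCollision hu, h.exists_isPeriodicFamily_collision hu⟩⟩
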